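/- Path-flows. Let $G$ be a finite graph with edge set $\mathcal E$. A path-flow on $G$ is a finite nonnegative measure $\mu$ on the countable set of finite oriented paths $\sigma=(v_0,\dots,v_k)$, $k\ge 0$, in $G$. Its transportation measure $\mathrm{tra}(\mu)$ is the push-forward of $\mu$ under $\sigma\mapsto(v_0,v_k)$, and its flow-volume is $\mathrm{flo}(\mu)(e)=\int n(\sigma,e)\,\mu(d\sigma)$, where $n(\sigma,e)$ is the number of times that $\sigma$ crosses $e$ in either direction. An environment is a family $\mathbf c=(c(e))_{e\in\mathcal E}$ of nonnegative reals, and $\mathrm{cost}(\mathbf f,\mathbf c)=\sum_{e\in\mathcal E} c(e)f(e)^2$. Infima over the empty set are $+\infty$. Torus. Let $\mathcal T_N^2$ be the discrete $N\times N$ torus. For $B>0$ let $\mathrm{cost}_{(N)}(\mathbf c,B)$ be the infimum of $\mathrm{cost}(\mathrm{flo}(\mu),\mathbf c)$ over path-flows $\mu$ on $\mathcal T_N^2$ with $\mathrm{tra}(\mu)(v,w)=N^{-3}$ for all vertices $v,w$ and $\mathrm{flo}(\mu)(e)\le B$ for all edges $e$. Square. The extended $M\times M$ square is the lattice square $[0,M-1]^2\subset\mathbb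 Z^2$ together with the half-edges that lead from it to the $4M$ boundary points $(-\tfrac12,j)$, $(M-\tfrac12,j)$, $(i,-\tfrac12)$, $(i,M-\tfrac12)$, $0\le i,j\le M-1$. Let $\mathrm{Bou}_M$ be the set of boundary points and $b\mapsto b^{\mathrm{reflect}}$ the left-right, respectively top-bottom, reflection on it. Let $\mathcal Q_M$ be the set of finite measures $Q$ on $\mathrm{Bou}_M\times\mathrm{Bou}_M$ such that the push-forward of the second marginal under $b\mapsto b^{\mathrm{reflect}}$ equals the first marginal, and put $\mathrm{drift}(Q)=M^{-2}\sum_{b_1,b_2}(b_2-b_1)Q(b_1,b_2)\in\mathbb R^2$. Let $\mathcal Q_M^{\mathrm{iso}}$ be the set of finite measures $Q_0=\int_{\mathcal Q_M}Q\,\psi(dQ)$, where $\psi$ is a probability distribution on $\mathcal Q_M$ under which $\mathrm{drift}(Q)$ modulo $(1,1)$ is uniformly distributed on $[0,1)^2$. For a finite measure $Q$ on $\mathrm{Bou}_M\times\mathrm{Bou}_M$ let $\mathrm{cost}_{M,B}(Q,\mathbf c)$ be the infimum of $\mathrm{cost}(\mathrm{flo}(\mu),\mathbf c)$ over path-flows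 $\mu$ on the extended $M\times M$ square with $\mathrm{tra}(\mu)=Q$ and $\mathrm{flo}(\mu)(e)\le B$ for all edges $e$. Random environment. Let $\kappa$ be a probability distribution with $\kappa[0,c^*]=1$ for some $0<c^*<\infty$. On the torus the $c(e)$ are i.i.d. with law $\kappa$. On the extended square the $c(e)$ are i.i.d. with law $\kappa$ on the internal edges and on the half-edges at the left and bottom sides, and $c(e)=0$ on the half-edges at the right and top sides. Put $c_{M,B}=\inf\{\mathbb E\,\mathrm{cost}_{M,B}(Q,\mathbf c):Q\in\mathcal Q_M^{\mathrm{iso}}\}$. Proposition. Let $B>\tfrac14$. Then for every $B''>B$, $$\limsup_{M\to\infty} M^{-2}c_{M,B''}\;\le\;\liminf_{N\to\infty}N^{-2}\,\mathbb E\,\mathrm{cost}_{(N)}(\mathbf c,B).$$ -/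

import Mathlib

open scoped NNReal ENNReal

noncomputable section

namespace LatticeFlow

/-! ### Path-flows on a graph -/

/-- A finite oriented path `(v₀, …, v_k)`, `k ≥ 0`, in `G`, with entrance `v₀` and exit `v_k`. -/
structure FinPath {V : Type*} (G : SimpleGraph V) where
  ent : V
  exi : V
  walk : G.Walk ent exi

/-- The set of finite paths of a finite graph is countable, so measures on it are taken on all
subsets. -/
instance {V : Type*} (G : SimpleGraph V) : MeasurableSpace (FinPath G) := ⊤

section Graph

variable {V : Type*} {G : SimpleGraph V}

/-- `n(σ, e)`: the number of times that `e` occurs, in either direction, in `σ`. -/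
def FinPath.crossings [DecidableEq V] (σ : FinPath G) (e : G.edgeSet) : ℕ :=
  σ.walk.edges.count (e : Sym2 V)

/-- Point masses of the transportation measure of the path-flow `μ`. -/
def tra (μ : MeasureTheory.Measure (FinPath G)) (v w : V) : ℝ≥0∞ :=
  μ {σ | σ.ent = v ∧ σ.exi = w}

/-- The flow-volume of the path-flow `μ`. -/
def flo [DecidableEq V] (μ : MeasureTheory.Measure (FinPath G)) (e : G.edgeSet) : ℝ≥0∞ :=
  ∫⁻ σ, (σ.crossings e : ℝ≥0∞) ∂μ

/-- An environment: a nonnegative cost-factor for each edge. -/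
abbrev Environment (G : SimpleGraph V) : Type _ := G.edgeSet → ℝ≥0

/-- The cost `∑ₑ c(e) f(e)²` of the flow-volume `f` in the environment `c`. -/
def cost [Fintype G.edgeSet] (f : G.edgeSet → ℝ≥0∞) (c : Environment G) : ℝ≥0∞ :=
  ∑ e, (c e : ℝ≥0∞) * f e ^ 2

/-- The least cost of a path-flow with transportation measure `T` and with flow-volume at most
`B` across every edge; it is `∞` if there is no such path-flow. -/
def minCost [DecidableEq V] [Fintype G.edgeSet] (T : V → V → ℝ≥0∞) (B : ℝ≥0)
    (c : Environment G) : ℝ≥0∞ :=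
  ⨅ (μ : MeasureTheory.Measure (FinPath G)) (_ : MeasureTheory.IsFiniteMeasure μ)
    (_ : tra μ = T) (_ : ∀ e, flo μ e ≤ B), cost (flo μ) c

end Graph

/-! ### The torus -/

/-- The discrete `N × N` torus. -/
abbrev torus (N : ℕ) : SimpleGraph (Fin N × Fin N) :=
  (SimpleGraph.cycleGraph N).boxProd (SimpleGraph.cycleGraph N)

instance (N : ℕ) : Fintype (torus N).edgeSet := Fintype.ofFinite _

/-- The least cost of a standardized global flow (volume `N⁻³` between every ordered pair of
vertices) that satisfies the capacity constraint `f(e) ≤ B`. -/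
def torusCost (N : ℕ) (B : ℝ≥0) (c : Environment (torus N)) : ℝ≥0∞ :=
  minCost (fun _ _ => ((N : ℝ≥0∞) ^ 3)⁻¹) B c

/-- The law of an i.i.d. environment on the torus. -/
def torusLaw (κ : MeasureTheory.Measure ℝ≥0) (N : ℕ) :
    MeasureTheory.Measure (Environment (torus N)) :=
  MeasureTheory.Measure.pi fun _ => κ

/-- The expectation of the minimum cost on the torus in the i.i.d. environment. -/
def expTorusCost (κ : MeasureTheory.Measure ℝ≥0) (N : ℕ) (B : ℝ≥0) : ℝ≥0∞ :=
  ∫⁻ c, torusCost N B c ∂torusLaw κ N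

/-! ### The extended square -/

/-- The four sides of a square. -/
inductive Side
  | left
  | right
  | bottom
  | top
  deriving DecidableEq

instance : Fintype Side where
  elems := {.left, .right, .bottom, .top}
  complete := by rintro (_ | _ | _ | _) <;> simp

/-- The `4M` boundary points of the `M × M` square: a side and the coordinate along it. -/
abbrev Bou (M : ℕ) : Type := Side × Fin M

/-- The vertices of the extended `M × M` square: internal vertices and boundary points. -/
abbrev SqVertex (M : ℕ) : Type := (Fin M × Fin M) ⊕ Bou M

/-- The internal vertex `p` is the end of the boundary half-edge at the boundary point. -/
def Attached {M : ℕ} (p : Fin M × Fin M) : Bou M → Prop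
  | (.left, j) => (p.1 : ℕ) = 0 ∧ p.2 = j
  | (.right, j) => (p.1 : ℕ) + 1 = M ∧ p.2 = j
  | (.bottom, i) => (p.2 : ℕ) = 0 ∧ p.1 = i
  | (.top, i) => (p.2 : ℕ) + 1 = M ∧ p.1 = i

/-- The adjacency relation of the extended `M × M` square. -/
def SqAdj {M : ℕ} : SqVertex M → SqVertex M → Prop
  | .inl p, .inl q => ((SimpleGraph.pathGraph M).boxProd (SimpleGraph.pathGraph M)).Adj p q
  | .inl p, .inr b => Attached p b
  | .inr b, .inl p => Attached p b
  | .inr _, .inr _ => False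

/-- The extended `M × M` square: the square `[0, M-1]²` of the lattice together with a half-edge
from each of the `4M` boundary points. -/
def extSquare (M : ℕ) : SimpleGraph (SqVertex M) where
  Adj := SqAdj
  symm := ⟨by
    rintro (p | b) (q | b') h
    · exact SimpleGraph.Adj.symm h
    · exact h
    · exact h
    · exact h⟩
  loopless := ⟨by
    rintro (p | b) h
    · exact SimpleGraph.irrefl _ h
    · exact h⟩

instance (M : ℕ) : Fintype (extSquare M).edgeSet := Fintype.ofFinite _

/-- The position in the plane of a boundary point. -/
def Bou.pos {M : ℕ} : Bou M → ℝ × ℝ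
  | (.left, j) => (-(1 / 2), (j : ℕ))
  | (.right, j) => ((M : ℝ) - 1 / 2, (j : ℕ))
  | (.bottom, i) => ((i : ℕ), -(1 / 2))
  | (.top, i) => ((i : ℕ), (M : ℝ) - 1 / 2)

/-- Reflection of boundary points, left-to-right or top-to-bottom. -/
def Bou.reflect {M : ℕ} : Bou M → Bou M
  | (.left, j) => (.right, j)
  | (.right, j) => (.left, j)
  | (.bottom, i) => (.top, i)
  | (.top, i) => (.bottom, i)

/-! ### Transportation measures across the square -/

/-- Finite measures on `Bou_M × Bou_M`, given by their point masses. -/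
abbrev Transport (M : ℕ) : Type := Bou M × Bou M → ℝ≥0

/-- The entrance marginal. -/
def Transport.ent {M : ℕ} (Q : Transport M) (b : Bou M) : ℝ≥0 := ∑ b', Q (b, b')

/-- The exit marginal. -/
def Transport.exi {M : ℕ} (Q : Transport M) (b : Bou M) : ℝ≥0 := ∑ b', Q (b', b)

/-- The set `𝒬_M` of transportation measures for which the push-forward of the exit marginal under
reflection equals the entrance marginal. -/
def compatible (M : ℕ) : Set (Transport M) :=
  {Q | ∀ b, ∑ b' with Bou.reflect b' = b, Q.exi b' = Q.ent b}

/-- `drift(Q) = M⁻² ∑_{b₁, b₂} (b₂ - b₁) Q(b₁, b₂)`. -/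
def Transport.drift {M : ℕ} (Q : Transport M) : ℝ × ℝ :=
  (1 / (M : ℝ) ^ 2) • ∑ b₁, ∑ b₂, (Q (b₁, b₂) : ℝ) • (Bou.pos b₂ - Bou.pos b₁)

/-- `drift(Q)` modulo `(1, 1)`, a point of `[0, 1)²`. -/
def Transport.driftMod {M : ℕ} (Q : Transport M) : ℝ × ℝ :=
  (Int.fract Q.drift.1, Int.fract Q.drift.2)

/-- `Q₀` is isotropic: it is a mixture of elements of `𝒬_M` under a probability distribution `ψ`
for which the drift modulo `(1, 1)` is uniformly distributed on `[0, 1)²`. -/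
def IsIsotropic {M : ℕ} (Q₀ : Transport M) : Prop :=
  ∃ ψ : MeasureTheory.Measure (Transport M), MeasureTheory.IsProbabilityMeasure ψ ∧
    (∀ᵐ Q ∂ψ, Q ∈ compatible M) ∧
    (∀ b, (Q₀ b : ℝ≥0∞) = ∫⁻ Q, (Q b : ℝ≥0∞) ∂ψ) ∧
    ψ.map Transport.driftMod =
      MeasureTheory.volume.restrict (Set.Ico (0 : ℝ) 1 ×ˢ Set.Ico (0 : ℝ) 1)

/-- `Q` as a measure on pairs of vertices of the extended square, carried by pairs of boundary
points. -/
def Transport.onVertices {M : ℕ} (Q : Transport M) : SqVertex M → SqVertex M → ℝ≥0∞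
  | .inr b, .inr b' => Q (b, b')
  | _, _ => 0

/-- `cost_{M,B}(Q, c)`: the least cost of a path-flow across the square with transportation
measure `Q` and flow-volume at most `B` across every edge. -/
def squareCost (M : ℕ) (B : ℝ≥0) (Q : Transport M) (c : Environment (extSquare M)) : ℝ≥0∞ :=
  minCost Q.onVertices B c

/-- The edge ends at a boundary point on the right or on the top side. -/
def IsRightTop {M : ℕ} (e : (extSquare M).edgeSet) : Prop :=
  ∃ j : Fin M, (Sum.inr (Side.right, j) : SqVertex M) ∈ (e : Sym2 (SqVertex M)) ∨
    (Sum.inr (Side.top, j) : SqVertex M) ∈ (e : Sym2 (SqVertex M))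

open Classical in
/-- The law of the environment on the extended square: the cost-factors are independent, zero on
the half-edges at the right and top sides, and with law `κ` on all other edges. -/
def squareLaw (κ : MeasureTheory.Measure ℝ≥0) (M : ℕ) :
    MeasureTheory.Measure (Environment (extSquare M)) :=
  MeasureTheory.Measure.pi fun e => if IsRightTop e then MeasureTheory.Measure.dirac 0 else κ

/-- `c_{M,B}`: the infimum over isotropic `Q` of the expectation of `cost_{M,B}(Q, c)`. -/
def cInf (κ : MeasureTheory.Measure ℝ≥0) (M : ℕ) (B : ℝ≥0) : ℝ≥0∞ :=
  ⨅ (Q : Transport M) (_ : IsIsotropic Q), ∫⁻ c, squareCost M B Q c ∂squareLaw κ M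

end LatticeFlow

end

/-! A cheap flow in a large torus induces, inside a square at a uniformly random position, a flow
across the square. Its mean transportation measure is almost isotropic and its mean cost is `M² /
N²` times the torus cost, up to small errors. So `M` is fixed, `N` is taken as large as needed among
those that nearly attain the lower limit, and a nearly optimal torus flow is chosen measurably in
the environment (`exists_measurable_weights`).

Geometry. Each torus path is cut where it enters and leaves the square (`exists_isCut`). Pieces that
start or end inside are completed to a fixed corner; since every vertex is the start of mass `1 / N`
and the end of mass `1 / N`, this concerns only mass of order `M² / N`. Summed over all positions,
the entrances through a boundary point and the exits through its reflection both count the steps of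
the path in one direction, which gives compatibility after a correction at one corner. The drift of
a path is its displacement divided by `N`, modulo integers. Displacements are uniform on the `N × N`
grid, so a correction of size at most `1 / N` makes the drift uniform on the unit square
(`exists_isIsotropic`). Every torus edge is counted in `M²` of the `N²` positions
(`sum_placeEdge_le`), which gives the cost.

Decoupling. The induced flow depends on the environment, whereas `cInf` asks for one deterministic
`Q`. Convexity (`minCost_convex`) bounds the cost of the mean transportation measure by the mean
cost of the random one, but in an environment independent of it. To return to the environment that
produced the flow, concentration is needed simultaneously for all transportation measures that may
occur. The flow is therefore replaced by `n` independently drawn paths of equal mass. Their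
transportation measure depends only on the end points, hence takes at most `(v² + 1) ^ n` values,
where `v` is the number of vertices; a Chernoff bound keeps every flow-volume within `ξ` of its
value outside an event of small probability (`sum_bad_le`). Bounded differences with a union bound
over these values give the simultaneous estimate (`exists_deviation_bound`), and
`lintegral_minCost_expectation_le` combines everything.

Balance. The flow across the square has mass of order `M`. With `n = M * Nat.sqrt M` the sampling
failure is of order `exp (-a √M)` times a power of `M`, while the logarithm of the number of values
is of order `M ^ (3/2) log M`, negligible against `M²` (`exists_decoupleError_le`). The capacity
grows by an arbitrarily small amount, whence `B < B''`. -/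

noncomputable section

namespace LatticeFlow

open MeasureTheory

/-! ### Finitely supported path-flows -/

section Weights

variable {V : Type*} {G : SimpleGraph V}

/-- The finite paths without repeated vertices. -/
abbrev SimplePath (G : SimpleGraph V) : Type _ := {σ : FinPath G // σ.walk.IsPath}

theorem FinPath.ext_support {σ τ : FinPath G} (h : σ.walk.support = τ.walk.support) : σ = τ := by
  obtain ⟨u, v, p⟩ := σ
  obtain ⟨u', v', q⟩ := τ
  simp only at h
  have hu : u = u' := by
    have h1 := p.head_support
    have h2 := q.head_support
    simp only [h] at h1
    exact h1.symm.trans h2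
  have hv : v = v' := by
    have h1 := p.getLast_support
    have h2 := q.getLast_support
    simp only [h] at h1
    exact h1.symm.trans h2
  subst hu hv
  rw [SimpleGraph.Walk.ext_support h]

/-- A path is determined by its list of vertices, and there are finitely many lists without
repetition. This reduces path-flows to finite weight vectors. -/
instance [Fintype V] [DecidableEq V] : Finite (SimplePath G) := by
  refine Finite.of_injective
    (fun σ : SimplePath G => (⟨σ.1.walk.support, σ.2.support_nodup⟩ : {l : List V // l.Nodup})) ?_
  intro σ τ h
  exact Subtype.ext (FinPath.ext_support (congrArg Subtype.val h))

instance [Fintype V] [DecidableEq V] : Fintype (SimplePath G) := Fintype.ofFinite _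

instance : DecidableEq (SimplePath G) := Classical.decEq _

/-- Deletion of the loops of a path. -/
def FinPath.simplify [DecidableEq V] (σ : FinPath G) : SimplePath G :=
  ⟨⟨σ.ent, σ.exi, σ.walk.bypass⟩, σ.walk.bypass_isPath⟩

@[simp] theorem FinPath.simplify_ent [DecidableEq V] (σ : FinPath G) :
    σ.simplify.1.ent = σ.ent := rfl

@[simp] theorem FinPath.simplify_exi [DecidableEq V] (σ : FinPath G) :
    σ.simplify.1.exi = σ.exi := rfl

theorem FinPath.crossings_simplify_le [DecidableEq V] (σ : FinPath G) (e : G.edgeSet) :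
    σ.simplify.1.crossings e ≤ σ.crossings e :=
  σ.walk.edges_bypass_sublist_edges.count_le _

theorem SimplePath.crossings_le_one [DecidableEq V] (σ : SimplePath G) (e : G.edgeSet) :
    σ.1.crossings e ≤ 1 :=
  List.nodup_iff_count_le_one.1 σ.2.isTrail.edges_nodup _

/-- The cost of a finite flow-volume. -/
def nncost [Fintype G.edgeSet] (f : G.edgeSet → ℝ≥0) (c : Environment G) : ℝ≥0 :=
  ∑ e, c e * f e ^ 2

variable [DecidableEq V]

theorem minCost_le_of_weights [Fintype G.edgeSet] {ι : Type*} [Fintype ι] (σ : ι → FinPath G)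
    (x : ι → ℝ≥0) (T : V → V → ℝ≥0∞)
    (hT : ∀ v w, ((∑ i, if (σ i).ent = v ∧ (σ i).exi = w then x i else 0 : ℝ≥0) : ℝ≥0∞) = T v w)
    (B : ℝ≥0) (hB : ∀ e, ∑ i, x i * ((σ i).crossings e : ℝ≥0) ≤ B) (c : Environment G) :
    minCost T B c ≤ (nncost (fun e => ∑ i, x i * ((σ i).crossings e : ℝ≥0)) c : ℝ≥0) := by
  let μ : Measure (FinPath G) := ∑ i, (x i : ℝ≥0∞) • Measure.dirac (σ i)
  have happ : ∀ s : Set (FinPath G), μ s = ∑ i, (x i : ℝ≥0∞) * s.indicator 1 (σ i) := by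
    intro s
    simp [μ, Measure.finsetSum_apply, Measure.dirac_apply' _ (MeasurableSpace.measurableSet_top)]
    rfl
  have hflo : ∀ e, flo μ e = ((∑ i, x i * ((σ i).crossings e : ℝ≥0) : ℝ≥0) : ℝ≥0∞) := by
    intro e
    simp only [flo, μ]
    rw [lintegral_finsetSum_measure]
    push_cast
    refine Finset.sum_congr rfl fun i _ => ?_
    rw [lintegral_smul_measure, lintegral_dirac' _ measurable_from_top, smul_eq_mul]
  have hfin : IsFiniteMeasure μ := ⟨by
    rw [happ]
    simp only [Set.indicator_univ, Pi.one_apply, mul_one]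
    exact ENNReal.sum_lt_top.2 fun i _ => ENNReal.coe_lt_top⟩
  have htra : tra μ = T := by
    funext v w
    rw [← hT, tra, happ]
    push_cast
    refine Finset.sum_congr rfl fun i _ => ?_
    by_cases h : (σ i).ent = v ∧ (σ i).exi = w
    · simp [Set.indicator, h]
    · simp [Set.indicator, h]
  have hcap : ∀ e, flo μ e ≤ B := fun e => by rw [hflo]; exact_mod_cast hB e
  refine (iInf_le_of_le μ <| iInf_le_of_le hfin <| iInf_le_of_le htra <|
    iInf_le_of_le hcap le_rfl).trans (le_of_eq ?_)
  simp [cost, nncost, hflo]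

variable [Fintype V]

/-- The flow-volume of a weighted family of simple paths. -/
def vol (x : SimplePath G → ℝ≥0) (e : G.edgeSet) : ℝ≥0 := ∑ σ, x σ * (σ.1.crossings e : ℝ≥0)

/-- The transportation measure of a weighted family of simple paths. -/
def trans (x : SimplePath G → ℝ≥0) (v w : V) : ℝ≥0 :=
  ∑ σ, if σ.1.ent = v ∧ σ.1.exi = w then x σ else 0

theorem minCost_le_of_simple [Fintype G.edgeSet] (x : SimplePath G → ℝ≥0) (B : ℝ≥0)
    (hB : ∀ e, vol x e ≤ B) (c : Environment G) :
    minCost (fun v w => (trans x v w : ℝ≥0∞)) B c ≤ (nncost (vol x) c : ℝ≥0) :=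
  minCost_le_of_weights (fun σ : SimplePath G => σ.1) x _ (fun _ _ => rfl) B hB c

/-- Push the measure forward under loop deletion: end points are kept and no edge is crossed more
often. -/
theorem exists_weights_of_measure [Fintype G.edgeSet] (μ : Measure (FinPath G))
    [IsFiniteMeasure μ] :
    ∃ x : SimplePath G → ℝ≥0, (∀ v w, (trans x v w : ℝ≥0∞) = tra μ v w) ∧
      ∀ e, (vol x e : ℝ≥0∞) ≤ flo μ e := by
  let s : FinPath G → SimplePath G := FinPath.simplify
  have hx : ∀ σ, (((μ (s ⁻¹' {σ})).toNNReal : ℝ≥0) : ℝ≥0∞) = μ (s ⁻¹' {σ}) := fun σ =>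
    ENNReal.coe_toNNReal (measure_ne_top _ _)
  refine ⟨fun σ => (μ (s ⁻¹' {σ})).toNNReal, fun v w => ?_, fun e => ?_⟩
  · have : {σ : FinPath G | σ.ent = v ∧ σ.exi = w} =
        s ⁻¹' ((Finset.univ.filter fun σ : SimplePath G => σ.1.ent = v ∧ σ.1.exi = w :
          Finset (SimplePath G)) : Set (SimplePath G)) := by
      ext σ
      simp [s]
    rw [tra, this, ← sum_measure_preimage_singleton _
      (fun _ _ => MeasurableSpace.measurableSet_top), Finset.sum_filter, trans]
    push_cast
    refine Finset.sum_congr rfl fun σ _ => ?_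
    split_ifs with h
    · exact hx σ
    · simp
  · have h1 : ∀ τ : FinPath G, ((s τ).1.crossings e : ℝ≥0∞) ≤ τ.crossings e := fun τ => by
      exact_mod_cast τ.crossings_simplify_le e
    refine le_trans ?_ (lintegral_mono h1)
    have h2 : ∀ τ : FinPath G, ((s τ).1.crossings e : ℝ≥0∞) =
        ∑ σ, (s ⁻¹' {σ}).indicator (fun _ => (σ.1.crossings e : ℝ≥0∞)) τ := by
      intro τ
      rw [Finset.sum_eq_single (s τ)]
      · simp
      · intro b _ hb
        simp [Set.indicator, hb.symm]
      · simp
    simp only [h2]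
    rw [lintegral_finsetSum _ fun _ _ => measurable_from_top, vol]
    push_cast
    refine Finset.sum_le_sum fun σ _ => ?_
    rw [lintegral_indicator MeasurableSpace.measurableSet_top, setLIntegral_const, hx, mul_comm]

theorem exists_weights_of_minCost [Fintype G.edgeSet] {T : V → V → ℝ≥0∞} {B : ℝ≥0}
    {c : Environment G} (h : minCost T B c ≠ ∞) {η : ℝ≥0} (hη : 0 < η) :
    ∃ x : SimplePath G → ℝ≥0, (∀ v w, (trans x v w : ℝ≥0∞) = T v w) ∧ (∀ e, vol x e ≤ B) ∧
      (nncost (vol x) c : ℝ≥0∞) ≤ minCost T B c + η := by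
  have hlt : minCost T B c < minCost T B c + η := ENNReal.lt_add_right h (by simpa using hη.ne')
  conv_lhs at hlt => rw [minCost]
  simp only [iInf_lt_iff] at hlt
  obtain ⟨μ, hμ, hT, hB, hc⟩ := hlt
  obtain ⟨x, hxT, hxv⟩ := exists_weights_of_measure μ
  refine ⟨x, fun v w => by rw [hxT, hT], fun e => ?_, le_trans ?_ hc.le⟩
  · exact_mod_cast (hxv e).trans (hB e)
  · simp only [nncost, cost]
    push_cast
    gcongr with e
    exact hxv e

/-- Feasibility does not depend on the environment. -/
theorem minCost_ne_top_of_ne_top [Fintype G.edgeSet] {T : V → V → ℝ≥0∞} {B : ℝ≥0}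
    {c c' : Environment G} (h : minCost T B c ≠ ∞) : minCost T B c' ≠ ∞ := by
  obtain ⟨x, hT, hB, -⟩ := exists_weights_of_minCost h one_pos
  have : (fun v w => (trans x v w : ℝ≥0∞)) = T := by funext v w; exact hT v w
  have h2 := minCost_le_of_simple x B hB c'
  rw [this] at h2
  exact ne_top_of_le_ne_top ENNReal.coe_ne_top h2

theorem minCost_le_mul_card [Fintype G.edgeSet] (x : SimplePath G → ℝ≥0) (B cs : ℝ≥0)
    (hB : ∀ e, vol x e ≤ B) (c : Environment G) (hc : ∀ e, c e ≤ cs) :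
    minCost (fun v w => (trans x v w : ℝ≥0∞)) B c ≤ (cs * Fintype.card G.edgeSet * B ^ 2 : ℝ≥0) := by
  refine (minCost_le_of_simple x B hB c).trans ?_
  rw [ENNReal.coe_le_coe]
  calc nncost (vol x) c ≤ ∑ _e : G.edgeSet, cs * B ^ 2 := by
        refine Finset.sum_le_sum fun e _ => ?_
        gcongr
        · exact hc e
        · exact hB e
    _ = _ := by rw [Finset.sum_const, Finset.card_univ, nsmul_eq_mul]; ring

/-- A nearly optimal flow for `c` is also a competitor for `c'`, and the capacity bounds each
squared volume by `B ^ 2`. All regularity of the cost in the environment comes from this estimate.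
-/
theorem minCost_le_add [Fintype G.edgeSet] (T : V → V → ℝ≥0∞) (B : ℝ≥0) (c c' : Environment G)
    (d : G.edgeSet → ℝ≥0) (h : ∀ e, c' e ≤ c e + d e) :
    minCost T B c' ≤ minCost T B c + ((∑ e, d e) * B ^ 2 : ℝ≥0) := by
  by_cases hc : minCost T B c = ∞
  · simp [hc]
  refine ENNReal.le_of_forall_pos_le_add fun η hη _ => ?_
  obtain ⟨x, hT, hB, hx⟩ := exists_weights_of_minCost hc hη
  have hTT : (fun v w => (trans x v w : ℝ≥0∞)) = T := by funext v w; exact hT v w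
  have h2 := minCost_le_of_simple x B hB c'
  rw [hTT] at h2
  have h3 : nncost (vol x) c' ≤ nncost (vol x) c + (∑ e, d e) * B ^ 2 := by
    rw [nncost, nncost, Finset.sum_mul, ← Finset.sum_add_distrib]
    refine Finset.sum_le_sum fun e _ => ?_
    calc c' e * vol x e ^ 2 ≤ (c e + d e) * vol x e ^ 2 := by gcongr; exact h e
      _ = c e * vol x e ^ 2 + d e * vol x e ^ 2 := by ring
      _ ≤ _ := by gcongr; exact hB e
  calc minCost T B c' ≤ (nncost (vol x) c' : ℝ≥0) := h2
    _ ≤ ((nncost (vol x) c + (∑ e, d e) * B ^ 2 : ℝ≥0) : ℝ≥0∞) := by exact_mod_cast h3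
    _ ≤ (minCost T B c + η) + ((∑ e, d e) * B ^ 2 : ℝ≥0) := by
        rw [ENNReal.coe_add]; gcongr
    _ = _ := by ring

/-- Cauchy–Schwarz applied to `√w` and `√w * a`. -/
theorem sq_sum_mul_le {ι : Type*} (s : Finset ι) (w a : ι → ℝ≥0) (hw : ∑ i ∈ s, w i ≤ 1) :
    (∑ i ∈ s, w i * a i) ^ 2 ≤ ∑ i ∈ s, w i * a i ^ 2 := by
  have h := Finset.sum_mul_sq_le_sq_mul_sq s (fun i => NNReal.sqrt (w i))
    (fun i => NNReal.sqrt (w i) * a i)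
  simp only [← mul_assoc, NNReal.mul_self_sqrt, mul_pow, NNReal.sq_sqrt] at h
  refine h.trans ?_
  calc _ ≤ 1 * ∑ i ∈ s, w i * a i ^ 2 := by gcongr
    _ = _ := one_mul _

theorem trans_sum {ι : Type*} (s : Finset ι) (w : ι → ℝ≥0) (x : ι → SimplePath G → ℝ≥0) (v v' : V) :
    trans (fun σ => ∑ i ∈ s, w i * x i σ) v v' = ∑ i ∈ s, w i * trans (x i) v v' := by
  simp only [trans, Finset.mul_sum]
  rw [Finset.sum_comm]
  refine Finset.sum_congr rfl fun σ _ => ?_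
  split_ifs <;> simp

theorem vol_sum {ι : Type*} (s : Finset ι) (w : ι → ℝ≥0) (x : ι → SimplePath G → ℝ≥0)
    (e : G.edgeSet) :
    vol (fun σ => ∑ i ∈ s, w i * x i σ) e = ∑ i ∈ s, w i * vol (x i) e := by
  simp only [vol, Finset.mul_sum, Finset.sum_mul]
  rw [Finset.sum_comm]
  simp only [mul_assoc]

/-- Joint convexity of the minimum cost in the transportation measure and the capacity. -/
theorem minCost_convex [Fintype G.edgeSet] {ι : Type*} [Fintype ι] (w : ι → ℝ≥0)
    (hw : ∑ i, w i ≤ 1) (T : ι → V → V → ℝ≥0) (T₀ : V → V → ℝ≥0∞)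
    (hT₀ : ∀ v v', T₀ v v' = ((∑ i, w i * T i v v' : ℝ≥0) : ℝ≥0∞)) (B : ι → ℝ≥0) (B₀ : ℝ≥0)
    (hB₀ : ∑ i, w i * B i ≤ B₀) (c : Environment G) :
    minCost T₀ B₀ c ≤ ∑ i, (w i : ℝ≥0∞) * minCost (fun v v' => (T i v v' : ℝ≥0∞)) (B i) c := by
  classical
  -- Indices of weight zero may have infinite cost; they contribute nothing on either side and have
  -- no flow to choose.
  let s : Finset ι := Finset.univ.filter fun i => w i ≠ 0
  have hsum : ∀ f : ι → ℝ≥0, ∑ i, w i * f i = ∑ i ∈ s, w i * f i := fun f => by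
    rw [Finset.sum_filter_of_ne]
    intro i _ h h0
    simp [h0] at h
  have hsum' : ∀ f : ι → ℝ≥0∞, ∑ i, (w i : ℝ≥0∞) * f i = ∑ i ∈ s, (w i : ℝ≥0∞) * f i := fun f => by
    rw [Finset.sum_filter_of_ne]
    intro i _ h h0
    simp [h0] at h
  have hws : ∑ i ∈ s, w i ≤ 1 := (Finset.sum_le_univ_sum_of_nonneg (by simp)).trans hw
  rw [hsum']
  by_cases htop : ∃ i ∈ s, minCost (fun v v' => (T i v v' : ℝ≥0∞)) (B i) c = ∞
  · obtain ⟨i, hi, h⟩ := htop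
    refine le_of_le_of_eq le_top (Eq.symm ?_)
    refine ENNReal.sum_eq_top.2 ⟨i, hi, ?_⟩
    rw [h]
    exact ENNReal.mul_top (by simpa [s] using hi)
  push Not at htop
  refine ENNReal.le_of_forall_pos_le_add fun η hη _ => ?_
  have hex : ∀ i, ∃ x : SimplePath G → ℝ≥0, i ∈ s → (∀ v v', trans x v v' = T i v v') ∧
      (∀ e, vol x e ≤ B i) ∧
      (nncost (vol x) c : ℝ≥0∞) ≤ minCost (fun v v' => (T i v v' : ℝ≥0∞)) (B i) c + η := by
    intro i
    by_cases hi : i ∈ s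
    · obtain ⟨x, h1, h2, h3⟩ := exists_weights_of_minCost (htop i hi) hη
      exact ⟨x, fun _ => ⟨fun v v' => by exact_mod_cast h1 v v', h2, h3⟩⟩
    · exact ⟨0, fun h => absurd h hi⟩
  choose x hx using hex
  let y : SimplePath G → ℝ≥0 := fun σ => ∑ i ∈ s, w i * x i σ
  have hyT : (fun v w => (trans y v w : ℝ≥0∞)) = T₀ := by
    funext v v'
    rw [hT₀, hsum, trans_sum]
    congr 1
    exact Finset.sum_congr rfl fun i hi => by rw [(hx i hi).1]
  have hyB : ∀ e, vol y e ≤ B₀ := fun e => by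
    rw [vol_sum]
    rw [hsum] at hB₀
    exact (Finset.sum_le_sum fun i hi => by gcongr; exact (hx i hi).2.1 e).trans hB₀
  have h1 := minCost_le_of_simple y B₀ hyB c
  rw [hyT] at h1
  have h2 : nncost (vol y) c ≤ ∑ i ∈ s, w i * nncost (vol (x i)) c := by
    simp only [nncost, Finset.mul_sum]
    rw [Finset.sum_comm]
    refine Finset.sum_le_sum fun e _ => ?_
    rw [vol_sum]
    calc c e * (∑ i ∈ s, w i * vol (x i) e) ^ 2 ≤ c e * ∑ i ∈ s, w i * vol (x i) e ^ 2 := by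
          gcongr; exact sq_sum_mul_le s w _ hws
      _ = _ := by rw [Finset.mul_sum]; exact Finset.sum_congr rfl fun i _ => by ring
  calc minCost T₀ B₀ c ≤ (nncost (vol y) c : ℝ≥0) := h1
    _ ≤ ((∑ i ∈ s, w i * nncost (vol (x i)) c : ℝ≥0) : ℝ≥0∞) := by exact_mod_cast h2
    _ ≤ ∑ i ∈ s, (w i : ℝ≥0∞) * (minCost (fun v v' => (T i v v' : ℝ≥0∞)) (B i) c + η) := by
        push_cast
        refine Finset.sum_le_sum fun i hi => ?_
        gcongr
        exact (hx i hi).2.2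
    _ = ∑ i ∈ s, (w i : ℝ≥0∞) * minCost (fun v v' => (T i v v' : ℝ≥0∞)) (B i) c +
          (∑ i ∈ s, (w i : ℝ≥0∞)) * η := by
        rw [Finset.sum_mul, ← Finset.sum_add_distrib]
        exact Finset.sum_congr rfl fun i _ => by ring
    _ ≤ _ := by
        gcongr
        calc (∑ i ∈ s, (w i : ℝ≥0∞)) * η ≤ 1 * η := by
              gcongr; exact_mod_cast hws
          _ = η := one_mul _

end Weights

end LatticeFlow

end

noncomputable section

namespace LatticeFlow

open MeasureTheory

/-! ### The bounded differences inequality -/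

/-- Hoeffding's lemma. The values lie in an interval of length `2 * D` around any one of them, so
the variance proxy is `D ^ 2`; the loss of a factor four against the best constant does not matter.
-/
theorem integral_exp_sub_le_of_forall_abs_sub_le {X : Type*} [MeasurableSpace X] (μ : Measure X)
    [IsProbabilityMeasure μ] {f : X → ℝ} (hf : Measurable f) {D : ℝ} (hD : ∀ x y, |f x - f y| ≤ D)
    (t : ℝ) :
    ∫ x, Real.exp (t * ((∫ y, f y ∂μ) - f x)) ∂μ ≤ Real.exp (t ^ 2 * D ^ 2 / 2) := by
  obtain ⟨x₀⟩ : Nonempty X := nonempty_of_isProbabilityMeasure μ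
  have hD0 : 0 ≤ D := (abs_nonneg _).trans (hD x₀ x₀)
  have hmem : ∀ᵐ x ∂μ, f x ∈ Set.Icc (f x₀ - D) (f x₀ + D) := by
    refine Filter.Eventually.of_forall fun x => ?_
    have := abs_le.1 (hD x x₀)
    constructor <;> linarith [this.1, this.2]
  have h := (ProbabilityTheory.hasSubgaussianMGF_of_mem_Icc hf.aemeasurable hmem).mgf_le (-t)
  rw [ProbabilityTheory.mgf] at h
  convert h using 2
  · funext x
    congr 1
    ring
  · have : ‖f x₀ + D - (f x₀ - D)‖₊ = 2 * D.toNNReal := by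
      ext
      simp only [coe_nnnorm, NNReal.coe_mul, Real.coe_toNNReal D hD0, NNReal.coe_ofNat,
        Real.norm_eq_abs]
      rw [show f x₀ + D - (f x₀ - D) = 2 * D by ring, abs_of_nonneg (by linarith)]
    rw [this]
    push_cast
    rw [Real.coe_toNNReal D hD0]
    ring

/-- Induction on the number of coordinates: the mean over all coordinates but the first is a
function of oscillation at most `D`, and with the first coordinate fixed the induction hypothesis
controls the rest. The two exponents add up. -/
theorem integral_exp_sub_le_fin {X : Type*} [MeasurableSpace X] {D K : ℝ} (t : ℝ) (n : ℕ) :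
    ∀ (μ : Fin n → Measure X) [∀ i, IsProbabilityMeasure (μ i)] (g : (Fin n → X) → ℝ),
      Measurable g → (∀ c, |g c| ≤ K) → (∀ c i a, |g c - g (Function.update c i a)| ≤ D) →
      ∫ c, Real.exp (t * ((∫ c', g c' ∂Measure.pi μ) - g c)) ∂Measure.pi μ ≤
        Real.exp (n * (t ^ 2 * D ^ 2 / 2)) := by
  induction n with
  | zero =>
    intro μ _ g _ _ _
    have h : ∀ c, g c = g default := fun c => congrArg g (Subsingleton.elim _ _)
    simp [h]
  | succ n ih =>
    intro μ _ g hg hK hD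
    let e := MeasurableEquiv.piFinSuccAbove (fun _ : Fin (n + 1) => X) 0
    let ν : Measure (Fin n → X) := Measure.pi fun j => μ ((0 : Fin (n + 1)).succAbove j)
    have mp : MeasurePreserving e.symm ((μ 0).prod ν) (Measure.pi μ) :=
      (measurePreserving_piFinSuccAbove μ 0).symm
    have hK0 : 0 ≤ K := by
      obtain ⟨c⟩ : Nonempty (Fin (n + 1) → X) := nonempty_of_isProbabilityMeasure (Measure.pi μ)
      exact (abs_nonneg _).trans (hK c)
    have hsymm : ∀ x y, e.symm (x, y) = Fin.insertNth (0 : Fin (n + 1)) x y := fun x y => rfl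
    have hge : Measurable fun z => g (e.symm z) := hg.comp e.symm.measurable
    have hint : ∀ x, Integrable (fun y => g (e.symm (x, y))) ν := fun x =>
      Integrable.of_bound (hge.comp measurable_prodMk_left).aestronglyMeasurable K
        (Filter.Eventually.of_forall fun y => hK _)
    have hintp : Integrable (fun z => g (e.symm z)) ((μ 0).prod ν) :=
      Integrable.of_bound hge.aestronglyMeasurable K (Filter.Eventually.of_forall fun y => hK _)
    -- The conditional mean given the first coordinate.
    let H : X → ℝ := fun x => ∫ y, g (e.symm (x, y)) ∂ν
    have hHm : Measurable H := (hge.stronglyMeasurable.integral_prod_right').measurable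
    have hHD : ∀ x x', |H x - H x'| ≤ D := by
      intro x x'
      rw [← integral_sub (hint x) (hint x'), ← Real.norm_eq_abs]
      refine (norm_integral_le_of_norm_le_const (C := D)
        (Filter.Eventually.of_forall fun y => ?_)).trans (by simp)
      have := hD (e.symm (x, y)) 0 x'
      rw [hsymm, hsymm, Real.norm_eq_abs]
      rwa [hsymm, Fin.insertNth_zero', Fin.update_cons_zero, ← Fin.insertNth_zero',
        ← Fin.insertNth_zero'] at this
    have hHK : ∀ x, |H x| ≤ K := fun x => by
      rw [← Real.norm_eq_abs]
      exact (norm_integral_le_of_norm_le_const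
        (Filter.Eventually.of_forall fun y => hK _)).trans (by simp)
    have hmean : ∫ c', g c' ∂Measure.pi μ = ∫ x, H x ∂μ 0 := by
      rw [← mp.integral_comp', integral_prod _ hintp]
    have hmeanK : |∫ x, H x ∂μ 0| ≤ K := by
      rw [← Real.norm_eq_abs]
      exact (norm_integral_le_of_norm_le_const
        (Filter.Eventually.of_forall fun y => hHK _)).trans (by simp)
    have hbound : ∀ a b : ℝ, |a| ≤ K → |b| ≤ K → ‖Real.exp (t * (a - b))‖ ≤ Real.exp (|t| * (2 * K)) := by
      intro a b ha hb
      rw [Real.norm_eq_abs, Real.abs_exp, Real.exp_le_exp]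
      refine (le_abs_self _).trans ?_
      rw [abs_mul]
      gcongr
      exact (abs_sub _ _).trans (by linarith)
    rw [hmean, ← mp.integral_comp' (f := e.symm), integral_prod]
    · have hstep : ∀ x, ∫ y, Real.exp (t * ((∫ x, H x ∂μ 0) - g (e.symm (x, y)))) ∂ν ≤
          Real.exp (t * ((∫ x, H x ∂μ 0) - H x)) * Real.exp (n * (t ^ 2 * D ^ 2 / 2)) := by
        intro x
        have h1 : ∀ y, Real.exp (t * ((∫ x, H x ∂μ 0) - g (e.symm (x, y)))) =
            Real.exp (t * ((∫ x, H x ∂μ 0) - H x)) * Real.exp (t * (H x - g (e.symm (x, y)))) := by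
          intro y
          rw [← Real.exp_add]
          congr 1
          ring
        simp only [h1]
        rw [integral_const_mul]
        gcongr
        refine ih (fun j => μ ((0 : Fin (n + 1)).succAbove j)) (fun y => g (e.symm (x, y)))
          (hge.comp measurable_prodMk_left) (fun y => hK _) ?_
        intro y i a
        have := hD (e.symm (x, y)) i.succ a
        rw [hsymm] at this
        rw [hsymm, hsymm]
        rwa [Fin.insertNth_zero', ← Fin.cons_update, ← Fin.insertNth_zero',
          ← Fin.insertNth_zero'] at this
      have hi1 : Integrable (fun x => Real.exp (t * ((∫ x, H x ∂μ 0) - H x))) (μ 0) :=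
        Integrable.of_bound (by fun_prop) _
          (Filter.Eventually.of_forall fun x => hbound _ _ hmeanK (hHK x))
      calc _ ≤ ∫ x, Real.exp (t * ((∫ x, H x ∂μ 0) - H x)) * Real.exp (n * (t ^ 2 * D ^ 2 / 2))
              ∂μ 0 := by
            refine integral_mono_of_nonneg (Filter.Eventually.of_forall fun x => by positivity)
              (hi1.mul_const _) (Filter.Eventually.of_forall hstep)
        _ ≤ Real.exp (t ^ 2 * D ^ 2 / 2) * Real.exp (n * (t ^ 2 * D ^ 2 / 2)) := by
            rw [integral_mul_const]
            gcongr
            exact integral_exp_sub_le_of_forall_abs_sub_le (μ 0) hHm hHD t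
        _ = _ := by
            rw [← Real.exp_add]
            congr 1
            push_cast
            ring
    · exact Integrable.of_bound
        (Real.measurable_exp.comp ((hge.const_sub _).const_mul t)).aestronglyMeasurable _
          (Filter.Eventually.of_forall fun x => hbound _ _ hmeanK (hK _))

/-- The exponential moment bound behind McDiarmid's inequality. -/
theorem integral_exp_sub_le {ι X : Type*} [Fintype ι] [DecidableEq ι] [MeasurableSpace X] {D K : ℝ}
    (t : ℝ) (μ : ι → Measure X) [∀ i, IsProbabilityMeasure (μ i)] (g : (ι → X) → ℝ)
    (hg : Measurable g) (hK : ∀ c, |g c| ≤ K)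
    (hD : ∀ c i a, |g c - g (Function.update c i a)| ≤ D) :
    ∫ c, Real.exp (t * ((∫ c', g c' ∂Measure.pi μ) - g c)) ∂Measure.pi μ ≤
      Real.exp (Fintype.card ι * (t ^ 2 * D ^ 2 / 2)) := by
  let f : Fin (Fintype.card ι) ≃ ι := (Fintype.equivFin ι).symm
  let e := MeasurableEquiv.piCongrLeft (fun _ : ι => X) f
  have mp : MeasurePreserving e (Measure.pi fun i => μ (f i)) (Measure.pi μ) :=
    measurePreserving_piCongrLeft μ f
  have he : ∀ y i, e y i = y (f.symm i) := fun y i => by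
    simpa using MeasurableEquiv.piCongrLeft_apply_apply (β := fun _ : ι => X) (e := f) (x := y)
      (f.symm i)
  rw [← mp.integral_comp', ← mp.integral_comp' g]
  refine integral_exp_sub_le_fin t _ (fun i => μ (f i)) (fun y => g (e y)) (hg.comp e.measurable)
    (fun y => hK _) ?_
  intro y i a
  have := hD (e y) (f i) a
  convert this using 3
  congr 1
  funext j
  rw [he]
  by_cases hj : j = f i
  · subst hj; simp
  · have : f.symm j ≠ i := fun h => hj (by rw [← h]; simp)
    simp [hj, this, he]

end LatticeFlow

end

noncomputable section

namespace LatticeFlow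

open MeasureTheory

/-! ### Independent sampling from a finite set -/

section Sampling

variable {Z : Type*} [Fintype Z] {n : ℕ}

theorem sum_prod_eq_pow {R : Type*} [CommSemiring R] (u : Z → R) :
    ∑ y : Fin n → Z, ∏ i, u (y i) = (∑ z, u z) ^ n := by
  classical
  rw [← Fintype.prod_sum (fun (_ : Fin n) z => u z)]
  simp

/-- The marginal of a product distribution: all factors except the `k`-th sum to one. -/
theorem sum_prod_mul_apply {R : Type*} [CommSemiring R] (u φ : Z → R) (hu : ∑ z, u z = 1)
    (k : Fin n) : ∑ y : Fin n → Z, (∏ i, u (y i)) * φ (y k) = ∑ z, u z * φ z := by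
  classical
  have h : ∀ y : Fin n → Z, (∏ i, u (y i)) * φ (y k) =
      ∏ i, (u (y i) * if i = k then φ (y i) else 1) := by
    intro y
    rw [Finset.prod_mul_distrib]
    congr 1
    simp [Finset.prod_ite_eq']
  simp only [h]
  rw [← Fintype.prod_sum (fun (i : Fin n) z => u z * if i = k then φ z else 1),
    Fintype.prod_eq_single k]
  · simp
  · intro i hi
    simp [hi, hu]

/-- Exponential Markov inequality for a sum of independent indicators, with `θ` the mass of one draw
and `f` the mean of the scaled sum; off the event `p` the sum exceeds its mean by `ξ`. -/
theorem chernoff_bound (u : Z → ℝ) (hu0 : ∀ z, 0 ≤ u z) (hu : ∑ z, u z = 1) (a : Z → ℝ)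
    (ha : ∀ z, a z = 0 ∨ a z = 1) {θ f B ξ : ℝ} (hθ : 0 < θ) (hB : 0 < B)
    (hf : (n : ℝ) * ∑ z, u z * a z = f / θ) (hfB : f ≤ B) (hξ : 0 ≤ ξ) (hξB : ξ ≤ 2 * B)
    (p : (Fin n → Z) → Prop) [DecidablePred p] (hp : ∀ y, ¬ p y → f + ξ ≤ θ * ∑ i, a (y i)) :
    ∑ y : Fin n → Z, (if p y then 0 else ∏ i, u (y i)) ≤ Real.exp (-(ξ ^ 2 / (4 * B * θ))) := by
  -- This `l` minimizes `B * l ^ 2 - l * ξ`, with value `-ξ ^ 2 / (4 * B)`; `ξ ≤ 2 * B` gives `l ≤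
  -- 1`, where the exponential is at most `1 + l + l ^ 2`.
  set l : ℝ := ξ / (2 * B) with hl
  have hl0 : 0 ≤ l := by positivity
  have hl1 : l ≤ 1 := by rw [hl, div_le_one (by positivity)]; exact hξB
  have hexp : Real.exp l - 1 ≤ l + l ^ 2 := by
    have := Real.abs_exp_sub_one_sub_id_le (x := l) (by rwa [abs_of_nonneg hl0])
    linarith [(abs_le.1 this).2]
  have hexp0 : 0 ≤ Real.exp l - 1 := by linarith [Real.add_one_le_exp l]
  have hmgf : ∑ z, u z * Real.exp (l * a z) ≤ Real.exp ((∑ z, u z * a z) * (Real.exp l - 1)) := by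
    have h1 : ∀ z, u z * Real.exp (l * a z) = u z + u z * a z * (Real.exp l - 1) := by
      intro z
      rcases ha z with h | h <;> simp [h]
      ring
    simp only [h1]
    rw [Finset.sum_add_distrib, hu, ← Finset.sum_mul]
    linarith [Real.add_one_le_exp ((∑ z, u z * a z) * (Real.exp l - 1))]
  have hpt : ∀ y : Fin n → Z, (if p y then 0 else ∏ i, u (y i)) ≤
      (∏ i, u (y i) * Real.exp (l * a (y i))) * Real.exp (-(l * ((f + ξ) / θ))) := by
    intro y
    have hprod : 0 ≤ ∏ i, u (y i) := Finset.prod_nonneg fun i _ => hu0 _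
    rw [Finset.prod_mul_distrib, ← Real.exp_sum, mul_assoc, ← Real.exp_add]
    split_ifs with h
    · positivity
    · refine le_mul_of_one_le_right hprod (Real.one_le_exp ?_)
      rw [← Finset.mul_sum, ← sub_eq_add_neg, ← mul_sub]
      refine mul_nonneg hl0 (sub_nonneg.2 ?_)
      rw [div_le_iff₀ hθ, mul_comm]
      exact hp y h
  calc _ ≤ ∑ y : Fin n → Z, (∏ i, u (y i) * Real.exp (l * a (y i))) *
          Real.exp (-(l * ((f + ξ) / θ))) := Finset.sum_le_sum fun y _ => hpt y
    _ = (∑ z, u z * Real.exp (l * a z)) ^ n * Real.exp (-(l * ((f + ξ) / θ))) := by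
        rw [← Finset.sum_mul, ← sum_prod_eq_pow]
    _ ≤ Real.exp ((∑ z, u z * a z) * (Real.exp l - 1)) ^ n * Real.exp (-(l * ((f + ξ) / θ))) := by
        gcongr
        exact Finset.sum_nonneg fun z _ => mul_nonneg (hu0 z) (Real.exp_nonneg _)
    _ = Real.exp (f / θ * (Real.exp l - 1) - l * ((f + ξ) / θ)) := by
        rw [← Real.exp_nat_mul, ← Real.exp_add, ← mul_assoc, hf,
          sub_eq_add_neg (f / θ * _)]
    _ ≤ _ := by
        rw [Real.exp_le_exp]
        have hf0 : 0 ≤ f / θ := by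
          rw [← hf]
          refine mul_nonneg (Nat.cast_nonneg _) (Finset.sum_nonneg fun z _ => mul_nonneg (hu0 z) ?_)
          rcases ha z with h | h <;> simp [h]
        calc f / θ * (Real.exp l - 1) - l * ((f + ξ) / θ)
            ≤ f / θ * (l + l ^ 2) - l * ((f + ξ) / θ) := by gcongr
          _ = (f * l ^ 2 - l * ξ) / θ := by ring
          _ ≤ (B * l ^ 2 - l * ξ) / θ := by gcongr
          _ = _ := by rw [hl]; field_simp; ring

end Sampling

/-! ### Sampling the paths of a flow. -/

section Graph

variable {V : Type*} {G : SimpleGraph V} [DecidableEq V]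

/-- Crossings of an edge by the path drawn. -/
def drawCrossings (e : G.edgeSet) : Option (SimplePath G) → ℕ
  | some σ => σ.1.crossings e
  | none => 0

theorem drawCrossings_le_one (e : G.edgeSet) (z : Option (SimplePath G)) :
    drawCrossings e z ≤ 1 := by
  cases z with
  | none => simp [drawCrossings]
  | some σ => exact σ.crossings_le_one e

variable [Fintype V]

/-- The probability of drawing a given path, or no path at all. -/
def drawWeight (m : ℝ≥0) (x : SimplePath G → ℝ≥0) : Option (SimplePath G) → ℝ≥0
  | some σ => x σ / m
  | none => 1 - (∑ σ, x σ) / m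

theorem sum_drawWeight {m : ℝ≥0} (hm : 0 < m) {x : SimplePath G → ℝ≥0} (hx : ∑ σ, x σ ≤ m) :
    ∑ z, drawWeight m x z = 1 := by
  rw [Fintype.sum_option]
  simp only [drawWeight]
  rw [← Finset.sum_div]
  exact tsub_add_cancel_of_le ((div_le_one hm).2 hx)

/-- The path-flow that gives the mass `θ` to each path drawn. -/
def sampleFlow (θ : ℝ≥0) {n : ℕ} (y : Fin n → Option (SimplePath G)) (σ : SimplePath G) : ℝ≥0 :=
  ∑ i, if y i = some σ then θ else 0

/-- The end points of the path drawn. -/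
def drawEnds (z : Option (SimplePath G)) : Option (V × V) := z.map fun σ => (σ.1.ent, σ.1.exi)

/-- The transportation measure that gives the mass `θ` to each pair of end points drawn. -/
def sampleTrans (θ : ℝ≥0) {n : ℕ} (τ : Fin n → Option (V × V)) (v w : V) : ℝ≥0 :=
  ∑ i, if τ i = some (v, w) then θ else 0

/-- Only the end points drawn matter, so the union bound runs over samples of vertex pairs and not
over the far more numerous samples of paths. -/
theorem trans_sampleFlow (θ : ℝ≥0) {n : ℕ} (y : Fin n → Option (SimplePath G)) (v w : V) :
    trans (sampleFlow θ y) v w = sampleTrans θ (fun i => drawEnds (y i)) v w := by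
  simp only [trans, sampleFlow, sampleTrans]
  have : ∀ σ : SimplePath G, (if σ.1.ent = v ∧ σ.1.exi = w then
      ∑ i, (if y i = some σ then θ else 0) else 0) =
      ∑ i, if y i = some σ ∧ σ.1.ent = v ∧ σ.1.exi = w then θ else 0 := by
    intro σ
    split_ifs with h <;> simp [h]
  simp only [this]
  rw [Finset.sum_comm]
  refine Finset.sum_congr rfl fun i _ => ?_
  obtain h | ⟨σ, h⟩ : y i = none ∨ ∃ σ, y i = some σ := by cases y i <;> simp
  · simp [h, drawEnds]
  · rw [Finset.sum_eq_single σ]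
    · simp [h, drawEnds]
    · intro b _ hb
      simp [h, hb.symm]
    · simp

theorem vol_sampleFlow (θ : ℝ≥0) {n : ℕ} (y : Fin n → Option (SimplePath G)) (e : G.edgeSet) :
    vol (sampleFlow θ y) e = θ * ∑ i, (drawCrossings e (y i) : ℝ≥0) := by
  simp only [vol, sampleFlow, Finset.sum_mul, Finset.mul_sum]
  rw [Finset.sum_comm]
  refine Finset.sum_congr rfl fun i _ => ?_
  cases h : y i with
  | none => simp [drawCrossings]
  | some σ =>
    rw [Finset.sum_eq_single σ]
    · simp [drawCrossings]
    · intro b _ hb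
      simp [hb.symm]
    · simp

/-- A simple path crosses an edge at most once, so the total mass is a capacity that even bad
samples respect. -/
theorem vol_sampleFlow_le (θ : ℝ≥0) {n : ℕ} (y : Fin n → Option (SimplePath G)) (e : G.edgeSet) :
    vol (sampleFlow θ y) e ≤ θ * n := by
  rw [vol_sampleFlow]
  gcongr
  calc ∑ i, (drawCrossings e (y i) : ℝ≥0) ≤ ∑ _i : Fin n, (1 : ℝ≥0) := by
        refine Finset.sum_le_sum fun i _ => ?_
        exact_mod_cast drawCrossings_le_one e (y i)
    _ = n := by simp

theorem sum_drawWeight_mul_drawCrossings (m : ℝ≥0) (x : SimplePath G → ℝ≥0) (e : G.edgeSet) :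
    ∑ z, drawWeight m x z * (drawCrossings e z : ℝ≥0) = vol x e / m := by
  rw [Fintype.sum_option]
  simp only [drawWeight, drawCrossings, vol, Finset.sum_div]
  simp only [Nat.cast_zero, mul_zero, zero_add]
  exact Finset.sum_congr rfl fun σ _ => by ring

/-- The expectation of the sampled path-flow is the path-flow sampled from. -/
theorem sum_prod_drawWeight_mul_sampleFlow {m : ℝ≥0} (hm : 0 < m) {x : SimplePath G → ℝ≥0}
    (hx : ∑ σ, x σ ≤ m) {θ : ℝ≥0} {n : ℕ} (hθ : θ * n = m) (σ : SimplePath G) :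
    ∑ y : Fin n → Option (SimplePath G), (∏ i, drawWeight m x (y i)) * sampleFlow θ y σ = x σ := by
  simp only [sampleFlow, Finset.mul_sum]
  rw [Finset.sum_comm]
  have : ∀ k : Fin n, ∑ y : Fin n → Option (SimplePath G), (∏ i, drawWeight m x (y i)) *
      (if y k = some σ then θ else 0) = x σ / m * θ := by
    intro k
    rw [sum_prod_mul_apply (drawWeight m x) (fun z => if z = some σ then θ else 0)
      (sum_drawWeight hm hx)]
    simp [drawWeight]
  simp only [this]
  rw [Finset.sum_const, Finset.card_univ, Fintype.card_fin, nsmul_eq_mul]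
  calc (n : ℝ≥0) * (x σ / m * θ) = x σ / m * (θ * n) := by ring
    _ = x σ := by rw [hθ, div_mul_cancel₀ _ hm.ne']

variable [Fintype G.edgeSet]

/-- With high probability, sampling increases no flow-volume by more than `ξ`. -/
theorem sum_bad_le {m B ξ : ℝ≥0} (hm : 0 < m) {x : SimplePath G → ℝ≥0} (hx : ∑ σ, x σ ≤ m)
    (hB : 0 < B) (hvol : ∀ e, vol x e ≤ B) (hξB : ξ ≤ 2 * B) {θ : ℝ≥0} {n : ℕ}
    (hn : 0 < n) (hθ : θ * n = m) :
    ∑ y : Fin n → Option (SimplePath G),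
      (if ∀ e, vol (sampleFlow θ y) e ≤ vol x e + ξ then 0 else
        ((∏ i, drawWeight m x (y i) : ℝ≥0) : ℝ)) ≤
      Fintype.card G.edgeSet * Real.exp (-((ξ : ℝ) ^ 2 * n / (4 * B * m))) := by
  have hn' : (0 : ℝ) < n := by exact_mod_cast hn
  have hθ' : (θ : ℝ) * n = m := by exact_mod_cast hθ
  have hm' : (0 : ℝ) < m := by exact_mod_cast hm
  have hθ0 : (0 : ℝ) < θ := by
    by_contra h
    nlinarith
  -- The Chernoff bound for a single edge; summing over the edges is the union bound.
  have hone : ∀ e : G.edgeSet, ∑ y : Fin n → Option (SimplePath G),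
      (if vol (sampleFlow θ y) e ≤ vol x e + ξ then 0 else
        ∏ i, (drawWeight m x (y i) : ℝ)) ≤ Real.exp (-((ξ : ℝ) ^ 2 * n / (4 * B * m))) := by
    intro e
    have h := chernoff_bound (n := n) (fun z => (drawWeight m x z : ℝ)) (fun z => NNReal.coe_nonneg _)
      (by exact_mod_cast sum_drawWeight hm hx) (fun z => (drawCrossings e z : ℝ))
      (fun z => by
        have := drawCrossings_le_one e z
        interval_cases drawCrossings e z <;> simp) (θ := θ) (f := vol x e) (B := B) (ξ := ξ)
      hθ0 (by exact_mod_cast hB)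
      (by
        have := sum_drawWeight_mul_drawCrossings m x e
        have h2 : ∑ z, (drawWeight m x z : ℝ) * (drawCrossings e z : ℝ) = vol x e / m := by
          exact_mod_cast this
        rw [h2, ← hθ']
        field_simp)
      (by exact_mod_cast hvol e) (NNReal.coe_nonneg _) (by exact_mod_cast hξB)
      (fun y => vol (sampleFlow θ y) e ≤ vol x e + ξ)
      (by
        intro y hy
        rw [vol_sampleFlow] at hy
        push Not at hy
        exact_mod_cast hy.le)
    refine h.trans (le_of_eq ?_)
    rw [← hθ']
    congr 2
    field_simp
  calc _ ≤ ∑ y : Fin n → Option (SimplePath G), ∑ e : G.edgeSet,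
        (if vol (sampleFlow θ y) e ≤ vol x e + ξ then 0 else ∏ i, (drawWeight m x (y i) : ℝ)) := by
        refine Finset.sum_le_sum fun y _ => ?_
        have hnn : ∀ e : G.edgeSet, 0 ≤ (if vol (sampleFlow θ y) e ≤ vol x e + ξ then 0 else
            ∏ i, (drawWeight m x (y i) : ℝ)) := fun e => by
          split_ifs
          · exact le_rfl
          · exact Finset.prod_nonneg fun i _ => NNReal.coe_nonneg _
        split_ifs with h
        · exact Finset.sum_nonneg fun e _ => hnn e
        · push Not at h
          obtain ⟨e, he⟩ := h
          refine le_trans ?_ (Finset.single_le_sum (fun e _ => hnn e) (Finset.mem_univ e))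
          rw [if_neg (not_le.2 he)]
          push_cast
          exact le_rfl
    _ ≤ ∑ _e : G.edgeSet, Real.exp (-((ξ : ℝ) ^ 2 * n / (4 * B * m))) := by
        rw [Finset.sum_comm]
        exact Finset.sum_le_sum fun e _ => hone e
    _ = _ := by simp

/-! ### Concentration of the minimum cost -/

/-- Lipschitz by `minCost_le_add`; needed for measurability. The value `∞` causes no trouble, as the
estimate holds in `ℝ≥0∞`. -/
theorem continuous_minCost (T : V → V → ℝ≥0∞) (B : ℝ≥0) :
    Continuous fun c : Environment G => minCost T B c := by
  refine continuous_of_le_add_edist ((Fintype.card G.edgeSet * B ^ 2 : ℝ≥0) : ℝ≥0∞)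
    ENNReal.coe_ne_top ?_
  intro c c'
  refine (minCost_le_add T B c' c (fun _ => nndist c c') ?_).trans ?_
  · intro e
    have h1 := nndist_le_pi_nndist c c' e
    have h2 : (c e : ℝ) ≤ c' e + nndist (c e) (c' e) := by
      have := NNReal.dist_eq (c e) (c' e)
      rw [coe_nndist, this]
      linarith [le_abs_self ((c e : ℝ) - c' e)]
    have h2' : c e ≤ c' e + nndist (c e) (c' e) := by exact_mod_cast h2
    exact h2'.trans (by gcongr)
  · gcongr
    rw [edist_nndist, ← ENNReal.coe_mul, Finset.sum_const, Finset.card_univ, nsmul_eq_mul]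
    exact le_of_eq (by congr 1; ring)

theorem measurable_minCost (T : V → V → ℝ≥0∞) (B : ℝ≥0) :
    Measurable fun c : Environment G => minCost T B c :=
  (continuous_minCost T B).measurable

theorem minCost_le_of_ne_top {T : V → V → ℝ≥0∞} {B cs : ℝ≥0} {c : Environment G}
    (h : minCost T B c ≠ ∞) (hc : ∀ e, c e ≤ cs) :
    minCost T B c ≤ (cs * Fintype.card G.edgeSet * B ^ 2 : ℝ≥0) := by
  obtain ⟨x, hT, hB, -⟩ := exists_weights_of_minCost h one_pos
  have hTT : (fun v w => (trans x v w : ℝ≥0∞)) = T := by funext v w; exact hT v w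
  rw [← hTT]
  exact minCost_le_mul_card x B cs hB c hc

/-- The bounded difference property: changing one cost-factor within `[0, cs]` changes the cost of a
fixed admissible flow by at most `cs * B ^ 2`. -/
theorem abs_toReal_minCost_sub_le {T : V → V → ℝ≥0∞} {B cs : ℝ≥0} {c c' : Environment G}
    (h : minCost T B c ≠ ∞) (i : G.edgeSet) (hc : ∀ e, e ≠ i → c' e = c e) (hi : c i ≤ cs)
    (hi' : c' i ≤ cs) :
    |(minCost T B c).toReal - (minCost T B c').toReal| ≤ cs * B ^ 2 := by
  classical
  have key : ∀ a b : Environment G, minCost T B b ≠ ∞ → (∀ e, e ≠ i → a e = b e) → a i ≤ cs →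
      (minCost T B a).toReal ≤ (minCost T B b).toReal + cs * B ^ 2 := by
    intro a b hb hab ha
    have h1 := minCost_le_add T B b a (Pi.single i cs) (by
      intro e
      by_cases he : e = i
      · subst he; simpa using le_add_left ha
      · rw [hab e he]; exact le_self_add)
    rw [Finset.sum_pi_single'] at h1
    simp only [Finset.mem_univ, if_true] at h1
    have h2 := ENNReal.toReal_mono (by finiteness) h1
    rwa [ENNReal.toReal_add hb ENNReal.coe_ne_top, ENNReal.coe_toReal] at h2
  have h' : minCost T B c' ≠ ∞ := minCost_ne_top_of_ne_top h
  have h1 := key c c' h' (fun e he => (hc e he).symm) hi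
  have h2 := key c' c h hc hi'
  rw [abs_le]
  constructor <;> linarith

/-- In a finite family of transportation measures, the minimum costs are simultaneously not much
smaller than their expectations. -/
theorem exists_deviation_bound {ι : Type*} [Fintype ι] [Nonempty ι] (T : ι → V → V → ℝ≥0∞) (B cs : ℝ≥0)
    (μ : G.edgeSet → Measure ℝ≥0) [∀ e, IsProbabilityMeasure (μ e)]
    (hμ : ∀ e, ∀ᵐ t ∂μ e, t ≤ cs) {l : ℝ} (hl : 0 < l) :
    ∃ W : Environment G → ℝ≥0∞, Measurable W ∧
      ∫⁻ c, W c ∂Measure.pi μ ≤ ENNReal.ofReal (1 / l) ∧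
      ∀ᵐ c ∂Measure.pi μ, ∀ i, ∫⁻ c', minCost (T i) B c' ∂Measure.pi μ ≤ minCost (T i) B c +
        ENNReal.ofReal ((Real.log (Fintype.card ι) +
          Fintype.card G.edgeSet * (l ^ 2 * (cs * B ^ 2 : ℝ) ^ 2 / 2)) / l) + W c := by
  classical
  set ρ : Measure (Environment G) := Measure.pi μ with hρ
  set a : ℝ := (Real.log (Fintype.card ι) +
          Fintype.card G.edgeSet * (l ^ 2 * (cs * B ^ 2 : ℝ) ^ 2 / 2)) / l with ha
  have ha0 : 0 ≤ a := by
    have : 0 ≤ Real.log (Fintype.card ι) := Real.log_natCast_nonneg _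
    positivity
  have hae : ∀ᵐ c ∂ρ, ∀ e, c e ≤ cs := by
    rw [ae_all_iff]
    intro e
    exact (Measure.quasiMeasurePreserving_eval μ e).ae (hμ e)
  -- The bounded differences inequality needs bounds at every point, not almost everywhere;
  -- truncation at `cs` provides them and almost surely changes nothing.
  let tr : Environment G → Environment G := fun c e => min (c e) cs
  have htr : Measurable tr := by fun_prop
  let g : ι → Environment G → ℝ := fun i c => (minCost (T i) B (tr c)).toReal
  have hgm : ∀ i, Measurable (g i) := fun i =>
    ((measurable_minCost (T i) B).comp htr).ennreal_toReal
  -- Feasibility is the same in all environments, so outside `F` the right side of the claim is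
  -- infinite.
  let F : Finset ι := Finset.univ.filter fun i => minCost (T i) B (0 : Environment G) ≠ ∞
  have hF : ∀ i ∈ F, ∀ c, minCost (T i) B c ≠ ∞ := fun i hi c =>
    minCost_ne_top_of_ne_top (Finset.mem_filter.1 hi).2
  have hgK : ∀ i ∈ F, ∀ c, |g i c| ≤ (cs * Fintype.card G.edgeSet * B ^ 2 : ℝ≥0) := by
    intro i hi c
    rw [abs_of_nonneg ENNReal.toReal_nonneg]
    have := minCost_le_of_ne_top (hF i hi (tr c)) (fun e => min_le_right (c e) cs)
    exact ENNReal.toReal_le_of_le_ofReal (NNReal.coe_nonneg _)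
      (by rwa [ENNReal.ofReal_coe_nnreal])
  have hgD : ∀ i ∈ F, ∀ c e t, |g i c - g i (Function.update c e t)| ≤ cs * B ^ 2 := by
    intro i hi c e t
    refine abs_toReal_minCost_sub_le (hF i hi _) e ?_ (min_le_right _ _) (min_le_right _ _)
    intro e' he'
    simp [tr, Function.update_of_ne he']
  have hgint : ∀ i ∈ F, ∫⁻ c', minCost (T i) B c' ∂ρ = ENNReal.ofReal (∫ c', g i c' ∂ρ) := by
    intro i hi
    rw [ofReal_integral_eq_lintegral_ofReal]
    · refine lintegral_congr_ae ?_
      filter_upwards [hae] with c hc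
      have : tr c = c := funext fun e => min_eq_left (hc e)
      simp only [g, this]
      rw [ENNReal.ofReal_toReal (hF i hi c)]
    · exact Integrable.of_bound (hgm i).aestronglyMeasurable _ (Filter.Eventually.of_forall (hgK i hi))
    · exact Filter.Eventually.of_forall fun c => ENNReal.toReal_nonneg
  -- An exponential bound for the positive part of the downward deviation beyond `a`. The value of
  -- `a` is such that each of these has expectation at most `1 / l` divided by the size of the
  -- family; `W` is their sum.
  let w : ι → Environment G → ℝ := fun i c =>
    1 / l * Real.exp (l * ((∫ c', g i c' ∂ρ) - g i c) - l * a)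
  have hwm : ∀ i, Measurable (w i) := fun i =>
    (Real.measurable_exp.comp ((((hgm i).const_sub _).const_mul l).sub_const _)).const_mul _
  have hwint : ∀ i ∈ F, ∫⁻ c, ENNReal.ofReal (w i c) ∂ρ ≤
      ENNReal.ofReal (1 / l * (1 / Fintype.card ι)) := by
    intro i hi
    have h1 := integral_exp_sub_le (K := (cs * Fintype.card G.edgeSet * B ^ 2 : ℝ≥0))
      (D := cs * B ^ 2) l μ (g i) (hgm i) (hgK i hi) (hgD i hi)
    rw [← hρ] at h1
    have hsplit : ∀ c, w i c = 1 / l * Real.exp (-(l * a)) *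
        Real.exp (l * ((∫ c', g i c' ∂ρ) - g i c)) := by
      intro c
      simp only [w]
      rw [mul_assoc, ← Real.exp_add]
      congr 2
      ring
    have hK0 := hgK i hi
    have hbd : ∀ c, ‖w i c‖ ≤ 1 / l * Real.exp (-(l * a)) * Real.exp (l * ((∫ c', g i c' ∂ρ) -
        (-((cs * Fintype.card G.edgeSet * B ^ 2 : ℝ≥0) : ℝ)))) := by
      intro c
      rw [hsplit, Real.norm_eq_abs, abs_of_nonneg (by positivity)]
      gcongr
      exact (abs_le.1 (hgK i hi c)).1
    rw [← ofReal_integral_eq_lintegral_ofReal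
      (Integrable.of_bound (hwm i).aestronglyMeasurable _ (Filter.Eventually.of_forall hbd))
      (Filter.Eventually.of_forall fun c => by simp only [w, Pi.zero_apply]; positivity)]
    refine ENNReal.ofReal_le_ofReal ?_
    simp only [hsplit]
    rw [integral_const_mul, mul_assoc]
    gcongr
    have hcard : (0 : ℝ) < Fintype.card ι := by exact_mod_cast Fintype.card_pos
    calc Real.exp (-(l * a)) * ∫ c, Real.exp (l * ((∫ c', g i c' ∂ρ) - g i c)) ∂ρ
        ≤ Real.exp (-(l * a)) *
          Real.exp (Fintype.card G.edgeSet * (l ^ 2 * (cs * B ^ 2 : ℝ) ^ 2 / 2)) := by gcongr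
      _ = Real.exp (-Real.log (Fintype.card ι)) := by
          rw [← Real.exp_add]
          congr 1
          rw [ha]
          field_simp
          ring
      _ = 1 / Fintype.card ι := by
          rw [Real.exp_neg, Real.exp_log hcard, one_div]
  refine ⟨fun c => ∑ i ∈ F, ENNReal.ofReal (w i c), ?_, ?_, ?_⟩
  · exact Finset.measurable_fun_sum _ fun i _ => (hwm i).ennreal_ofReal
  · rw [lintegral_finsetSum _ fun i _ => (hwm i).ennreal_ofReal]
    have hcard : (0 : ℝ) < Fintype.card ι := by exact_mod_cast Fintype.card_pos
    calc _ ≤ ∑ i ∈ F, ENNReal.ofReal (1 / l * (1 / Fintype.card ι)) :=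
          Finset.sum_le_sum hwint
      _ ≤ ∑ i : ι, ENNReal.ofReal (1 / l * (1 / Fintype.card ι)) :=
          Finset.sum_le_univ_sum_of_nonneg (by simp)
      _ = ENNReal.ofReal (1 / l) := by
          rw [Finset.sum_const, Finset.card_univ, ← ENNReal.ofReal_nsmul, nsmul_eq_mul]
          congr 1
          field_simp
  · filter_upwards [hae] with c hc i
    by_cases hi : i ∈ F
    · have htc : tr c = c := funext fun e => min_eq_left (hc e)
      have hw1 : ENNReal.ofReal (w i c) ≤ ∑ i ∈ F, ENNReal.ofReal (w i c) :=
        Finset.single_le_sum (f := fun i => ENNReal.ofReal (w i c)) (by simp) hi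
      refine le_trans ?_ (add_le_add_right hw1 _)
      have hgc : minCost (T i) B c = ENNReal.ofReal (g i c) := by
        simp only [g, htc]
        rw [ENNReal.ofReal_toReal (hF i hi c)]
      rw [hgint i hi, hgc, ← ENNReal.ofReal_add ENNReal.toReal_nonneg ha0,
        ← ENNReal.ofReal_add (add_nonneg ENNReal.toReal_nonneg ha0)
          (by simp only [w]; positivity)]
      refine ENNReal.ofReal_le_ofReal ?_
      -- From `u ≤ exp u`, divided by `l`: the deviation beyond `a` is at most `w i c`.
      have h1 := Real.add_one_le_exp (l * ((∫ c', g i c' ∂ρ) - g i c) - l * a)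
      have h2 : (∫ c', g i c' ∂ρ) - g i c - a ≤ w i c := by
        simp only [w]
        rw [one_div, inv_mul_eq_div, le_div_iff₀ hl]
        linarith
      linarith
    · have : minCost (T i) B (0 : Environment G) = ∞ := by
        simpa [F] using hi
      have hc' : minCost (T i) B c = ∞ := by
        by_contra h
        exact minCost_ne_top_of_ne_top h this
      simp [hc']

end Graph

end LatticeFlow

end

noncomputable section

namespace LatticeFlow

open MeasureTheory

/-! ### Replacing an environment-dependent flow by its expectation -/

section Decoupling

variable {V : Type*} {G : SimpleGraph V}

theorem nncost_le_of_le_add [Fintype G.edgeSet] {f f' : G.edgeSet → ℝ≥0} {B ξ cs : ℝ≥0} {c : Environment G}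
    (hf : ∀ e, f e ≤ B) (hf' : ∀ e, f' e ≤ f e + ξ) (hc : ∀ e, c e ≤ cs) :
    nncost f' c ≤ nncost f c + cs * Fintype.card G.edgeSet * (2 * B * ξ + ξ ^ 2) := by
  calc nncost f' c ≤ ∑ e, (c e * f e ^ 2 + cs * (2 * B * ξ + ξ ^ 2)) := by
        refine Finset.sum_le_sum fun e _ => ?_
        calc c e * f' e ^ 2 ≤ c e * (f e + ξ) ^ 2 := by gcongr; exact hf' e
          _ = c e * f e ^ 2 + c e * (2 * f e * ξ + ξ ^ 2) := by ring
          _ ≤ _ := by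
              gcongr
              · exact hc e
              · exact hf e
    _ = _ := by
        rw [Finset.sum_add_distrib, Finset.sum_const, Finset.card_univ, nsmul_eq_mul, nncost]
        ring

variable [DecidableEq V] [Fintype V]

theorem measurable_drawWeight (m : ℝ≥0) (z : Option (SimplePath G)) :
    Measurable fun x : SimplePath G → ℝ≥0 => drawWeight m x z := by
  cases z with
  | none => simp only [drawWeight]; fun_prop
  | some σ => simp only [drawWeight]; fun_prop

theorem measurable_vol (e : G.edgeSet) : Measurable fun x : SimplePath G → ℝ≥0 => vol x e := by
  simp only [vol]; fun_prop

theorem measurable_trans (v w : V) : Measurable fun x : SimplePath G → ℝ≥0 => trans x v w := by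
  simp only [trans]
  refine Finset.measurable_fun_sum _ fun σ _ => ?_
  split_ifs <;> fun_prop

/-- The error made in replacing an environment-dependent flow by its expectation: `E` and `v` are
the numbers of edges and vertices, `m` bounds the total mass, `B` the flow-volumes. -/
def decoupleError (cs B m ξ E v l : ℝ) (n : ℕ) : ℝ :=
  cs * E * (2 * B * ξ + ξ ^ 2) +
    (Real.log ((v ^ 2 + 1) ^ n) + E * (l ^ 2 * (cs * (B + ξ) ^ 2) ^ 2 / 2)) / l + 1 / l +
    E * Real.exp (-(ξ ^ 2 * n / (4 * B * m))) * (cs * E * m ^ 2)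

/-- The flow `x ω` may depend on the environment `S ω`; the left side concerns its mean
transportation measure in a fresh environment. The flow is the mean of its samples, so by convexity
the left side is at most a mean of sampled costs in the fresh environment. Good samples are
transferred back to `S ω` by the deviation bound, bad samples are paid for at the trivial cost. The
four summands of `decoupleError` are the rise `ξ` of the volumes, the deviation threshold, the mean
of `W`, and the bad samples. -/
theorem lintegral_minCost_expectation_le [Fintype G.edgeSet] {Ω : Type*} [MeasurableSpace Ω] (P : Measure Ω)
    [IsProbabilityMeasure P] (cs : ℝ≥0) (μ : G.edgeSet → Measure ℝ≥0)
    [∀ e, IsProbabilityMeasure (μ e)] (hμ : ∀ e, ∀ᵐ t ∂μ e, t ≤ cs) (S : Ω → Environment G)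
    (hS : Measurable S) (hlaw : P.map S = Measure.pi μ) (x : Ω → SimplePath G → ℝ≥0)
    (hx : Measurable x) {m B ξ B₂ : ℝ≥0} (hm : 0 < m) (hB : 0 < B)
    (hmass : ∀ ω, ∑ σ, x ω σ ≤ m) (hvol : ∀ ω e, vol (x ω) e ≤ B) (hξB : ξ ≤ 2 * B)
    {n : ℕ} (hn : 0 < n) {l : ℝ} (hl : 0 < l) (T₀ : V → V → ℝ≥0∞)
    (hT₀ : ∀ v w, T₀ v w = ∫⁻ ω, trans (x ω) v w ∂P)
    (hB₂ : (B + ξ : ℝ) +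
      Fintype.card G.edgeSet * Real.exp (-((ξ : ℝ) ^ 2 * n / (4 * B * m))) * m ≤ B₂) :
    ∫⁻ c, minCost T₀ B₂ c ∂Measure.pi μ ≤ ∫⁻ ω, nncost (vol (x ω)) (S ω) ∂P +
      ENNReal.ofReal (decoupleError cs B m ξ (Fintype.card G.edgeSet) (Fintype.card V) l n) := by
  classical
  set E : ℕ := Fintype.card G.edgeSet with hE
  set p : ℝ := E * Real.exp (-((ξ : ℝ) ^ 2 * n / (4 * B * m))) with hp
  have hp0 : 0 ≤ p := by positivity
  set θ : ℝ≥0 := m / n with hθdef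
  have hθ : θ * n = m := div_mul_cancel₀ _ (by exact_mod_cast hn.ne')
  let good : Ω → (Fin n → Option (SimplePath G)) → Prop := fun ω y =>
    ∀ e, vol (sampleFlow θ y) e ≤ vol (x ω) e + ξ
  let pr : Ω → (Fin n → Option (SimplePath G)) → ℝ≥0 := fun ω y => ∏ i, drawWeight m (x ω) (y i)
  -- The probability of drawing `y` from `x ω`, split according to whether `y` is good for this `ω`.
  -- The same `y` may be good for one `ω` and bad for another, so the convex combination below is
  -- indexed by `Bool` as well.
  let q : Bool → Ω → (Fin n → Option (SimplePath G)) → ℝ≥0 := fun b ω y =>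
    if (good ω y ↔ b = true) then pr ω y else 0
  have hprm : ∀ y, Measurable fun ω => pr ω y := fun y =>
    Finset.measurable_fun_prod _ fun i _ => (measurable_drawWeight m (y i)).comp hx
  have hgoodm : ∀ y, MeasurableSet {ω | good ω y} := fun y => by
    simp only [good, Set.ofPred_forall]
    exact MeasurableSet.iInter fun e => measurableSet_le measurable_const
      (((measurable_vol e).comp hx).add_const ξ)
  have hqm : ∀ b y, Measurable fun ω => q b ω y := by
    intro b y
    refine Measurable.ite ?_ (hprm y) measurable_const
    cases b
    · have : {ω | good ω y ↔ false = true} = {ω | good ω y}ᶜ := by ext ω; simp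
      rw [this]
      exact (hgoodm y).compl
    · have : {ω | good ω y ↔ true = true} = {ω | good ω y} := by ext ω; simp
      rw [this]
      exact hgoodm y
  have hprsum : ∀ ω, ∑ y, pr ω y = 1 := fun ω => by
    simp only [pr]
    rw [sum_prod_eq_pow, sum_drawWeight hm (hmass ω), one_pow]
  have hqsum : ∀ ω y, q true ω y + q false ω y = pr ω y := by
    intro ω y
    by_cases h : good ω y <;> simp [q, h]
  have hqle : ∀ b ω y, q b ω y ≤ pr ω y := by
    intro b ω y
    simp only [q]
    split_ifs <;> simp
  have hqtrue : ∀ ω, ∑ y, q true ω y ≤ 1 := fun ω =>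
    (Finset.sum_le_sum fun y _ => hqle true ω y).trans (hprsum ω).le
  have hqfalse : ∀ ω, ((∑ y, q false ω y : ℝ≥0) : ℝ) ≤ p := by
    intro ω
    refine le_trans (le_of_eq ?_) (sum_bad_le hm (hmass ω) hB (hvol ω) hξB hn hθ)
    push_cast
    refine Finset.sum_congr rfl fun y _ => ?_
    by_cases h : good ω y
    · have h' : ∀ e, vol (sampleFlow θ y) e ≤ vol (x ω) e + ξ := h
      simp [q, h, h']
    · have h' : ¬ ∀ e, vol (sampleFlow θ y) e ≤ vol (x ω) e + ξ := h
      simp only [q, h, if_neg h']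
      simp [pr]
  have hprle : ∀ ω y, pr ω y ≤ 1 := fun ω y =>
    (Finset.single_le_sum (f := pr ω) (by simp) (Finset.mem_univ y)).trans (hprsum ω).le
  have hqfin : ∀ b y, ∫⁻ ω, (q b ω y : ℝ≥0∞) ∂P ≠ ∞ := by
    intro b y
    refine ne_top_of_le_ne_top ENNReal.one_ne_top ?_
    calc ∫⁻ ω, (q b ω y : ℝ≥0∞) ∂P ≤ ∫⁻ _ω, 1 ∂P :=
          lintegral_mono fun ω => ENNReal.coe_le_one_iff.2 ((hqle b ω y).trans (hprle ω y))
      _ = 1 := by simp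
  let w : Bool × (Fin n → Option (SimplePath G)) → ℝ≥0 := fun by' =>
    (∫⁻ ω, (q by'.1 ω by'.2 : ℝ≥0∞) ∂P).toNNReal
  have hw : ∀ b y, (w (b, y) : ℝ≥0∞) = ∫⁻ ω, (q b ω y : ℝ≥0∞) ∂P := fun b y =>
    ENNReal.coe_toNNReal (hqfin b y)
  have hwb : ∀ b, ((∑ y, w (b, y) : ℝ≥0) : ℝ≥0∞) = ∫⁻ ω, ((∑ y, q b ω y : ℝ≥0) : ℝ≥0∞) ∂P := by
    intro b
    push_cast
    rw [lintegral_finsetSum _ fun y _ => (hqm b y).coe_nnreal_ennreal]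
    exact Finset.sum_congr rfl fun y _ => hw b y
  have hwtrue : ∑ y, w (true, y) ≤ 1 := by
    rw [← ENNReal.coe_le_coe, hwb]
    calc _ ≤ ∫⁻ _ω, 1 ∂P := lintegral_mono fun ω => ENNReal.coe_le_one_iff.2 (hqtrue ω)
      _ = 1 := by simp
  have hwfalse : ((∑ y, w (false, y) : ℝ≥0) : ℝ≥0∞) ≤ ENNReal.ofReal p := by
    rw [hwb]
    calc _ ≤ ∫⁻ _ω, ENNReal.ofReal p ∂P := lintegral_mono fun ω => by
          rw [← ENNReal.ofReal_coe_nnreal]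
          exact ENNReal.ofReal_le_ofReal (hqfalse ω)
      _ = _ := by simp
  have hwfalse' : ((∑ y, w (false, y) : ℝ≥0) : ℝ) ≤ p := by
    rw [← ENNReal.ofReal_coe_nnreal] at hwfalse
    exact (ENNReal.ofReal_le_ofReal_iff hp0).1 hwfalse
  have hwsum : ∑ by', w by' ≤ 1 := by
    rw [← ENNReal.coe_le_coe, Fintype.sum_prod_type, Fintype.sum_bool, ENNReal.coe_add, hwb, hwb,
      ← lintegral_add_left
        (Finset.measurable_fun_sum _ fun y _ => hqm true y).coe_nnreal_ennreal]
    calc _ ≤ ∫⁻ _ω, 1 ∂P := lintegral_mono fun ω => by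
          dsimp only
          rw [← ENNReal.coe_add, ← Finset.sum_add_distrib,
            Finset.sum_congr rfl fun y _ => hqsum ω y, hprsum ω, ENNReal.coe_one]
      _ = 1 := by simp
  let T : Bool × (Fin n → Option (SimplePath G)) → V → V → ℝ≥0 := fun by' =>
    trans (sampleFlow θ by'.2)
  -- Convexity is joint in the capacity: bad samples use the large capacity `m`, but with total
  -- weight at most `p`, so the mean capacity stays below `B₂`.
  let Bc : Bool × (Fin n → Option (SimplePath G)) → ℝ≥0 := fun by' =>
    if by'.1 = true then B + ξ else m
  have hT₀' : ∀ v v', T₀ v v' = ((∑ i, w i * T i v v' : ℝ≥0) : ℝ≥0∞) := by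
    intro v v'
    rw [hT₀, Fintype.sum_prod_type, Fintype.sum_bool, ← Finset.sum_add_distrib]
    have h1 : ∀ ω, (trans (x ω) v v' : ℝ≥0∞) = ∑ y, ((q true ω y : ℝ≥0∞) + q false ω y) *
        trans (sampleFlow θ y) v v' := by
      intro ω
      have h2 : x ω = fun σ => ∑ y, pr ω y * sampleFlow θ y σ := by
        funext σ
        exact (sum_prod_drawWeight_mul_sampleFlow hm (hmass ω) hθ σ).symm
      conv_lhs => rw [h2, trans_sum]
      push_cast
      refine Finset.sum_congr rfl fun y _ => ?_
      rw [← hqsum ω y, ENNReal.coe_add]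
    have hqa : ∀ y, Measurable fun ω => (q true ω y : ℝ≥0∞) + q false ω y := fun y =>
      (hqm true y).coe_nnreal_ennreal.add (hqm false y).coe_nnreal_ennreal
    simp only [h1]
    rw [lintegral_finsetSum _ fun y _ => (hqa y).mul_const _]
    push_cast
    refine Finset.sum_congr rfl fun y _ => ?_
    rw [lintegral_mul_const _ (hqa y), lintegral_add_left (hqm true y).coe_nnreal_ennreal,
      hw, hw, add_mul]
  have hBc : ∑ i, w i * Bc i ≤ B₂ := by
    rw [Fintype.sum_prod_type, Fintype.sum_bool]
    simp only [Bc, if_true, Bool.false_eq_true, if_false]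
    rw [← Finset.sum_mul, ← Finset.sum_mul, ← NNReal.coe_le_coe]
    refine le_trans ?_ hB₂
    rw [NNReal.coe_add, NNReal.coe_mul, NNReal.coe_mul, NNReal.coe_add]
    gcongr
    calc ((∑ y, w (true, y) : ℝ≥0) : ℝ) * (B + ξ) ≤ 1 * (B + ξ) := by
          gcongr; exact_mod_cast hwtrue
      _ = _ := one_mul _
  let ρ : Measure (Environment G) := Measure.pi μ
  have hae : ∀ᵐ c ∂ρ, ∀ e, c e ≤ cs := by
    rw [ae_all_iff]
    intro e
    exact (Measure.quasiMeasurePreserving_eval μ e).ae (hμ e)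
  obtain ⟨W, hWm, hWint, hW⟩ := exists_deviation_bound
    (fun (τ : Fin n → Option (V × V)) v w => (sampleTrans θ τ v w : ℝ≥0∞)) (B + ξ) cs μ hμ hl
  set a : ℝ := (Real.log (Fintype.card (Fin n → Option (V × V))) +
    Fintype.card G.edgeSet * (l ^ 2 * (cs * ((B + ξ : ℝ≥0) : ℝ) ^ 2 : ℝ) ^ 2 / 2)) / l with ha
  have hSae : ∀ {r : Environment G → Prop}, (∀ᵐ c ∂ρ, r c) → ∀ᵐ ω ∂P, r (S ω) := fun h =>
    ae_of_ae_map hS.aemeasurable (by rwa [hlaw])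
  have hgoodpart : ∑ y, (w (true, y) : ℝ≥0∞) *
      ∫⁻ c, minCost (fun v v' => (T (true, y) v v' : ℝ≥0∞)) (B + ξ) c ∂ρ ≤
      ∫⁻ ω, nncost (vol (x ω)) (S ω) ∂P +
        ENNReal.ofReal (cs * E * (2 * B * ξ + ξ ^ 2)) + ENNReal.ofReal a +
        ENNReal.ofReal (1 / l) := by
    let h : (Fin n → Option (SimplePath G)) → ℝ≥0∞ := fun y =>
      ∫⁻ c, minCost (fun v v' => (T (true, y) v v' : ℝ≥0∞)) (B + ξ) c ∂ρ
    have h1 : ∑ y, (w (true, y) : ℝ≥0∞) * h y = ∫⁻ ω, ∑ y, (q true ω y : ℝ≥0∞) * h y ∂P := by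
      rw [lintegral_finsetSum _ fun y _ => (hqm true y).coe_nnreal_ennreal.mul_const _]
      refine Finset.sum_congr rfl fun y _ => ?_
      rw [lintegral_mul_const _ (hqm true y).coe_nnreal_ennreal, hw]
    have h2 : ∀ᵐ ω ∂P, ∑ y, (q true ω y : ℝ≥0∞) * h y ≤ (nncost (vol (x ω)) (S ω) : ℝ≥0∞) +
        (ENNReal.ofReal (cs * E * (2 * B * ξ + ξ ^ 2)) + ENNReal.ofReal a + W (S ω)) := by
      filter_upwards [hSae hae, hSae hW] with ω hω1 hω2
      set R : ℝ≥0∞ := (nncost (vol (x ω)) (S ω) : ℝ≥0∞) +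
        (ENNReal.ofReal (cs * E * (2 * B * ξ + ξ ^ 2)) + ENNReal.ofReal a + W (S ω)) with hR
      have h3 : ∀ y, (q true ω y : ℝ≥0∞) * h y ≤ (q true ω y : ℝ≥0∞) * R := by
        intro y
        by_cases hy : good ω y
        · gcongr
          -- The mean over a fresh environment is bounded by the cost in `S ω` itself, where the
          -- sample is a competitor close to `x ω`.
          have h4 := hω2 fun i => drawEnds (y i)
          have h5 : (fun v v' => (sampleTrans θ (fun i => drawEnds (y i)) v v' : ℝ≥0∞)) =
              fun v v' => (trans (sampleFlow θ y) v v' : ℝ≥0∞) := by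
            funext v v'
            rw [trans_sampleFlow]
          simp only [h5] at h4
          refine h4.trans ?_
          have h6 := minCost_le_of_simple (sampleFlow θ y) (B + ξ)
            (fun e => (hy e).trans (by gcongr; exact hvol ω e)) (S ω)
          have h7 := nncost_le_of_le_add (hvol ω) hy hω1
          have h8 : (cs * Fintype.card G.edgeSet * (2 * B * ξ + ξ ^ 2) : ℝ≥0) =
              ENNReal.ofReal (cs * E * (2 * B * ξ + ξ ^ 2)) := by
            rw [← ENNReal.ofReal_coe_nnreal]
            push_cast
            rfl
          rw [hR, ← h8, ← add_assoc, ← add_assoc, ← ENNReal.coe_add]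
          gcongr
          exact h6.trans (by exact_mod_cast h7)
        · simp [q, hy]
      calc ∑ y, (q true ω y : ℝ≥0∞) * h y ≤ ∑ y, (q true ω y : ℝ≥0∞) * R :=
            Finset.sum_le_sum fun y _ => h3 y
        _ = ((∑ y, q true ω y : ℝ≥0) : ℝ≥0∞) * R := by
            push_cast
            rw [Finset.sum_mul]
        _ ≤ 1 * R := by gcongr; exact_mod_cast hqtrue ω
        _ = R := one_mul _
    change ∑ y, (w (true, y) : ℝ≥0∞) * h y ≤ _
    rw [h1]
    refine (lintegral_mono_ae h2).trans ?_
    have hWS : Measurable fun ω => W (S ω) := hWm.comp hS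
    have hWS' : Measurable fun ω => ENNReal.ofReal (cs * E * (2 * B * ξ + ξ ^ 2)) +
        ENNReal.ofReal a + W (S ω) := hWS.const_add _
    rw [lintegral_add_right _ hWS', lintegral_add_right _ hWS,
      lintegral_const, measure_univ, mul_one, ← lintegral_map hWm hS, hlaw, ← add_assoc, ← add_assoc]
    gcongr
  have hbadpart : ∑ y, (w (false, y) : ℝ≥0∞) *
      ∫⁻ c, minCost (fun v v' => (T (false, y) v v' : ℝ≥0∞)) m c ∂ρ ≤
      ENNReal.ofReal (p * (cs * E * m ^ 2)) := by
    have h1 : ∀ y, ∫⁻ c, minCost (fun v v' => (T (false, y) v v' : ℝ≥0∞)) m c ∂ρ ≤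
        ((cs * E * m ^ 2 : ℝ≥0) : ℝ≥0∞) := by
      intro y
      calc _ ≤ ∫⁻ _c, ((cs * E * m ^ 2 : ℝ≥0) : ℝ≥0∞) ∂ρ := by
            refine lintegral_mono_ae ?_
            filter_upwards [hae] with c hc
            exact minCost_le_mul_card (sampleFlow θ y) m cs
              (fun e => (vol_sampleFlow_le θ y e).trans hθ.le) c hc
        _ = _ := by simp [ρ]
    calc _ ≤ ∑ y, (w (false, y) : ℝ≥0∞) * ((cs * E * m ^ 2 : ℝ≥0) : ℝ≥0∞) :=
          Finset.sum_le_sum fun y _ => by gcongr; exact h1 y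
      _ = ((∑ y, w (false, y) : ℝ≥0) : ℝ≥0∞) * ((cs * E * m ^ 2 : ℝ≥0) : ℝ≥0∞) := by
          push_cast
          rw [Finset.sum_mul]
      _ ≤ ENNReal.ofReal p * ((cs * E * m ^ 2 : ℝ≥0) : ℝ≥0∞) := by gcongr
      _ = _ := by
          rw [ENNReal.ofReal_mul hp0, ← ENNReal.ofReal_coe_nnreal]
          push_cast
          rfl
  have hmain : ∫⁻ c, minCost T₀ B₂ c ∂ρ ≤
      ∑ i, (w i : ℝ≥0∞) * ∫⁻ c, minCost (fun v v' => (T i v v' : ℝ≥0∞)) (Bc i) c ∂ρ := by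
    refine (lintegral_mono fun c => minCost_convex w hwsum T T₀ hT₀' Bc B₂ hBc c).trans ?_
    rw [lintegral_finsetSum _ fun i _ => (measurable_minCost _ _).const_mul _]
    exact le_of_eq (Finset.sum_congr rfl fun i _ => lintegral_const_mul _ (measurable_minCost _ _))
  refine hmain.trans ?_
  rw [Fintype.sum_prod_type, Fintype.sum_bool]
  refine (add_le_add hgoodpart hbadpart).trans (le_of_eq ?_)
  have ha0 : 0 ≤ a := by
    have : 0 ≤ Real.log (Fintype.card (Fin n → Option (V × V))) := Real.log_natCast_nonneg _
    positivity
  rw [add_assoc, add_assoc, add_assoc, ← ENNReal.ofReal_add (by positivity) (by positivity),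
    ← ENNReal.ofReal_add ha0 (by positivity), ← ENNReal.ofReal_add (by positivity) (by positivity)]
  congr 2
  rw [decoupleError, ha, hp]
  simp only [Fintype.card_fun, Fintype.card_option, Fintype.card_prod, Fintype.card_fin]
  push_cast
  rw [← hE]
  ring_nf

end Decoupling

end LatticeFlow

end

noncomputable section

namespace LatticeFlow

open MeasureTheory SimpleGraph

/-! ### Cutting walks along the boundary of a subgraph -/

section Cutting

variable {V I D : Type*} [DecidableEq V] [DecidableEq I] [DecidableEq D] {G : SimpleGraph V}
  {H : SimpleGraph (I ⊕ D)}

/-- `H` is realized in `G` by `ι` such that every edge of `G` at an internal vertex `inl q` comes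
from `H`, and each boundary vertex `inr b` is joined in `H` to the internal vertex `att b` only. -/
structure Realization (H : SimpleGraph (I ⊕ D)) (G : SimpleGraph V) where
  ι : I ⊕ D → V
  inj : Function.Injective ι
  hom : ∀ {a b}, H.Adj a b → G.Adj (ι a) (ι b)
  full : ∀ {q v}, G.Adj (ι (.inl q)) v → ∃ z, v = ι z ∧ H.Adj (.inl q) z
  att : D → I
  adj_att : ∀ b, H.Adj (.inr b) (.inl (att b))
  att_eq : ∀ {b z}, H.Adj (.inr b) z → z = .inl (att b)

open Classical in
/-- Indicator of the internal vertices. -/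
def Realization.inside (R : Realization H G) (v : V) : ℕ := if ∃ q, v = R.ι (.inl q) then 1 else 0

/-- Number of entrances through `b`. -/
def Realization.entries (R : Realization H G) {u v : V} (w : G.Walk u v) (b : D) : ℕ :=
  w.darts.countP fun d => d.fst = R.ι (.inr b) ∧ d.snd = R.ι (.inl (R.att b))

/-- Number of exits through `b`. -/
def Realization.exits (R : Realization H G) {u v : V} (w : G.Walk u v) (b : D) : ℕ :=
  w.darts.countP fun d => d.fst = R.ι (.inl (R.att b)) ∧ d.snd = R.ι (.inr b)

/-- `L` consists of the pieces of `w`, if the paths that come before `w` have their entrances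
counted by `a` and their crossings counted by `k`; the last piece leads to `b₀`. -/
structure IsCut (R : Realization H G) (b₀ : D) {u v : V} (w : G.Walk u v) (L : List (FinPath H))
    (a : D → ℕ) (k : H.edgeSet → ℕ) : Prop where
  boundary : ∀ σ ∈ L, (∃ b, σ.ent = .inr b) ∧ ∃ b, σ.exi = .inr b
  ent : ∀ b, L.countP (fun σ => σ.ent = .inr b) = a b + R.entries w b
  exi : ∀ b, L.countP (fun σ => σ.exi = .inr b) =
    R.exits w b + if b = b₀ then R.inside v else 0
  cross : ∀ e, (L.map fun σ => σ.crossings e).sum ≤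
    k e + w.edges.count (Sym2.map R.ι e) + R.inside v

/-- Induction along the walk with two states: outside, with no open piece, or at an internal vertex,
with an open piece `pre` that began at `b₁`. The open piece is charged to `a` and `k`. -/
theorem exists_isCut_aux (R : Realization H G) (b₀ : D) (hcon : ∀ q, H.Reachable (.inl q) (.inr b₀))
    {u v : V} (w : G.Walk u v) :
    ((∀ q, u ≠ R.ι (.inl q)) → ∃ L, IsCut R b₀ w L (fun _ => 0) (fun _ => 0)) ∧
    ∀ q, u = R.ι (.inl q) → ∀ b₁ (pre : H.Walk (.inr b₁) (.inl q)),
      ∃ L, IsCut R b₀ w L (fun b => if b = b₁ then 1 else 0) (fun e => pre.edges.count (e : Sym2 (I ⊕ D))) := by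
  have hinj : ∀ {a b}, R.ι a = R.ι b ↔ a = b := R.inj.eq_iff
  induction w with
  | nil =>
    refine ⟨fun hu => ⟨[], ?_, ?_, ?_, ?_⟩, ?_⟩
    · simp
    · simp [Realization.entries]
    · simp [Realization.exits, Realization.inside, hu]
    · simp
    · rintro q rfl b₁ pre
      -- The walk ends inside, so the open piece is completed to `b₀` by a loop-free path, which
      -- crosses each edge at most once; this is the term `R.inside v`.
      obtain ⟨c⟩ := hcon q
      refine ⟨[⟨_, _, pre.append c.bypass⟩], ?_, ?_, ?_, ?_⟩
      · simp
      · intro b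
        simp [Realization.entries, eq_comm]
      · intro b
        simp [Realization.exits, Realization.inside, hinj, eq_comm]
      · intro e
        simp only [List.map_cons, List.map_nil, List.sum_singleton, FinPath.crossings,
          Walk.edges_append, List.count_append, Walk.edges_nil, List.count_nil, add_zero]
        gcongr
        have h1 := List.nodup_iff_count_le_one.1 (Walk.bypass_isPath c).isTrail.edges_nodup
          (e : Sym2 (I ⊕ D))
        simpa [Realization.inside, hinj] using h1
  | @cons u u' v h w ih =>
    have hent : ∀ b, R.entries (Walk.cons h w) b = R.entries w b +
        if u = R.ι (.inr b) ∧ u' = R.ι (.inl (R.att b)) then 1 else 0 := fun b => by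
      simp [Realization.entries, List.countP_cons]
    have hexi : ∀ b, R.exits (Walk.cons h w) b = R.exits w b +
        if u = R.ι (.inl (R.att b)) ∧ u' = R.ι (.inr b) then 1 else 0 := fun b => by
      simp [Realization.exits, List.countP_cons]
    have hcount : ∀ s, (Walk.cons h w).edges.count s = w.edges.count s +
        if s(u, u') = s then 1 else 0 := fun s => by
      simp [List.count_cons]
    refine ⟨fun hu => ?_, ?_⟩
    · by_cases hu' : ∃ q', u' = R.ι (.inl q')
      · obtain ⟨q', rfl⟩ := hu'
        obtain ⟨z, hz, hadj⟩ := R.full h.symm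
        obtain ⟨b, rfl⟩ : ∃ b, z = .inr b := by
          rcases z with q | b
          · exact absurd hz (hu q)
          · exact ⟨b, rfl⟩
        have hq' : q' = R.att b := Sum.inl_injective (R.att_eq hadj.symm)
        -- An entrance through `b`: a new piece is opened, consisting of this step.
        obtain ⟨L, hL⟩ := ih.2 q' rfl b (Walk.cons hadj.symm Walk.nil)
        refine ⟨L, hL.boundary, fun b' => ?_, fun b' => ?_, fun e => ?_⟩
        · rw [hL.ent, hent]
          subst hz hq'
          by_cases hb : b' = b
          · subst hb; simp; ring
          · have hb' : b ≠ b' := fun h => hb h.symm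
            simp [hinj, hb, hb']
        · rw [hL.exi, hexi]
          simp [hinj]
        · refine (hL.cross e).trans ?_
          rw [hcount]
          simp only [Walk.edges_cons, Walk.edges_nil, List.count_cons, List.count_nil, zero_add,
            beq_iff_eq]
          have : (if s(Sum.inr b, Sum.inl q') = (e : Sym2 (I ⊕ D)) then 1 else 0) ≤
              if s(u, R.ι (.inl q')) = Sym2.map R.ι e then 1 else 0 := by
            split_ifs with h1 h2
            · exact le_rfl
            · exact absurd (by rw [← h1, Sym2.map_mk, hz]) h2
            · exact Nat.zero_le _
            · exact le_rfl
          omega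
      · push Not at hu'
        obtain ⟨L, hL⟩ := ih.1 hu'
        refine ⟨L, hL.boundary, fun b' => ?_, fun b' => ?_, fun e => ?_⟩
        · rw [hL.ent, hent]
          simp [hu']
        · rw [hL.exi, hexi]
          simp [hu]
        · refine (hL.cross e).trans ?_
          rw [hcount]
          gcongr
          omega
    · rintro q rfl b₁ pre
      obtain ⟨z, rfl, hadj⟩ := R.full h
      have hedge : ∀ e : H.edgeSet, (if s(Sum.inl q, z) = (e : Sym2 (I ⊕ D)) then 1 else 0) ≤
          if s(R.ι (.inl q), R.ι z) = Sym2.map R.ι e then 1 else 0 := by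
        intro e
        split_ifs with h1 h2
        · exact le_rfl
        · exact absurd (by rw [← h1, Sym2.map_mk]) h2
        · exact Nat.zero_le _
        · exact le_rfl
      rcases z with q' | b
      · obtain ⟨L, hL⟩ := ih.2 q' rfl b₁ (pre.concat hadj)
        refine ⟨L, hL.boundary, fun b' => ?_, fun b' => ?_, fun e => ?_⟩
        · rw [hL.ent, hent]
          simp [hinj]
        · rw [hL.exi, hexi]
          simp [hinj]
        · refine (hL.cross e).trans ?_
          rw [hcount]
          have := hedge e
          simp only [Walk.edges_concat, List.concat_eq_append, List.count_append, List.count_cons,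
            List.count_nil, zero_add, beq_iff_eq]
          omega
      · have hq : q = R.att b := Sum.inl_injective (R.att_eq hadj.symm)
        -- An exit through `b`: the open piece is closed and the rest of the walk starts outside.
        obtain ⟨L, hL⟩ := ih.1 (fun q' hq' => by simpa using R.inj hq')
        refine ⟨⟨_, _, pre.concat hadj⟩ :: L, ?_, fun b' => ?_, fun b' => ?_, fun e => ?_⟩
        · intro σ hσ
          rcases List.mem_cons.1 hσ with rfl | hσ
          · exact ⟨⟨_, rfl⟩, ⟨_, rfl⟩⟩
          · exact hL.boundary σ hσ
        · rw [List.countP_cons, hL.ent, hent]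
          by_cases hb : b' = b₁
          · subst hb; simp [hinj]; ring
          · have hb' : b₁ ≠ b' := fun h => hb h.symm
            simp [hinj, hb, hb']
        · rw [List.countP_cons, hL.exi, hexi]
          subst hq
          by_cases hb : b' = b
          · subst hb; simp; ring
          · have hb' : b ≠ b' := fun h => hb h.symm
            simp [hinj, hb']
        · have h1 := hL.cross e
          have := hedge e
          rw [hcount]
          simp only [List.map_cons, List.sum_cons, FinPath.crossings, Walk.edges_concat,
            List.concat_eq_append, List.count_append, List.count_cons, List.count_nil, zero_add,
            beq_iff_eq] at h1 ⊢
          omega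

/-- Every walk in `G` can be cut into pieces that are paths in `H` between boundary points; the
first and the last piece are completed by paths from and to `b₀`. -/
theorem exists_isCut (R : Realization H G) (b₀ : D) (hcon : ∀ q, H.Reachable (.inl q) (.inr b₀))
    {u v : V} (w : G.Walk u v) :
    ∃ L, IsCut R b₀ w L (fun b => if b = b₀ then R.inside u else 0) (fun _ => R.inside u) := by
  by_cases hu : ∃ q, u = R.ι (.inl q)
  · obtain ⟨q, hq⟩ := hu
    obtain ⟨c⟩ := (hcon q).symm
    -- A walk that starts inside is treated as if it had just arrived from `b₀`.
    obtain ⟨L, hL⟩ := (exists_isCut_aux R b₀ hcon w).2 q hq b₀ c.bypass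
    have h1 : R.inside u = 1 := by simp [Realization.inside, hq, R.inj.eq_iff]
    refine ⟨L, hL.boundary, fun b => ?_, hL.exi, fun e => (hL.cross e).trans ?_⟩
    · rw [hL.ent, h1]
    · rw [h1]
      gcongr
      exact List.nodup_iff_count_le_one.1 (Walk.bypass_isPath c).isTrail.edges_nodup _
  · push Not at hu
    obtain ⟨L, hL⟩ := (exists_isCut_aux R b₀ hcon w).1 hu
    have h1 : R.inside u = 0 := by simp [Realization.inside, hu]
    refine ⟨L, hL.boundary, fun b => ?_, hL.exi, fun e => (hL.cross e).trans ?_⟩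
    · rw [hL.ent, h1]; simp
    · rw [h1]

end Cutting

end LatticeFlow

end

noncomputable section

namespace LatticeFlow

open MeasureTheory SimpleGraph

/-! ### The extended square as a part of the torus -/

section Embedding

variable {M N : ℕ} [NeZero N]

theorem cycleGraph_adj_iff (hN : 2 ≤ N) {u v : Fin N} :
    (cycleGraph N).Adj u v ↔ v = u + 1 ∨ u = v + 1 := by
  obtain ⟨n, rfl⟩ : ∃ n, N = n + 2 := ⟨N - 2, by omega⟩
  rw [cycleGraph_adj, sub_eq_iff_eq_add', sub_eq_iff_eq_add', or_comm]

theorem ofNat_add_one (k : ℕ) : Fin.ofNat N (k + 1) = Fin.ofNat N k + 1 := by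
  ext
  simp [Fin.val_add, Nat.add_mod]

theorem ofNat_inj {a b : ℕ} (ha : a < N) (hb : b < N) (h : Fin.ofNat N a = Fin.ofNat N b) :
    a = b := by
  have := congrArg Fin.val h
  simpa [Nat.mod_eq_of_lt ha, Nat.mod_eq_of_lt hb] using this

/-- Position of the vertices of the extended square in the square `[0, M + 1]²`. -/
def offset : SqVertex M → ℕ × ℕ
  | .inl p => (p.1 + 1, p.2 + 1)
  | .inr (.left, j) => (0, j + 1)
  | .inr (.right, j) => (M + 1, j + 1)
  | .inr (.bottom, i) => (i + 1, 0)
  | .inr (.top, i) => (i + 1, M + 1)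

theorem offset_lt (z : SqVertex M) : (offset z).1 < M + 2 ∧ (offset z).2 < M + 2 := by
  rcases z with ⟨x, y⟩ | ⟨_ | _ | _ | _, j⟩ <;> simp only [offset] <;> omega

theorem offset_injective : Function.Injective (offset (M := M)) := by
  intro z z' h
  rcases z with ⟨x, y⟩ | ⟨_ | _ | _ | _, j⟩ <;>
    rcases z' with ⟨x', y'⟩ | ⟨_ | _ | _ | _, j'⟩ <;>
    simp only [offset, Prod.mk.injEq] at h <;>
    first
    | (exfalso; omega)
    | (simp only [Sum.inl.injEq, Sum.inr.injEq, Prod.mk.injEq, true_and, Fin.ext_iff]; omega)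

/-- The internal vertex at a boundary point. -/
def attach : Bou M → Fin M × Fin M
  | (.left, j) => (⟨0, j.pos⟩, j)
  | (.right, j) => (⟨M - 1, by have := j.pos; omega⟩, j)
  | (.bottom, i) => (i, ⟨0, i.pos⟩)
  | (.top, i) => (i, ⟨M - 1, by have := i.pos; omega⟩)

theorem attached_iff {q : Fin M × Fin M} {b : Bou M} : Attached q b ↔ q = attach b := by
  obtain ⟨x, y⟩ := q
  obtain ⟨_ | _ | _ | _, j⟩ := b <;> simp only [Attached, attach, Prod.mk.injEq, Fin.ext_iff] <;>
    omega

theorem offset_adj {z z' : SqVertex M} (h : (extSquare M).Adj z z') :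
    ((offset z').1 = (offset z).1 + 1 ∧ (offset z').2 = (offset z).2) ∨
    ((offset z).1 = (offset z').1 + 1 ∧ (offset z').2 = (offset z).2) ∨
    ((offset z').2 = (offset z).2 + 1 ∧ (offset z').1 = (offset z).1) ∨
    ((offset z).2 = (offset z').2 + 1 ∧ (offset z').1 = (offset z).1) := by
  rcases z with ⟨x, y⟩ | ⟨_ | _ | _ | _, j⟩ <;>
    rcases z' with ⟨x', y'⟩ | ⟨_ | _ | _ | _, j'⟩ <;>
    simp only [extSquare, SqAdj, Attached, boxProd_adj, pathGraph_adj, Fin.ext_iff] at h <;>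
    simp only [offset] <;> omega

/-- The position in the torus of the vertices of the extended square with lower left corner
`p + (1, 1)`. -/
def place (p : Fin N × Fin N) (z : SqVertex M) : Fin N × Fin N :=
  (p.1 + Fin.ofNat N (offset z).1, p.2 + Fin.ofNat N (offset z).2)

theorem place_eq (p : Fin N × Fin N) (z : SqVertex M) : place p z = p + place 0 z := by
  ext <;> simp [place]

/-- The offsets lie in `[0, M + 1]`, so with `M + 2 ≤ N` nothing wraps around the torus. -/
theorem place_injective (hMN : M + 2 ≤ N) (p : Fin N × Fin N) :
    Function.Injective (place (M := M) p) := by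
  intro z z' h
  simp only [place, Prod.mk.injEq, add_right_inj] at h
  have h1 := offset_lt z
  have h2 := offset_lt z'
  refine offset_injective (Prod.ext ?_ ?_)
  · exact ofNat_inj (by omega) (by omega) h.1
  · exact ofNat_inj (by omega) (by omega) h.2

theorem torus_adj_iff (hN : 2 ≤ N) {u v : Fin N × Fin N} : (torus N).Adj u v ↔
    v = u + (1, 0) ∨ u = v + (1, 0) ∨ v = u + (0, 1) ∨ u = v + (0, 1) := by
  obtain ⟨a, b⟩ := u
  obtain ⟨c, d⟩ := v
  simp only [boxProd_adj, cycleGraph_adj_iff hN, Prod.mk_add_mk, Prod.mk.injEq, add_zero]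
  constructor
  · rintro (⟨h | h, h'⟩ | ⟨h | h, h'⟩) <;> simp [h, h']
  · rintro (⟨h, h'⟩ | ⟨h, h'⟩ | ⟨h, h'⟩ | ⟨h, h'⟩) <;> simp [h, h']

theorem place_right {p : Fin N × Fin N} {z z' : SqVertex M}
    (h : (offset z').1 = (offset z).1 + 1 ∧ (offset z').2 = (offset z).2) :
    place p z' = place p z + (1, 0) := by
  simp only [place, h.1, h.2, ofNat_add_one, Prod.mk_add_mk, add_assoc, add_zero]

theorem place_up {p : Fin N × Fin N} {z z' : SqVertex M}
    (h : (offset z').2 = (offset z).2 + 1 ∧ (offset z').1 = (offset z).1) :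
    place p z' = place p z + (0, 1) := by
  simp only [place, h.1, h.2, ofNat_add_one, Prod.mk_add_mk, add_assoc, add_zero]

theorem place_adj (hN : 2 ≤ N) (p : Fin N × Fin N) {z z' : SqVertex M}
    (h : (extSquare M).Adj z z') : (torus N).Adj (place p z) (place p z') := by
  rw [torus_adj_iff hN]
  rcases offset_adj h with h | h | h | h
  · exact Or.inl (place_right h)
  · exact Or.inr (Or.inl (place_right ⟨h.1, h.2.symm⟩))
  · exact Or.inr (Or.inr (Or.inl (place_up h)))
  · exact Or.inr (Or.inr (Or.inr (place_up ⟨h.1, h.2.symm⟩)))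

/-- The neighbour to the right of an internal vertex. -/
theorem exists_right (q : Fin M × Fin M) : ∃ z, (extSquare M).Adj (.inl q) z ∧
    (offset z).1 = (offset (.inl q)).1 + 1 ∧ (offset z).2 = (offset (.inl q)).2 := by
  obtain ⟨x, y⟩ := q
  by_cases hx : (x : ℕ) + 1 < M
  · refine ⟨.inl (⟨x + 1, hx⟩, y), ?_, ?_⟩
    · simp [extSquare, SqAdj, boxProd_adj, pathGraph_adj]
    · simp [offset]
  · refine ⟨.inr (.right, y), ?_, ?_⟩
    · simp only [extSquare, SqAdj, Attached, and_true]
      omega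
    · simp only [offset, and_true]
      omega

theorem exists_left (q : Fin M × Fin M) : ∃ z, (extSquare M).Adj (.inl q) z ∧
    (offset (.inl q)).1 = (offset z).1 + 1 ∧ (offset (.inl q)).2 = (offset z).2 := by
  obtain ⟨x, y⟩ := q
  by_cases hx : (x : ℕ) = 0
  · refine ⟨.inr (.left, y), ?_, ?_⟩
    · simp only [extSquare, SqAdj, Attached, and_true]
      omega
    · simp only [offset, and_true]
      omega
  · refine ⟨.inl (⟨x - 1, by omega⟩, y), ?_, ?_⟩
    · simp only [extSquare, SqAdj, boxProd_adj, pathGraph_adj, and_true]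
      omega
    · simp only [offset, and_true]
      omega

theorem exists_up (q : Fin M × Fin M) : ∃ z, (extSquare M).Adj (.inl q) z ∧
    (offset z).2 = (offset (.inl q)).2 + 1 ∧ (offset z).1 = (offset (.inl q)).1 := by
  obtain ⟨x, y⟩ := q
  by_cases hy : (y : ℕ) + 1 < M
  · refine ⟨.inl (x, ⟨y + 1, hy⟩), ?_, ?_⟩
    · simp [extSquare, SqAdj, boxProd_adj, pathGraph_adj]
    · simp [offset]
  · refine ⟨.inr (.top, x), ?_, ?_⟩
    · simp only [extSquare, SqAdj, Attached, and_true]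
      omega
    · simp only [offset, and_true]
      omega

theorem exists_down (q : Fin M × Fin M) : ∃ z, (extSquare M).Adj (.inl q) z ∧
    (offset (.inl q)).2 = (offset z).2 + 1 ∧ (offset (.inl q)).1 = (offset z).1 := by
  obtain ⟨x, y⟩ := q
  by_cases hy : (y : ℕ) = 0
  · refine ⟨.inr (.bottom, x), ?_, ?_⟩
    · simp only [extSquare, SqAdj, Attached, and_true]
      omega
    · simp only [offset, and_true]
      omega
  · refine ⟨.inl (x, ⟨y - 1, by omega⟩), ?_, ?_⟩
    · simp only [extSquare, SqAdj, boxProd_adj, pathGraph_adj, and_true]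
      omega
    · simp only [offset, and_true]
      omega

/-- The extended square at the position `p` of the torus. -/
def squareAt (hMN : M + 2 ≤ N) (p : Fin N × Fin N) : Realization (extSquare M) (torus N) where
  ι := place p
  inj := place_injective hMN p
  hom := place_adj (by omega) p
  full := by
    intro q v h
    rcases (torus_adj_iff (by omega)).1 h with h | h | h | h
    · obtain ⟨z, hz, ho⟩ := exists_right q
      exact ⟨z, by rw [h, place_right ho], hz⟩
    · obtain ⟨z, hz, ho⟩ := exists_left q
      exact ⟨z, add_right_cancel (h.symm.trans (place_right ho)), hz⟩
    · obtain ⟨z, hz, ho⟩ := exists_up q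
      exact ⟨z, by rw [h, place_up ho], hz⟩
    · obtain ⟨z, hz, ho⟩ := exists_down q
      exact ⟨z, add_right_cancel (h.symm.trans (place_up ho)), hz⟩
  att := attach
  adj_att b := attached_iff.2 rfl
  att_eq := by
    intro b z h
    rcases z with q | b'
    · rw [attached_iff.1 h]
    · exact h.elim

/-- The step of the torus that enters a square through the given side. -/
def inStep : Side → Fin N × Fin N
  | .left => (1, 0)
  | .right => (-1, 0)
  | .bottom => (0, 1)
  | .top => (0, -1)

/-- The opposite side. -/
def Side.opp : Side → Side
  | .left => .right
  | .right => .left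
  | .bottom => .top
  | .top => .bottom

theorem reflect_eq (b : Bou M) : Bou.reflect b = (b.1.opp, b.2) := by
  obtain ⟨_ | _ | _ | _, j⟩ := b <;> rfl

theorem opp_opp (s : Side) : s.opp.opp = s := by cases s <;> rfl

theorem inStep_opp (s : Side) : inStep (N := N) s.opp = -inStep s := by
  cases s <;> simp [Side.opp, inStep]

theorem place_attach (p : Fin N × Fin N) (b : Bou M) :
    place p (.inl (attach b)) = place p (.inr b) + inStep b.1 := by
  obtain ⟨_ | _ | _ | _, j⟩ := b
  · exact place_right (by simp [offset, attach])
  · rw [show inStep (N := N) Side.right = -(1, 0) by simp [inStep], ← sub_eq_add_neg,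
      eq_sub_iff_add_eq]
    refine (place_right ?_).symm
    have := j.pos
    simp only [offset, attach, and_true]
    omega
  · exact place_up (by simp [offset, attach])
  · rw [show inStep (N := N) Side.top = -(0, 1) by simp [inStep], ← sub_eq_add_neg,
      eq_sub_iff_add_eq]
    refine (place_up ?_).symm
    have := j.pos
    simp only [offset, attach, and_true]
    omega

/-- Number of steps of a walk in the torus in the direction that enters squares through `s`. -/
def steps {u v : Fin N × Fin N} (w : (torus N).Walk u v) (s : Side) : ℕ :=
  w.darts.countP fun d => d.snd = d.fst + inStep s

theorem sum_countP {α β : Type*} [Fintype α] (l : List β) (P : α → β → Prop)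
    [∀ a b, Decidable (P a b)] (Q : β → Prop) [DecidablePred Q]
    (h : ∀ b ∈ l, ∑ a, (if P a b then 1 else 0) = if Q b then 1 else 0) :
    ∑ a, l.countP (fun b => P a b) = l.countP (fun b => Q b) := by
  induction l with
  | nil => simp
  | cons b l ih =>
    simp only [List.countP_cons, decide_eq_true_eq]
    rw [Finset.sum_add_distrib, ih fun b hb => h b (List.mem_cons_of_mem _ hb),
      h b List.mem_cons_self]

/-- A given step in the direction that enters through the side of `b` uses the half-edge at `b` for
exactly one position of the square. -/
theorem sum_entries (hMN : M + 2 ≤ N) {u v : Fin N × Fin N} (w : (torus N).Walk u v) (b : Bou M) :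
    ∑ p, (squareAt hMN p).entries w b = steps w b.1 := by
  refine sum_countP _ (fun (p : Fin N × Fin N) (d : (torus N).Dart) =>
    d.fst = place p (.inr b) ∧ d.snd = place p (.inl (attach b))) _ fun d _ => ?_
  have : ∀ p, (d.fst = place p (.inr b) ∧ d.snd = place p (.inl (attach b))) ↔
      p = d.fst - place 0 (.inr b) ∧ d.snd = d.fst + inStep b.1 := by
    intro p
    rw [place_attach, place_eq p, eq_sub_iff_add_eq, eq_comm (a := d.fst)]
    constructor
    · rintro ⟨h, h'⟩; exact ⟨h, by rw [h', h]⟩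
    · rintro ⟨h, h'⟩; exact ⟨h, by rw [h', h]⟩
  simp only [this, ite_and, Finset.sum_ite_eq', Finset.mem_univ, if_true]

theorem sum_exits (hMN : M + 2 ≤ N) {u v : Fin N × Fin N} (w : (torus N).Walk u v) (b : Bou M) :
    ∑ p, (squareAt hMN p).exits w b = steps w b.1.opp := by
  refine sum_countP _ (fun (p : Fin N × Fin N) (d : (torus N).Dart) =>
    d.fst = place p (.inl (attach b)) ∧ d.snd = place p (.inr b)) _ fun d _ => ?_
  have : ∀ p, (d.fst = place p (.inl (attach b)) ∧ d.snd = place p (.inr b)) ↔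
      p = d.snd - place 0 (.inr b) ∧ d.snd = d.fst + inStep b.1.opp := by
    intro p
    rw [place_attach, place_eq p, eq_sub_iff_add_eq, eq_comm (a := d.snd), inStep_opp,
      ← sub_eq_add_neg, eq_sub_iff_add_eq, eq_comm (a := d.fst)]
    constructor
    · rintro ⟨h, h'⟩; exact ⟨h', by rw [← h', h]⟩
    · rintro ⟨h, h'⟩; exact ⟨by rw [h, h'], h⟩
  simp only [this, ite_and, Finset.sum_ite_eq', Finset.mem_univ, if_true]

/-- Each of the `M²` internal vertices is moved onto `u` by exactly one position, and these
positions differ. -/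
theorem sum_inside (hMN : M + 2 ≤ N) (u : Fin N × Fin N) :
    ∑ p, (squareAt (M := M) hMN p).inside u = M ^ 2 := by
  classical
  simp only [Realization.inside]
  have : (Finset.univ.filter fun p => ∃ q, u = (squareAt (M := M) hMN p).ι (.inl q)) =
      Finset.univ.image fun q : Fin M × Fin M => u - place 0 (.inl q : SqVertex M) := by
    ext p
    simp only [Finset.mem_filter, Finset.mem_univ, true_and, Finset.mem_image]
    refine exists_congr fun q => ?_
    change u = place p _ ↔ _
    rw [place_eq p, sub_eq_iff_eq_add]
  trans (Finset.univ.image fun q : Fin M × Fin M => u - place 0 (.inl q : SqVertex M)).card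
  · rw [← this, Finset.card_filter]
    exact Finset.sum_congr rfl fun p _ => by congr
  rw [Finset.card_image_of_injective]
  · simp [sq]
  · intro q q' h
    exact Sum.inl_injective (place_injective hMN 0 (sub_right_injective h))

end Embedding

end LatticeFlow

end

noncomputable section

namespace LatticeFlow

open MeasureTheory SimpleGraph

/-! ### Displacement of walks in the torus -/

section Displacement

variable {N : ℕ} [NeZero N]

/-- For `N ≥ 3` the steps `1` and `-1` differ, so each step of a walk has a well-defined direction.
-/
theorem inStep_injective (hN : 3 ≤ N) : Function.Injective (inStep (N := N)) := by
  have h1 : ((1 : Fin N) : ℕ) = 1 := by rw [Fin.val_one', Nat.mod_eq_of_lt (by omega)]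
  have h2 : ((-1 : Fin N) : ℕ) = N - 1 := by
    rw [Fin.val_neg', h1, Nat.mod_eq_of_lt (by omega)]
  have h0 : ((0 : Fin N) : ℕ) = 0 := rfl
  intro s s' h
  cases s <;> cases s' <;> first
    | rfl
    | (exfalso
       simp only [inStep, Prod.mk.injEq, Fin.ext_iff, h1, h2, h0] at h
       omega)

theorem exists_inStep (hN : 2 ≤ N) {u v : Fin N × Fin N} (h : (torus N).Adj u v) :
    ∃ s, v = u + inStep s := by
  rcases (torus_adj_iff hN).1 h with h | h | h | h
  · exact ⟨.left, h⟩
  · exact ⟨.right, by rw [h]; ext <;> simp [inStep]⟩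
  · exact ⟨.bottom, h⟩
  · exact ⟨.top, by rw [h]; ext <;> simp [inStep]⟩

theorem steps_cons (hN : 3 ≤ N) {u u' v : Fin N × Fin N} (h : (torus N).Adj u u')
    (w : (torus N).Walk u' v) {s : Side} (hs : u' = u + inStep s) (s' : Side) :
    steps (Walk.cons h w) s' = steps w s' + if s' = s then 1 else 0 := by
  subst hs
  simp [steps, List.countP_cons, (inStep_injective hN).eq_iff, eq_comm]

theorem exists_val_add_one (a : Fin N) : ∃ k : ℤ, (((a + 1 : Fin N) : ℕ) : ℤ) = (a : ℕ) + 1 + N * k := by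
  refine ⟨-(((a : ℕ) + 1 : ℤ) / N), ?_⟩
  rw [Fin.val_add]
  have : ((a : ℕ) + ((1 : Fin N) : ℕ)) % N = ((a : ℕ) + 1) % N := by
    rw [Fin.val_one', Nat.add_mod, Nat.mod_mod, ← Nat.add_mod]
  rw [this]
  push_cast
  rw [Int.emod_def]
  ring

theorem exists_val_sub_one (a : Fin N) : ∃ k : ℤ, (((a + -1 : Fin N) : ℕ) : ℤ) = (a : ℕ) - 1 + N * k := by
  obtain ⟨k, hk⟩ := exists_val_add_one (a + -1)
  rw [neg_add_cancel_right] at hk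
  exact ⟨-k, by linarith⟩

/-- The difference of the numbers of steps in opposite directions is determined modulo `N` by the
end points. -/
theorem exists_steps_sub (hN : 3 ≤ N) {u v : Fin N × Fin N} (w : (torus N).Walk u v) :
    (∃ k : ℤ, (steps w .left : ℤ) - steps w .right = ((v - u).1 : ℕ) + N * k) ∧
    ∃ k : ℤ, (steps w .bottom : ℤ) - steps w .top = ((v - u).2 : ℕ) + N * k := by
  induction w with
  | nil => exact ⟨⟨0, by simp [steps]⟩, ⟨0, by simp [steps]⟩⟩
  | @cons u u' v h w ih =>
    obtain ⟨⟨k, hk⟩, ⟨k', hk'⟩⟩ := ih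
    obtain ⟨s, hs⟩ := exists_inStep (by omega) h
    have hvu : v - u = (v - u') + inStep s := by rw [hs]; abel
    simp only [steps_cons hN h w hs, hvu]
    cases s
    · obtain ⟨l, hl⟩ := exists_val_add_one (v - u').1
      refine ⟨⟨k - l, ?_⟩, ⟨k', ?_⟩⟩
      · simp only [inStep, Prod.fst_add, hl]
        simp only [if_true, reduceCtorEq, if_false]
        push_cast
        linarith
      · simp [inStep, hk']
    · obtain ⟨l, hl⟩ := exists_val_sub_one (v - u').1
      refine ⟨⟨k - l, ?_⟩, ⟨k', ?_⟩⟩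
      · simp only [inStep, Prod.fst_add, hl]
        simp only [if_true, reduceCtorEq, if_false]
        push_cast
        linarith
      · simp [inStep, hk']
    · obtain ⟨l, hl⟩ := exists_val_add_one (v - u').2
      refine ⟨⟨k, ?_⟩, ⟨k' - l, ?_⟩⟩
      · simp [inStep, hk]
      · simp only [inStep, Prod.snd_add, hl]
        simp only [if_true, reduceCtorEq, if_false]
        push_cast
        linarith
    · obtain ⟨l, hl⟩ := exists_val_sub_one (v - u').2
      refine ⟨⟨k, ?_⟩, ⟨k' - l, ?_⟩⟩
      · simp [inStep, hk]
      · simp only [inStep, Prod.snd_add, hl]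
        simp only [if_true, reduceCtorEq, if_false]
        push_cast
        linarith

end Displacement

/-! ### Marginals and point masses of transportation measures. -/

section Transport

variable {M : ℕ}

/-- The mass `t` at the pair `(b, b')`. -/
def pointMass (b b' : Bou M) (t : ℝ≥0) : Transport M := fun r => if r = (b, b') then t else 0

theorem ent_add (Q Q' : Transport M) (b : Bou M) : (Q + Q').ent b = Q.ent b + Q'.ent b := by
  simp [Transport.ent, Finset.sum_add_distrib]

theorem exi_add (Q Q' : Transport M) (b : Bou M) : (Q + Q').exi b = Q.exi b + Q'.exi b := by
  simp [Transport.exi, Finset.sum_add_distrib]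

theorem ent_pointMass (b b' : Bou M) (t : ℝ≥0) (c : Bou M) :
    (pointMass b b' t).ent c = if c = b then t else 0 := by
  simp [Transport.ent, pointMass, ite_and]

theorem exi_pointMass (b b' : Bou M) (t : ℝ≥0) (c : Bou M) :
    (pointMass b b' t).exi c = if c = b' then t else 0 := by
  simp [Transport.exi, pointMass, ite_and]

theorem mem_compatible_iff (Q : Transport M) :
    Q ∈ compatible M ↔ ∀ b : Bou M, Q.exi b.reflect = Q.ent b := by
  refine forall_congr' fun b => ?_
  have : (Finset.univ.filter fun b' : Bou M => b'.reflect = b) = {b.reflect} := by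
    ext b'
    simp only [Finset.mem_filter, Finset.mem_univ, true_and, Finset.mem_singleton, reflect_eq]
    constructor
    · rintro rfl; simp [opp_opp]
    · rintro rfl; simp [opp_opp]
  rw [this, Finset.sum_singleton]

theorem sum_pointMass_mul (b b' : Bou M) (t : ℝ≥0) (f : Bou M → ℝ) :
    ∑ b₁, ∑ b₂, (pointMass b b' t (b₁, b₂) : ℝ) * (f b₂ - f b₁) = t * (f b' - f b) := by
  rw [Finset.sum_eq_single b, Finset.sum_eq_single b']
  · simp [pointMass]
  · intro c _ hc; simp [pointMass, hc]
  · simp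
  · intro c _ hc; simp [pointMass, hc]
  · simp

end Transport

/-! ### The pieces of a walk in a square -/

section Pieces

variable {M N : ℕ} [NeZero M] [NeZero N]

theorem reachable_extSquare (z z' : SqVertex M) : (extSquare M).Reachable z z' := by
  have hM : 0 < M := Nat.pos_of_ne_zero (NeZero.ne M)
  have hpre := (pathGraph_preconnected M).boxProd (pathGraph_preconnected M)
  let f : ((pathGraph M).boxProd (pathGraph M)) →g extSquare M := ⟨Sum.inl, fun h => h⟩
  have h1 : ∀ q q', (extSquare M).Reachable (.inl q) (.inl q') := fun q q' =>
    (hpre q q').map f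
  have h2 : ∀ z, ∃ q, (extSquare M).Reachable z (.inl q) := by
    rintro (q | b)
    · exact ⟨q, Reachable.refl _⟩
    · exact ⟨attach b, Adj.reachable (attached_iff.2 rfl : Attached (attach b) b)⟩
  obtain ⟨q, hq⟩ := h2 z
  obtain ⟨q', hq'⟩ := h2 z'
  exact hq.trans ((h1 q q').trans hq'.symm)

/-- The first boundary point of a side. -/
def corner (s : Side) : Bou M := (s, 0)

theorem exists_pieces (hMN : M + 2 ≤ N) (p : Fin N × Fin N) (σ : FinPath (torus N)) :
    ∃ L : List (FinPath (extSquare M)), IsCut (squareAt hMN p) (corner .left) σ.walk L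
      (fun b => if b = corner .left then (squareAt (M := M) hMN p).inside σ.ent else 0)
      (fun _ => (squareAt (M := M) hMN p).inside σ.ent) :=
  exists_isCut _ _ (fun _ => reachable_extSquare _ _) _

/-- The pieces of the path `σ` in the extended square at the position `p`. -/
def pieces (hMN : M + 2 ≤ N) (p : Fin N × Fin N) (σ : FinPath (torus N)) :
    List (FinPath (extSquare M)) := (exists_pieces hMN p σ).choose

theorem isCut_pieces (hMN : M + 2 ≤ N) (p : Fin N × Fin N) (σ : FinPath (torus N)) :
    IsCut (squareAt hMN p) (corner .left) σ.walk (pieces hMN p σ)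
      (fun b => if b = corner .left then (squareAt (M := M) hMN p).inside σ.ent else 0)
      (fun _ => (squareAt (M := M) hMN p).inside σ.ent) := (exists_pieces hMN p σ).choose_spec

/-- Number of pieces with given end points. -/
def pieceTrans (hMN : M + 2 ≤ N) (p : Fin N × Fin N) (σ : FinPath (torus N)) (b b' : Bou M) : ℕ :=
  (pieces hMN p σ).countP fun τ => τ.ent = .inr b ∧ τ.exi = .inr b'

theorem sum_pieceTrans_right (hMN : M + 2 ≤ N) (p : Fin N × Fin N) (σ : FinPath (torus N))
    (b : Bou M) : ∑ b', pieceTrans hMN p σ b b' =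
      (if b = corner .left then (squareAt (M := M) hMN p).inside σ.ent else 0) +
        (squareAt hMN p).entries σ.walk b := by
  rw [← (isCut_pieces hMN p σ).ent b]
  refine sum_countP _ (fun b' (τ : FinPath (extSquare M)) => τ.ent = .inr b ∧ τ.exi = .inr b') _ ?_
  intro τ hτ
  obtain ⟨c, hc⟩ := ((isCut_pieces hMN p σ).boundary τ hτ).2
  simp [hc, ite_and]

theorem sum_pieceTrans_left (hMN : M + 2 ≤ N) (p : Fin N × Fin N) (σ : FinPath (torus N))
    (b : Bou M) : ∑ b', pieceTrans hMN p σ b' b =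
      (squareAt hMN p).exits σ.walk b +
      (if b = corner .left then (squareAt (M := M) hMN p).inside σ.exi else 0) := by
  rw [← (isCut_pieces hMN p σ).exi b]
  refine sum_countP _ (fun b' (τ : FinPath (extSquare M)) => τ.ent = .inr b' ∧ τ.exi = .inr b) _ ?_
  intro τ hτ
  obtain ⟨c, hc⟩ := ((isCut_pieces hMN p σ).boundary τ hτ).1
  simp [hc, ite_and]

/-- Number of pieces with given end points, in all positions of the square. -/
def totalTrans (hMN : M + 2 ≤ N) (σ : FinPath (torus N)) (b b' : Bou M) : ℕ :=
  ∑ p, pieceTrans hMN p σ b b'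

theorem sum_totalTrans_right (hMN : M + 2 ≤ N) (σ : FinPath (torus N)) (b : Bou M) :
    ∑ b', totalTrans hMN σ b b' = steps σ.walk b.1 + if b = corner .left then M ^ 2 else 0 := by
  simp only [totalTrans]
  rw [Finset.sum_comm]
  simp only [sum_pieceTrans_right]
  rw [Finset.sum_add_distrib, sum_entries, add_comm]
  split_ifs
  · rw [sum_inside]
  · simp

theorem sum_totalTrans_left (hMN : M + 2 ≤ N) (σ : FinPath (torus N)) (b : Bou M) :
    ∑ b', totalTrans hMN σ b' b = steps σ.walk b.1.opp + if b = corner .left then M ^ 2 else 0 := by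
  simp only [totalTrans]
  rw [Finset.sum_comm]
  simp only [sum_pieceTrans_left]
  rw [Finset.sum_add_distrib, sum_exits]
  split_ifs
  · rw [sum_inside]
  · simp

theorem sum_side {R : Type*} [AddCommMonoid R] (f : Side → R) :
    ∑ s, f s = f .left + f .right + f .bottom + f .top := by
  have : (Finset.univ : Finset Side) = {.left, .right, .bottom, .top} := rfl
  rw [this, Finset.sum_insert (by simp), Finset.sum_insert (by simp), Finset.sum_insert (by simp),
    Finset.sum_singleton]
  simp only [add_assoc]

/-- The sum depends only on the marginals. The completions at the corner contribute `M ^ 2` to both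
of them and cancel. -/
theorem sum_totalTrans_mul (hMN : M + 2 ≤ N) (σ : FinPath (torus N)) (f : Bou M → ℝ) :
    ∑ b₁, ∑ b₂, (totalTrans hMN σ b₁ b₂ : ℝ) * (f b₂ - f b₁) =
      ∑ b : Bou M, ((steps σ.walk b.1.opp : ℝ) - steps σ.walk b.1) * f b := by
  have h1 : ∑ b₁, ∑ b₂, (totalTrans hMN σ b₁ b₂ : ℝ) * f b₂ = ∑ b : Bou M,
      ((steps σ.walk b.1.opp + if b = corner .left then M ^ 2 else 0 : ℕ) : ℝ) * f b := by
    rw [Finset.sum_comm]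
    refine Finset.sum_congr rfl fun b _ => ?_
    rw [← sum_totalTrans_left hMN, ← Finset.sum_mul]
    push_cast
    rfl
  have h2 : ∑ b₁, ∑ b₂, (totalTrans hMN σ b₁ b₂ : ℝ) * f b₁ = ∑ b : Bou M,
      ((steps σ.walk b.1 + if b = corner .left then M ^ 2 else 0 : ℕ) : ℝ) * f b := by
    refine Finset.sum_congr rfl fun b _ => ?_
    rw [← sum_totalTrans_right hMN, ← Finset.sum_mul]
    push_cast
    rfl
  simp only [mul_sub, Finset.sum_sub_distrib]
  rw [h1, h2, ← Finset.sum_sub_distrib]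
  refine Finset.sum_congr rfl fun b _ => ?_
  push_cast
  ring

/-- Opposite sides carry opposite coefficients. The coordinate along the sides cancels, the
coordinate across differs by `M`, and there are `M` points on a side. -/
theorem sum_totalTrans_pos (hMN : M + 2 ≤ N) (σ : FinPath (torus N)) :
    ∑ b₁, ∑ b₂, (totalTrans hMN σ b₁ b₂ : ℝ) * ((Bou.pos b₂).1 - (Bou.pos b₁).1) =
      M ^ 2 * ((steps σ.walk .left : ℝ) - steps σ.walk .right) ∧
    ∑ b₁, ∑ b₂, (totalTrans hMN σ b₁ b₂ : ℝ) * ((Bou.pos b₂).2 - (Bou.pos b₁).2) =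
      M ^ 2 * ((steps σ.walk .bottom : ℝ) - steps σ.walk .top) := by
  constructor
  · rw [sum_totalTrans_mul hMN σ fun b => (Bou.pos b).1, Fintype.sum_prod_type, sum_side]
    simp only [Bou.pos, Side.opp, Finset.sum_const, Finset.card_univ, Fintype.card_fin,
      nsmul_eq_mul, ← Finset.mul_sum]
    ring
  · rw [sum_totalTrans_mul hMN σ fun b => (Bou.pos b).2, Fintype.sum_prod_type, sum_side]
    simp only [Bou.pos, Side.opp, Finset.sum_const, Finset.card_univ, Fintype.card_fin,
      nsmul_eq_mul, ← Finset.mul_sum]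
    ring

/-- A small transportation measure with drift `(t₁, t₂)`. -/
def driftMass (t₁ t₂ : ℝ≥0) : Transport M :=
  pointMass (corner .left) (corner .right) (t₁ * M) +
    pointMass (corner .bottom) (corner .top) (t₂ * M)

/-- The pieces of `σ` in a random position, made compatible. -/
def pathTransport (hMN : M + 2 ≤ N) (σ : FinPath (torus N)) : Transport M :=
  (fun r => (totalTrans hMN σ r.1 r.2 : ℝ≥0) / N) +
    pointMass (corner .right) (corner .right) ((M : ℝ≥0) ^ 2 / N)

theorem reflect_eq_corner {b : Bou M} {s : Side} : b.reflect = corner s ↔ b = corner s.opp := by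
  obtain ⟨s', j⟩ := b
  rw [reflect_eq]
  simp only [corner, Prod.mk.injEq]
  cases s <;> cases s' <;> simp [Side.opp]

/-- Entrances through `b` and exits through `b.reflect` count the same steps. The completions add `M
^ 2 / N` to both marginals at the left corner, and the mass at the pair of right corners adds the
same at its reflection. The drift correction joins a corner to its reflection, which is compatible
by itself. -/
theorem pathTransport_add_mem_compatible (hMN : M + 2 ≤ N) (σ : FinPath (torus N)) (t₁ t₂ : ℝ≥0) :
    pathTransport hMN σ + driftMass t₁ t₂ ∈ compatible M := by
  rw [mem_compatible_iff]
  intro b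
  have h1 : ∀ b, Transport.ent (fun r : Bou M × Bou M => (totalTrans hMN σ r.1 r.2 : ℝ≥0) / N) b =
      (steps σ.walk b.1 + if b = corner .left then (M : ℝ≥0) ^ 2 else 0) / N := by
    intro b
    have := sum_totalTrans_right hMN σ b
    rw [Transport.ent, ← Finset.sum_div]
    congr 1
    exact_mod_cast this
  have h2 : ∀ b, Transport.exi (fun r : Bou M × Bou M => (totalTrans hMN σ r.1 r.2 : ℝ≥0) / N) b =
      (steps σ.walk b.1.opp + if b = corner .left then (M : ℝ≥0) ^ 2 else 0) / N := by
    intro b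
    have := sum_totalTrans_left hMN σ b
    rw [Transport.exi, ← Finset.sum_div]
    congr 1
    exact_mod_cast this
  have h3 : b.reflect.1.opp = b.1 := by rw [reflect_eq, opp_opp]
  have r1 : b.reflect = corner .left ↔ b = corner .right := reflect_eq_corner
  have r2 : b.reflect = corner .right ↔ b = corner .left := reflect_eq_corner
  have r3 : b.reflect = corner .top ↔ b = corner .bottom := reflect_eq_corner
  simp only [pathTransport, driftMass, ent_add, exi_add, h1, h2, ent_pointMass, exi_pointMass,
    r1, r2, r3, h3]
  by_cases hb : b = corner .left
  · have : corner (M := M) .left ≠ corner .right := by simp [corner]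
    subst hb
    simp [this]
    ring
  · simp only [hb, if_false]
    by_cases hb' : b = corner .right
    · simp [hb']; ring
    · simp [hb']

theorem drift_pathTransport_add (hMN : M + 2 ≤ N) (σ : FinPath (torus N)) (t₁ t₂ : ℝ≥0) :
    (pathTransport hMN σ + driftMass t₁ t₂ : Transport M).drift =
      (((steps σ.walk .left : ℝ) - steps σ.walk .right) / N + t₁,
        ((steps σ.walk .bottom : ℝ) - steps σ.walk .top) / N + t₂) := by
  have hM : (M : ℝ) ≠ 0 := by exact_mod_cast NeZero.ne M
  have hN : (N : ℝ) ≠ 0 := by exact_mod_cast NeZero.ne N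
  have key : ∀ f : Bou M → ℝ, ∑ b₁, ∑ b₂,
      ((pathTransport hMN σ + driftMass t₁ t₂ : Transport M) (b₁, b₂) : ℝ) * (f b₂ - f b₁) =
      (∑ b₁, ∑ b₂, (totalTrans hMN σ b₁ b₂ : ℝ) * (f b₂ - f b₁)) / N +
        t₁ * M * (f (corner .right) - f (corner .left)) +
        t₂ * M * (f (corner .top) - f (corner .bottom)) := by
    intro f
    have h1 := sum_pointMass_mul (corner .left) (corner .right) (t₁ * M) f
    have h2 := sum_pointMass_mul (corner .bottom) (corner .top) (t₂ * M) f
    have h3 := sum_pointMass_mul (corner .right) (corner .right) ((M : ℝ≥0) ^ 2 / N) f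
    push_cast at h1 h2 h3
    rw [← h1, ← h2, Finset.sum_div]
    simp only [Finset.sum_div]
    rw [sub_self, mul_zero] at h3
    simp only [pathTransport, driftMass, Pi.add_apply, NNReal.coe_add, add_mul,
      Finset.sum_add_distrib]
    rw [h3, add_zero, add_assoc]
    congr 1
    refine Finset.sum_congr rfl fun b _ => Finset.sum_congr rfl fun b' _ => ?_
    push_cast
    ring
  obtain ⟨hp1, hp2⟩ := sum_totalTrans_pos (M := M) hMN σ
  rw [Transport.drift]
  refine Prod.ext ?_ ?_
  · simp only [Prod.smul_fst, Prod.fst_sum, Prod.fst_sub, smul_eq_mul]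
    rw [key fun b => (Bou.pos b).1, hp1]
    simp only [corner, Bou.pos]
    field_simp
    ring
  · simp only [Prod.smul_snd, Prod.snd_sum, Prod.snd_sub, smul_eq_mul]
    rw [key fun b => (Bou.pos b).2, hp2]
    simp only [corner, Bou.pos]
    field_simp
    ring

end Pieces

end LatticeFlow

end

noncomputable section

namespace LatticeFlow

open MeasureTheory SimpleGraph

/-! ### Isotropy of the flow across a square in a random position -/

section Isotropy

variable {M N : ℕ}

/-- The cell of the partition of the unit square with lower left corner `d / N`. -/
def cell (d : Fin N × Fin N) : Set (ℝ × ℝ) :=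
  Set.Ico ((d.1 : ℕ) / N : ℝ) (((d.1 : ℕ) + 1) / N) ×ˢ
    Set.Ico ((d.2 : ℕ) / N : ℝ) (((d.2 : ℕ) + 1) / N)

theorem measurableSet_cell (d : Fin N × Fin N) : MeasurableSet (cell d) :=
  measurableSet_Ico.prod measurableSet_Ico

theorem mem_Ico_iff_floor (hN : 0 < N) (a : ℝ) (k : ℕ) (ha : 0 ≤ a) :
    a ∈ Set.Ico (k / N : ℝ) ((k + 1) / N) ↔ ⌊a * N⌋₊ = k := by
  have hN' : (0 : ℝ) < N := by exact_mod_cast hN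
  rw [Nat.floor_eq_iff (by positivity), Set.mem_Ico, div_le_iff₀ hN', lt_div_iff₀ hN']

theorem pos_of_mem_Ico {a : ℝ} {k : ℕ} {y : ℝ} (h : a ∈ Set.Ico (k / N : ℝ) y) : 0 ≤ a :=
  le_trans (by positivity) h.1

/-- The excess of `a` over `k / N`. -/
def excess (k : Fin N) (a : ℝ) : ℝ≥0 := (a - (k : ℕ) / N).toNNReal

theorem measurable_excess (k : Fin N) : Measurable (excess k) := by
  unfold excess; fun_prop

theorem measurable_driftMod : Measurable (Transport.driftMod (M := M)) := by
  have : Measurable (Transport.drift (M := M)) := by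
    unfold Transport.drift
    fun_prop
  exact (measurable_fract.comp this.fst).prodMk (measurable_fract.comp this.snd)

variable [NeZero M]

theorem driftMass_apply (t₁ t₂ : ℝ≥0) (r : Bou M × Bou M) : (driftMass t₁ t₂ : Transport M) r =
    t₁ * (driftMass 1 0 : Transport M) r + t₂ * (driftMass 0 1 : Transport M) r := by
  simp [driftMass, pointMass]

variable [NeZero N]

theorem volume_cell (d : Fin N × Fin N) : volume (cell d) = (((N : ℝ≥0) ^ 2)⁻¹ : ℝ≥0) := by
  have hN : (N : ℝ) ≠ 0 := by exact_mod_cast NeZero.ne N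
  have h : ∀ k : ℕ, volume (Set.Ico (k / N : ℝ) ((k + 1) / N)) = (((N : ℝ≥0))⁻¹ : ℝ≥0) := by
    intro k
    rw [Real.volume_Ico, ← sub_div, add_sub_cancel_left, one_div, ← ENNReal.ofReal_coe_nnreal]
    push_cast
    rfl
  rw [cell, Measure.volume_eq_prod, Measure.prod_prod, h, h, ← ENNReal.coe_mul, sq, mul_inv]

theorem iUnion_cell : ⋃ d : Fin N × Fin N, cell d = Set.Ico (0 : ℝ) 1 ×ˢ Set.Ico (0 : ℝ) 1 := by
  have hN : 0 < N := Nat.pos_of_ne_zero (NeZero.ne N)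
  have hN' : (0 : ℝ) < N := by exact_mod_cast hN
  have key : ∀ a : ℝ, a ∈ Set.Ico (0 : ℝ) 1 ↔
      ∃ k : Fin N, a ∈ Set.Ico ((k : ℕ) / N : ℝ) (((k : ℕ) + 1) / N) := by
    intro a
    constructor
    · rintro ⟨h0, h1⟩
      have hlt : ⌊a * N⌋₊ < N := by
        rw [Nat.floor_lt (by positivity)]
        nlinarith
      exact ⟨⟨_, hlt⟩, (mem_Ico_iff_floor hN a _ h0).2 rfl⟩
    · rintro ⟨k, hk⟩
      refine ⟨pos_of_mem_Ico hk, hk.2.trans_le ?_⟩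
      rw [div_le_one hN']
      exact_mod_cast k.2
  ext ⟨a, b⟩
  simp only [Set.mem_iUnion, cell, Set.mem_prod, key]
  constructor
  · rintro ⟨d, h1, h2⟩; exact ⟨⟨_, h1⟩, ⟨_, h2⟩⟩
  · rintro ⟨⟨k, h1⟩, ⟨l, h2⟩⟩; exact ⟨(k, l), h1, h2⟩

theorem pairwise_disjoint_cell : Pairwise (Function.onFun Disjoint (cell (N := N))) := by
  have hN : 0 < N := Nat.pos_of_ne_zero (NeZero.ne N)
  intro d d' hd
  rw [Function.onFun, Set.disjoint_left]
  rintro ⟨a, b⟩ ⟨h1, h2⟩ ⟨h1', h2'⟩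
  apply hd
  have ha := pos_of_mem_Ico h1
  have hb := pos_of_mem_Ico h2
  rw [mem_Ico_iff_floor hN _ _ ha] at h1 h1'
  rw [mem_Ico_iff_floor hN _ _ hb] at h2 h2'
  exact Prod.ext (Fin.ext (h1.symm.trans h1')) (Fin.ext (h2.symm.trans h2'))

/-- The displacement of a path in the torus. -/
def displacement (σ : FinPath (torus N)) : Fin N × Fin N := σ.exi - σ.ent

/-- The transportation measure of `σ` with its drift corrected to `a` modulo `(1, 1)`. -/
def correctedTransport (hMN : M + 2 ≤ N) (σ : FinPath (torus N)) (a : ℝ × ℝ) : Transport M :=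
  pathTransport hMN σ + driftMass (excess (displacement σ).1 a.1) (excess (displacement σ).2 a.2)

theorem measurable_correctedTransport (hMN : M + 2 ≤ N) (σ : FinPath (torus N)) :
    Measurable (correctedTransport (M := M) hMN σ) := by
  refine measurable_pi_lambda _ fun r => ?_
  simp only [correctedTransport, Pi.add_apply, driftMass_apply (excess _ _)]
  have h1 := measurable_excess (displacement σ).1
  have h2 := measurable_excess (displacement σ).2
  fun_prop

/-- The drift of a path is its displacement over `N` plus an integer, the number of windings; the
excess moves it to `a`, and the fractional part removes the integer. -/
theorem driftMod_correctedTransport (hN : 3 ≤ N) (hMN : M + 2 ≤ N) (σ : FinPath (torus N))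
    {a : ℝ × ℝ} (ha : a ∈ cell (displacement σ)) :
    (correctedTransport (M := M) hMN σ a).driftMod = a := by
  have hN' : (N : ℝ) ≠ 0 := by exact_mod_cast NeZero.ne N
  obtain ⟨⟨k, hk⟩, ⟨l, hl⟩⟩ := exists_steps_sub hN σ.walk
  have hunit : a ∈ Set.Ico (0 : ℝ) 1 ×ˢ Set.Ico (0 : ℝ) 1 := by
    rw [← iUnion_cell (N := N)]
    exact Set.mem_iUnion.2 ⟨_, ha⟩
  have key : ∀ (m n : ℕ) (d : Fin N) (k : ℤ) (b : ℝ), (m : ℤ) - n = (d : ℕ) + N * k →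
      (d : ℕ) / (N : ℝ) ≤ b → b ∈ Set.Ico (0 : ℝ) 1 →
      Int.fract (((m : ℝ) - n) / N + excess d b) = b := by
    intro m n d k b h hb hb'
    have h' : (m : ℝ) - n = (d : ℕ) + N * k := by exact_mod_cast h
    rw [h', excess, Real.coe_toNNReal _ (sub_nonneg.2 hb)]
    have : ((d : ℕ) + N * k : ℝ) / N + (b - (d : ℕ) / N) = b + k := by field_simp; ring
    rw [this, Int.fract_add_intCast, Int.fract_eq_self.2 hb']
  rw [Transport.driftMod, correctedTransport, drift_pathTransport_add]
  exact Prod.ext (key _ _ _ k _ hk ha.1.1 hunit.1) (key _ _ _ l _ hl ha.2.1 hunit.2)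

/-- There are `N ^ 2` starting points, each with mass `1 / N ^ 3` to the vertex displaced by `d`. -/
theorem sum_displacement (x : SimplePath (torus N) → ℝ≥0)
    (hx : ∀ v w, trans x v w = ((N : ℝ≥0) ^ 3)⁻¹) (d : Fin N × Fin N) :
    ∑ σ, (if displacement σ.1 = d then x σ else 0) = (N : ℝ≥0)⁻¹ := by
  have hN : (N : ℝ≥0) ≠ 0 := by exact_mod_cast NeZero.ne N
  have h1 : ∀ σ : SimplePath (torus N), (if displacement σ.1 = d then x σ else 0) =
      ∑ v, if σ.1.ent = v ∧ σ.1.exi = v + d then x σ else 0 := by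
    intro σ
    rw [Finset.sum_eq_single σ.1.ent]
    · have : displacement σ.1 = d ↔ σ.1.exi = σ.1.ent + d := by
        rw [displacement, sub_eq_iff_eq_add']
      simp [this]
    · intro v _ hv
      rw [if_neg fun h => hv h.1.symm]
    · simp
  simp only [h1]
  rw [Finset.sum_comm]
  have h2 : ∀ v, ∑ σ : SimplePath (torus N), (if σ.1.ent = v ∧ σ.1.exi = v + d then x σ else 0) =
      ((N : ℝ≥0) ^ 3)⁻¹ := fun v => hx v (v + d)
  simp only [h2]
  rw [Finset.sum_const, Finset.card_univ, Fintype.card_prod, Fintype.card_fin, nsmul_eq_mul]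
  push_cast
  field_simp

theorem sum_weights (x : SimplePath (torus N) → ℝ≥0)
    (hx : ∀ v w, trans x v w = ((N : ℝ≥0) ^ 3)⁻¹) : ∑ σ, x σ = N := by
  have hN : (N : ℝ≥0) ≠ 0 := by exact_mod_cast NeZero.ne N
  have h1 : ∀ σ : SimplePath (torus N), x σ = ∑ d, if displacement σ.1 = d then x σ else 0 := by
    intro σ
    simp
  rw [Finset.sum_congr rfl fun σ _ => h1 σ, Finset.sum_comm]
  simp only [sum_displacement x hx]
  rw [Finset.sum_const, Finset.card_univ, Fintype.card_prod, Fintype.card_fin, nsmul_eq_mul]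
  push_cast
  field_simp

/-- The distribution of the transportation measure of a random path with corrected drift. -/
def mixture (hMN : M + 2 ≤ N) (x : SimplePath (torus N) → ℝ≥0) : Measure (Transport M) :=
  ∑ σ, ((x σ * N : ℝ≥0) : ℝ≥0∞) •
    (volume.restrict (cell (displacement σ.1))).map (correctedTransport hMN σ.1)

/-- Each path contributes `x σ * N` times Lebesgue measure on the cell of its displacement. The
paths with a given displacement have total weight `1 / N`, so each cell receives Lebesgue measure
exactly once. -/
theorem map_mixture (hN : 3 ≤ N) (hMN : M + 2 ≤ N) (x : SimplePath (torus N) → ℝ≥0)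
    (hx : ∀ v w, trans x v w = ((N : ℝ≥0) ^ 3)⁻¹) :
    (mixture (M := M) hMN x).map Transport.driftMod =
      volume.restrict (Set.Ico (0 : ℝ) 1 ×ˢ Set.Ico (0 : ℝ) 1) := by
  have hN0 : (N : ℝ≥0) ≠ 0 := by exact_mod_cast NeZero.ne N
  ext s hs
  rw [Measure.map_apply measurable_driftMod hs, mixture, Measure.finsetSum_apply]
  have h1 : ∀ σ : SimplePath (torus N), (((x σ * N : ℝ≥0) : ℝ≥0∞) •
      (volume.restrict (cell (displacement σ.1))).map (correctedTransport (M := M) hMN σ.1))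
        (Transport.driftMod ⁻¹' s) =
      ∑ d, (((if displacement σ.1 = d then x σ else 0) : ℝ≥0) : ℝ≥0∞) * N *
        volume.restrict (cell d) s := by
    intro σ
    rw [Measure.smul_apply, Measure.map_apply (measurable_correctedTransport hMN σ.1)
      (measurable_driftMod hs), Finset.sum_eq_single (displacement σ.1)]
    · rw [if_pos rfl, smul_eq_mul]
      push_cast
      congr 1
      rw [Measure.restrict_apply hs, Measure.restrict_apply
        (measurable_correctedTransport hMN σ.1 (measurable_driftMod hs))]
      congr 1
      ext a
      simp only [Set.mem_inter_iff, Set.mem_preimage]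
      refine and_congr_left fun ha => ?_
      rw [driftMod_correctedTransport hN hMN σ.1 ha]
    · intro d _ hd
      simp [hd.symm]
    · simp
  rw [Finset.sum_congr rfl fun σ _ => h1 σ, Finset.sum_comm, ← iUnion_cell (N := N),
    Measure.restrict_iUnion pairwise_disjoint_cell measurableSet_cell, Measure.sum_apply _ hs,
    tsum_fintype]
  refine Finset.sum_congr rfl fun d _ => ?_
  rw [← Finset.sum_mul, ← Finset.sum_mul]
  have h2 : (∑ σ : SimplePath (torus N), (((if displacement σ.1 = d then x σ else 0) : ℝ≥0) : ℝ≥0∞)) *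
      N = 1 := by
    have := sum_displacement x hx d
    rw [← ENNReal.ofNNReal_finsetSum, this]
    have h3 : ((N : ℝ≥0)⁻¹ * N : ℝ≥0) = 1 := inv_mul_cancel₀ hN0
    exact_mod_cast h3
  rw [h2, one_mul]

/-- On a cell of side `1 / N` the excess is at most `1 / N`, and the weights times the cell areas
add up to one. -/
theorem lintegral_excess_le (x : SimplePath (torus N) → ℝ≥0)
    (hx : ∀ v w, trans x v w = ((N : ℝ≥0) ^ 3)⁻¹) (f : ℝ × ℝ → ℝ)
    (g : Fin N × Fin N → Fin N)
    (hf : ∀ d, ∀ a ∈ cell d, f a ≤ ((g d : ℕ) + 1) / N) :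
    ∑ σ : SimplePath (torus N), ((x σ * N : ℝ≥0) : ℝ≥0∞) *
      ∫⁻ a in cell (displacement σ.1), excess (g (displacement σ.1)) (f a) ≤
        (((N : ℝ≥0)⁻¹ : ℝ≥0) : ℝ≥0∞) := by
  have hN0 : (N : ℝ≥0) ≠ 0 := by exact_mod_cast NeZero.ne N
  have h1 : ∀ d : Fin N × Fin N, ∫⁻ a in cell d, (excess (g d) (f a) : ℝ≥0∞) ≤
      (((N : ℝ≥0)⁻¹ * ((N : ℝ≥0) ^ 2)⁻¹ : ℝ≥0) : ℝ≥0∞) := by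
    intro d
    calc ∫⁻ a in cell d, (excess (g d) (f a) : ℝ≥0∞)
        ≤ ∫⁻ _a in cell d, (((N : ℝ≥0)⁻¹ : ℝ≥0) : ℝ≥0∞) := by
          refine setLIntegral_mono' (measurableSet_cell d) fun a ha => ?_
          rw [ENNReal.coe_le_coe, excess, Real.toNNReal_le_iff_le_coe]
          have := hf d a ha
          push_cast
          rw [add_div] at this
          rw [inv_eq_one_div]
          linarith
      _ = _ := by rw [setLIntegral_const, volume_cell, ENNReal.coe_mul]
  calc _ ≤ ∑ σ : SimplePath (torus N), ((x σ * N : ℝ≥0) : ℝ≥0∞) *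
        (((N : ℝ≥0)⁻¹ * ((N : ℝ≥0) ^ 2)⁻¹ : ℝ≥0) : ℝ≥0∞) := by
        gcongr with σ
        exact h1 _
    _ = (((∑ σ, x σ) * N * ((N : ℝ≥0)⁻¹ * ((N : ℝ≥0) ^ 2)⁻¹) : ℝ≥0) : ℝ≥0∞) := by
        rw [← Finset.sum_mul, Finset.sum_mul (s := Finset.univ) (f := x),
          ENNReal.coe_mul (∑ σ, x σ * N), ENNReal.ofNNReal_finsetSum]
    _ = _ := by
        rw [sum_weights x hx]
        congr 1
        field_simp

/-- The expected transportation measure across a square in a random position is isotropic, up to a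
small correction. -/
theorem exists_isIsotropic (hN : 3 ≤ N) (hMN : M + 2 ≤ N) (x : SimplePath (torus N) → ℝ≥0)
    (hx : ∀ v w, trans x v w = ((N : ℝ≥0) ^ 3)⁻¹) :
    ∃ t₁ t₂ : ℝ≥0, t₁ ≤ (N : ℝ≥0)⁻¹ ∧ t₂ ≤ (N : ℝ≥0)⁻¹ ∧
      IsIsotropic ((fun r => ∑ σ, x σ / N * pathTransport hMN σ.1 r) +
        driftMass t₁ t₂ : Transport M) := by
  have hN0 : (N : ℝ≥0) ≠ 0 := by exact_mod_cast NeZero.ne N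
  -- The expected drift corrections; `driftMass` is linear in its arguments, so they alone enter the
  -- mean of the mixture.
  set s₁ : ℝ≥0∞ := ∑ σ : SimplePath (torus N), ((x σ * N : ℝ≥0) : ℝ≥0∞) *
      ∫⁻ a in cell (displacement σ.1), excess (displacement σ.1).1 a.1 with hs₁
  set s₂ : ℝ≥0∞ := ∑ σ : SimplePath (torus N), ((x σ * N : ℝ≥0) : ℝ≥0∞) *
      ∫⁻ a in cell (displacement σ.1), excess (displacement σ.1).2 a.2 with hs₂
  have hb₁ : s₁ ≤ (((N : ℝ≥0)⁻¹ : ℝ≥0) : ℝ≥0∞) :=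
    lintegral_excess_le x hx (fun a => a.1) (fun d => d.1) fun d a ha => ha.1.2.le
  have hb₂ : s₂ ≤ (((N : ℝ≥0)⁻¹ : ℝ≥0) : ℝ≥0∞) :=
    lintegral_excess_le x hx (fun a => a.2) (fun d => d.2) fun d a ha => ha.2.2.le
  have hc₁ : (s₁.toNNReal : ℝ≥0∞) = s₁ :=
    ENNReal.coe_toNNReal (ne_top_of_le_ne_top ENNReal.coe_ne_top hb₁)
  have hc₂ : (s₂.toNNReal : ℝ≥0∞) = s₂ :=
    ENNReal.coe_toNNReal (ne_top_of_le_ne_top ENNReal.coe_ne_top hb₂)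
  refine ⟨s₁.toNNReal, s₂.toNNReal, (ENNReal.coe_le_coe.1 (hc₁.le.trans hb₁)),
    (ENNReal.coe_le_coe.1 (hc₂.le.trans hb₂)), mixture hMN x, ?_, ?_, ?_, map_mixture hN hMN x hx⟩
  · have h := map_mixture (M := M) hN hMN x hx
    constructor
    have h1 : (mixture (M := M) hMN x).map Transport.driftMod Set.univ = 1 := by
      rw [h, Measure.restrict_apply MeasurableSet.univ, Set.univ_inter, Measure.volume_eq_prod,
        Measure.prod_prod]
      simp
    rwa [Measure.map_apply measurable_driftMod MeasurableSet.univ, Set.preimage_univ] at h1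
  · have hm : MeasurableSet (compatible M) := by
      have : compatible M = ⋂ b : Bou M, {Q : Transport M | Q.exi b.reflect = Q.ent b} := by
        ext Q
        simp [mem_compatible_iff]
      rw [this]
      refine MeasurableSet.iInter fun b => measurableSet_eq_fun ?_ ?_
      · unfold Transport.exi; fun_prop
      · unfold Transport.ent; fun_prop
    rw [ae_iff, mixture, Measure.finsetSum_apply]
    refine Finset.sum_eq_zero fun σ _ => ?_
    have hm' : MeasurableSet {Q | ¬ Q ∈ compatible M} := hm.compl
    rw [Measure.smul_apply, Measure.map_apply (measurable_correctedTransport hMN σ.1) hm']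
    have : correctedTransport hMN σ.1 ⁻¹' {Q | ¬ Q ∈ compatible M} = ∅ := by
      ext a
      simp only [Set.mem_preimage, Set.mem_ofPred_eq, Set.mem_empty_iff_false, iff_false, not_not]
      exact pathTransport_add_mem_compatible hMN σ.1 _ _
    rw [this]
    simp
  · intro r
    have hr : Measurable fun Q : Transport M => (Q r : ℝ≥0∞) :=
      (measurable_pi_apply r).coe_nnreal_ennreal
    rw [mixture, lintegral_finsetSum_measure]
    have h1 : ∀ σ : SimplePath (torus N), ∫⁻ Q, (Q r : ℝ≥0∞) ∂(((x σ * N : ℝ≥0) : ℝ≥0∞) •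
        (volume.restrict (cell (displacement σ.1))).map (correctedTransport (M := M) hMN σ.1)) =
        ((x σ / N * pathTransport hMN σ.1 r : ℝ≥0) : ℝ≥0∞) +
        (((x σ * N : ℝ≥0) : ℝ≥0∞) *
          ∫⁻ a in cell (displacement σ.1), excess (displacement σ.1).1 a.1) *
          ((driftMass 1 0 : Transport M) r) +
        (((x σ * N : ℝ≥0) : ℝ≥0∞) *
          ∫⁻ a in cell (displacement σ.1), excess (displacement σ.1).2 a.2) *
          ((driftMass 0 1 : Transport M) r) := by
      intro σ
      have hm1 : Measurable fun a : ℝ × ℝ => (excess (displacement σ.1).1 a.1 : ℝ≥0∞) :=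
        ((measurable_excess _).comp measurable_fst).coe_nnreal_ennreal
      have hm2 : Measurable fun a : ℝ × ℝ => (excess (displacement σ.1).2 a.2 : ℝ≥0∞) :=
        ((measurable_excess _).comp measurable_snd).coe_nnreal_ennreal
      have h2 : x σ / N * pathTransport hMN σ.1 r =
          x σ * N * (pathTransport hMN σ.1 r * ((N : ℝ≥0) ^ 2)⁻¹) := by
        field_simp
      rw [lintegral_smul_measure, lintegral_map hr (measurable_correctedTransport hMN σ.1), h2]
      simp only [correctedTransport, Pi.add_apply, driftMass_apply (excess _ _), ENNReal.coe_add,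
        ENNReal.coe_mul]
      rw [lintegral_add_left measurable_const, lintegral_add_left (hm1.mul_const _),
        lintegral_mul_const _ hm1, lintegral_mul_const _ hm2, setLIntegral_const, volume_cell,
        smul_eq_mul]
      ring
    rw [Finset.sum_congr rfl fun σ _ => h1 σ, Finset.sum_add_distrib, Finset.sum_add_distrib,
      ← Finset.sum_mul, ← Finset.sum_mul, ← hs₁, ← hs₂]
    rw [Pi.add_apply, driftMass_apply s₁.toNNReal]
    push_cast
    rw [hc₁, hc₂, add_assoc]

end Isotropy

end LatticeFlow

end

noncomputable section

namespace LatticeFlow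

open MeasureTheory SimpleGraph

/-! ### Edges of the square and of the torus -/

section Edges

variable {M N : ℕ}

/-- The neighbour of an internal vertex to the left, or below. -/
def lowerNeighbour (h : Bool) (q : Fin M × Fin M) : SqVertex M :=
  if h then (exists_left q).choose else (exists_down q).choose

theorem adj_lowerNeighbour (h : Bool) (q : Fin M × Fin M) :
    (extSquare M).Adj (.inl q) (lowerNeighbour h q) := by
  unfold lowerNeighbour
  split_ifs
  · exact (exists_left q).choose_spec.1
  · exact (exists_down q).choose_spec.1

/-- The edge to the left of an internal vertex, or below it. -/
def lowerEdge (i : Bool × (Fin M × Fin M)) : (extSquare M).edgeSet :=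
  ⟨s(.inl i.2, lowerNeighbour i.1 i.2), adj_lowerNeighbour i.1 i.2⟩

/-- The half-edge at a boundary point. -/
def halfEdge (b : Bou M) : (extSquare M).edgeSet :=
  ⟨s(.inr b, .inl (attach b)), (attached_iff.2 rfl : Attached (attach b) b)⟩

theorem eq_attach_of_adj {b : Bou M} {z : SqVertex M} (h : (extSquare M).Adj (.inr b) z) :
    z = .inl (attach b) := by
  rcases z with q | b'
  · rw [attached_iff.1 h]
  · exact h.elim

theorem lowerNeighbour_eq {q : Fin M × Fin M} {z : SqVertex M}
    (h : (offset (.inl q)).1 = (offset z).1 + 1 ∧ (offset (.inl q)).2 = (offset z).2) :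
    lowerNeighbour true q = z := by
  have h' := (exists_left q).choose_spec.2
  simp only [lowerNeighbour, if_true]
  exact offset_injective (Prod.ext (by omega) (by omega))

theorem lowerNeighbour_eq' {q : Fin M × Fin M} {z : SqVertex M}
    (h : (offset (.inl q)).2 = (offset z).2 + 1 ∧ (offset (.inl q)).1 = (offset z).1) :
    lowerNeighbour false q = z := by
  have h' := (exists_down q).choose_spec.2
  simp only [lowerNeighbour, Bool.false_eq_true, if_false]
  exact offset_injective (Prod.ext (by omega) (by omega))

/-- Orient the edge towards the larger coordinate. If the upper end is internal, this is the lower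
edge of that end; otherwise the upper end is a boundary point on the right or top. -/
theorem exists_lowerEdge_or_halfEdge (e : (extSquare M).edgeSet) :
    (∃ i, lowerEdge i = e) ∨ ∃ b : Bou M, halfEdge b = e ∧ (b.1 = .right ∨ b.1 = .top) := by
  obtain ⟨e, he⟩ := e
  induction e using Sym2.ind with
  | _ z z' =>
    have key : ∀ z z' : SqVertex M, ∀ h : (extSquare M).Adj z z',
        ((offset z').1 = (offset z).1 + 1 ∧ (offset z').2 = (offset z).2) ∨
        ((offset z').2 = (offset z).2 + 1 ∧ (offset z').1 = (offset z).1) →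
        (∃ i, lowerEdge i = ⟨s(z, z'), h⟩) ∨
          ∃ b : Bou M, halfEdge b = ⟨s(z, z'), h⟩ ∧ (b.1 = .right ∨ b.1 = .top) := by
      intro z z' h ho
      rcases z' with q | b
      · left
        rcases ho with ho | ho
        · exact ⟨(true, q), Subtype.ext (by
            simp only [lowerEdge, lowerNeighbour_eq ho]; exact Sym2.eq_swap)⟩
        · exact ⟨(false, q), Subtype.ext (by
            simp only [lowerEdge, lowerNeighbour_eq' ho]; exact Sym2.eq_swap)⟩
      · right
        obtain rfl := eq_attach_of_adj h.symm
        refine ⟨b, Subtype.ext Sym2.eq_swap, ?_⟩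
        obtain ⟨_ | _ | _ | _, j⟩ := b <;> simp only [offset, attach] at ho <;> simp <;> omega
    have hadj : (extSquare M).Adj z z' := he
    rcases offset_adj hadj with h | h | h | h
    · exact key z z' hadj (Or.inl h)
    · have := key z' z hadj.symm (Or.inl ⟨h.1, h.2.symm⟩)
      convert this using 5 <;> exact Subtype.ext Sym2.eq_swap
    · exact key z z' hadj (Or.inr h)
    · have := key z' z hadj.symm (Or.inr ⟨h.1, h.2.symm⟩)
      convert this using 5 <;> exact Subtype.ext Sym2.eq_swap

theorem isRightTop_halfEdge {b : Bou M} (h : b.1 = .right ∨ b.1 = .top) :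
    IsRightTop (halfEdge b) := by
  obtain ⟨s, j⟩ := b
  rcases h with h | h
  · simp only at h
    subst h
    exact ⟨j, Or.inl (by simp [halfEdge])⟩
  · simp only at h
    subst h
    exact ⟨j, Or.inr (by simp [halfEdge])⟩

/-- Two lower edges for each internal vertex and `4 * M` half-edges. -/
theorem card_edgeSet_le (hM : 0 < M) : Fintype.card (extSquare M).edgeSet ≤ 6 * M ^ 2 := by
  have h : Function.Surjective
      (Sum.elim lowerEdge halfEdge : (Bool × (Fin M × Fin M)) ⊕ Bou M → (extSquare M).edgeSet) := by
    intro e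
    rcases exists_lowerEdge_or_halfEdge e with ⟨i, hi⟩ | ⟨b, hb, -⟩
    · exact ⟨.inl i, hi⟩
    · exact ⟨.inr b, hb⟩
  have hside : Fintype.card Side = 4 := rfl
  refine (Fintype.card_le_of_surjective _ h).trans ?_
  simp only [Fintype.card_sum, Fintype.card_prod, Fintype.card_bool, Fintype.card_fin, hside]
  nlinarith

open Classical in
theorem sum_not_rightTop_le (F : (extSquare M).edgeSet → ℝ≥0) :
    ∑ e, (if IsRightTop e then 0 else F e) ≤ ∑ i, F (lowerEdge i) := by
  calc ∑ e, (if IsRightTop e then 0 else F e)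
      = ∑ e ∈ Finset.univ.filter fun e => ¬ IsRightTop e, F e := by
        rw [Finset.sum_filter]
        exact Finset.sum_congr rfl fun e _ => by split_ifs <;> simp_all
    _ ≤ ∑ e ∈ Finset.univ.image lowerEdge, F e := by
        refine Finset.sum_le_sum_of_subset fun e he => ?_
        rcases exists_lowerEdge_or_halfEdge e with ⟨i, hi⟩ | ⟨b, rfl, hb⟩
        · exact Finset.mem_image.2 ⟨i, Finset.mem_univ _, hi⟩
        · exact absurd (isRightTop_halfEdge hb) (Finset.mem_filter.1 he).2
    _ ≤ ∑ i, F (lowerEdge i) := Finset.sum_image_le_of_nonneg fun _ _ => zero_le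

variable [NeZero N]

/-- The edge of the torus that corresponds to an edge of the square at the position `p`. -/
def placeEdge (hMN : M + 2 ≤ N) (p : Fin N × Fin N) (e : (extSquare M).edgeSet) :
    (torus N).edgeSet :=
  ⟨Sym2.map (place (M := M) p) (e : Sym2 (SqVertex M)), by
    obtain ⟨e, he⟩ := e
    induction e using Sym2.ind with
    | _ z z' => exact place_adj (by omega) p he⟩

theorem placeEdge_injective (hMN : M + 2 ≤ N) (p : Fin N × Fin N) :
    Function.Injective (placeEdge (M := M) hMN p) := by
  intro e e' h
  exact Subtype.ext (Sym2.map.injective (place_injective hMN p) (congrArg Subtype.val h))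

/-- The side through which the given kind of edges is crossed. -/
def lowerSide (h : Bool) : Side := if h then .left else .bottom

/-- The edge to the left of a vertex of the torus, or below it. -/
def torusEdge (hN : 2 ≤ N) (i : Bool × (Fin N × Fin N)) : (torus N).edgeSet :=
  ⟨s(i.2, i.2 - inStep (lowerSide i.1)), by
    refine (torus_adj_iff hN).2 ?_
    obtain ⟨h, u⟩ := i
    cases h
    · exact Or.inr (Or.inr (Or.inr (sub_add_cancel u (0, 1)).symm))
    · exact Or.inr (Or.inl (sub_add_cancel u (1, 0)).symm)⟩

/-- An edge obtained with its ends exchanged would make two of the steps `(1, 0)`, `(0, 1)` inverse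
to each other. -/
theorem torusEdge_injective (hN : 3 ≤ N) :
    Function.Injective (torusEdge (N := N) (by omega)) := by
  rintro ⟨h, u⟩ ⟨h', u'⟩ heq
  have h1 := congrArg Subtype.val heq
  simp only [torusEdge, Sym2.eq_iff] at h1
  rcases h1 with ⟨rfl, h2⟩ | ⟨h2, h3⟩
  · have := inStep_injective hN (sub_right_injective h2)
    cases h <;> cases h' <;> simp [lowerSide] at this ⊢
  · exfalso
    have h4 : inStep (N := N) (lowerSide h') = inStep (lowerSide h).opp := by
      rw [inStep_opp, ← sub_eq_zero, sub_neg_eq_add]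
      have : u = u - inStep (lowerSide h) - inStep (lowerSide h') := by rw [h3, ← h2]
      rw [sub_sub, eq_comm, sub_eq_self] at this
      rw [add_comm]; exact this
    have := inStep_injective hN h4
    cases h <;> cases h' <;> simp [lowerSide, Side.opp] at this

theorem placeEdge_lowerEdge (hMN : M + 2 ≤ N) (p : Fin N × Fin N)
    (h : Bool) (q : Fin M × Fin M) :
    placeEdge hMN p (lowerEdge (h, q)) = torusEdge (by omega) (h, p + place 0 (.inl q : SqVertex M)) := by
  refine Subtype.ext ?_
  simp only [placeEdge, lowerEdge, torusEdge, Sym2.map_mk, ← place_eq]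
  congr 1
  rw [eq_sub_iff_add_eq]
  cases h
  · obtain ⟨h1, h2⟩ := (exists_down q).choose_spec
    exact (place_up (z := lowerNeighbour false q) (by simpa [lowerNeighbour] using h2)).symm
  · obtain ⟨h1, h2⟩ := (exists_left q).choose_spec
    exact (place_right (z := lowerNeighbour true q) (by simpa [lowerNeighbour] using h2)).symm

open Classical in
/-- Every edge of the torus belongs to `M²` of the squares. -/
theorem sum_placeEdge_le (hN : 3 ≤ N) (hMN : M + 2 ≤ N) (F : (torus N).edgeSet → ℝ≥0) :
    ∑ p, ∑ e : (extSquare M).edgeSet, (if IsRightTop e then 0 else F (placeEdge hMN p e)) ≤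
      M ^ 2 * ∑ e, F e := by
  calc _ ≤ ∑ p, ∑ i : Bool × (Fin M × Fin M), F (placeEdge hMN p (lowerEdge i)) :=
        Finset.sum_le_sum fun p _ => sum_not_rightTop_le fun e => F (placeEdge hMN p e)
    -- For a fixed lower edge of the square, the corresponding vertex runs through the torus once as
    -- the position varies.
    _ = ∑ i : Bool × (Fin M × Fin M), ∑ u : Fin N × Fin N, F (torusEdge (by omega) (i.1, u)) := by
        rw [Finset.sum_comm]
        refine Finset.sum_congr rfl fun i _ => ?_
        obtain ⟨h, q⟩ := i
        simp only [placeEdge_lowerEdge]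
        exact Equiv.sum_comp (Equiv.addRight (place 0 (.inl q : SqVertex M)))
          fun u => F (torusEdge (by omega) (h, u))
    _ = M ^ 2 * ∑ i : Bool × (Fin N × Fin N), F (torusEdge (by omega) i) := by
        rw [Fintype.sum_prod_type, Fintype.sum_prod_type (γ := ℝ≥0) (f := fun i => F (torusEdge _ i)),
          Finset.mul_sum]
        refine Finset.sum_congr rfl fun h _ => ?_
        simp only [Finset.sum_const, Finset.card_univ, Fintype.card_prod, Fintype.card_fin,
          nsmul_eq_mul]
        push_cast
        ring
    _ ≤ _ := by
        gcongr
        rw [← Finset.sum_image (f := F) (g := torusEdge (N := N) (by omega))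
          fun i _ j _ h => torusEdge_injective hN h]
        exact Finset.sum_le_univ_sum_of_nonneg fun _ => zero_le

/-! ### The environment of a square in the torus -/

open Classical in
/-- The environment on the extended square at the position `p`. -/
def squareEnv (hMN : M + 2 ≤ N) (p : Fin N × Fin N) (c : Environment (torus N)) :
    Environment (extSquare M) := fun e => if IsRightTop e then 0 else c (placeEdge hMN p e)

theorem measurable_squareEnv (hMN : M + 2 ≤ N) (p : Fin N × Fin N) :
    Measurable (squareEnv (M := M) hMN p) := by
  refine measurable_pi_lambda _ fun e => ?_
  unfold squareEnv
  split_ifs <;> fun_prop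

/-- Different edges of the square are placed on different edges of the torus, so their factors are
independent, and replacing some of them by zero preserves independence. -/
theorem map_squareEnv (κ : Measure ℝ≥0) [IsProbabilityMeasure κ] (hMN : M + 2 ≤ N)
    (p : Fin N × Fin N) : (torusLaw κ N).map (squareEnv (M := M) hMN p) = squareLaw κ M := by
  classical
  have : IsProbabilityMeasure (torusLaw κ N) := by unfold torusLaw; infer_instance
  let φ : (extSquare M).edgeSet → ℝ≥0 → ℝ≥0 := fun e t => if IsRightTop e then 0 else t
  have hφ : ∀ e, Measurable (φ e) := fun e => by
    simp only [φ]; split_ifs <;> fun_prop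
  have h1 : ProbabilityTheory.iIndepFun (fun (e : (torus N).edgeSet) (c : Environment (torus N)) => c e)
      (torusLaw κ N) :=
    ProbabilityTheory.iIndepFun_pi (μ := fun _ : (torus N).edgeSet => κ) (X := fun _ t => t)
      fun _ => aemeasurable_id
  have h2 := (h1.precomp (placeEdge_injective (M := M) hMN p)).comp φ hφ
  have hm : ∀ e, Measurable (φ e ∘ fun c : Environment (torus N) => c (placeEdge hMN p e)) := fun e =>
    (hφ e).comp (measurable_pi_apply _)
  rw [ProbabilityTheory.iIndepFun_iff_map_fun_eq_pi_map fun e => (hm e).aemeasurable] at h2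
  have h3 : squareEnv (M := M) hMN p = fun c e => (φ e ∘ fun c : Environment (torus N) =>
      c (placeEdge hMN p e)) c := rfl
  rw [h3, h2, squareLaw]
  congr 1
  funext e
  rw [← Measure.map_map (hφ e) (measurable_pi_apply (placeEdge hMN p e))]
  have h4 : (torusLaw κ N).map (fun c => c (placeEdge hMN p e)) = κ :=
    (measurePreserving_eval (fun _ : (torus N).edgeSet => κ) (placeEdge hMN p e)).map_eq
  rw [h4]
  by_cases he : IsRightTop e
  · have : φ e = fun _ => 0 := by funext t; simp [φ, he]
    rw [this, Measure.map_const, if_pos he]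
    simp
  · have : φ e = id := by funext t; simp [φ, he]
    rw [this, Measure.map_id, if_neg he]

end Edges

end LatticeFlow

end

noncomputable section

namespace LatticeFlow

open MeasureTheory SimpleGraph

/-! ### The flow across a square that is induced by a flow in the torus -/

section SquareFlow

theorem sum_countP_simplify {V : Type*} [DecidableEq V] [Fintype V] {G : SimpleGraph V}
    (L : List (FinPath G)) (φ : SimplePath G → ℝ≥0) :
    ∑ τ, (L.countP (fun ρ => ρ.simplify = τ) : ℝ≥0) * φ τ =
      (L.map fun ρ => φ ρ.simplify).sum := by
  induction L with
  | nil => simp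
  | cons ρ L ih =>
    simp only [List.countP_cons, List.map_cons, List.sum_cons, ← ih, decide_eq_true_eq]
    push_cast
    simp only [add_mul, Finset.sum_add_distrib, ite_mul, one_mul, zero_mul]
    rw [add_comm]
    simp

theorem sum_map_ite_eq_countP {α : Type*} (L : List α) (P : α → Prop) [DecidablePred P] :
    (L.map fun a => if P a then (1 : ℝ≥0) else 0).sum = (L.countP fun a => P a : ℕ) := by
  induction L with
  | nil => simp
  | cons a L ih =>
    simp only [List.countP_cons, List.map_cons, List.sum_cons, ih, decide_eq_true_eq]
    push_cast
    rw [add_comm]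

theorem sum_map_simplify {V : Type*} [DecidableEq V] [Fintype V] {G : SimpleGraph V}
    (L : List (FinPath G)) (v w : V) :
    (L.map fun ρ => if ρ.simplify.1.ent = v ∧ ρ.simplify.1.exi = w then (1 : ℝ≥0) else 0).sum =
      (L.countP fun ρ => ρ.ent = v ∧ ρ.exi = w : ℕ) :=
  sum_map_ite_eq_countP L fun ρ => ρ.ent = v ∧ ρ.exi = w

/-! ### Starts, ends and entrances of paths in a square at a fixed position. -/

section Position

variable {M N : ℕ} [NeZero N]

theorem sum_inside_position (hMN : M + 2 ≤ N) (p : Fin N × Fin N) :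
    ∑ u, (squareAt (M := M) hMN p).inside u = M ^ 2 := by
  classical
  simp only [Realization.inside]
  have : (Finset.univ.filter fun u => ∃ q, u = (squareAt (M := M) hMN p).ι (.inl q)) =
      Finset.univ.image fun q : Fin M × Fin M => place p (.inl q : SqVertex M) := by
    ext u
    simp only [Finset.mem_filter, Finset.mem_univ, true_and, Finset.mem_image]
    exact exists_congr fun q => eq_comm
  trans (Finset.univ.image fun q : Fin M × Fin M => place p (.inl q : SqVertex M)).card
  · rw [← this, Finset.card_filter]
    exact Finset.sum_congr rfl fun p _ => by congr
  rw [Finset.card_image_of_injective]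
  · simp [sq]
  · exact (place_injective hMN p).comp Sum.inl_injective

theorem entries_le (hMN : M + 2 ≤ N) (p : Fin N × Fin N) (σ : FinPath (torus N)) (b : Bou M) :
    (squareAt hMN p).entries σ.walk b ≤ σ.crossings (placeEdge hMN p (halfEdge b)) := by
  rw [Realization.entries, FinPath.crossings, Walk.edges, List.count, List.countP_map]
  refine List.countP_mono_left fun d _ hd => ?_
  simp only [decide_eq_true_eq] at hd
  simp only [Function.comp_apply, beq_iff_eq, placeEdge, halfEdge, Sym2.map_mk]
  obtain ⟨⟨u, v⟩, h⟩ := d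
  simp only at hd
  rw [Dart.edge_mk, hd.1, hd.2]
  rfl

variable {x : SimplePath (torus N) → ℝ≥0}

/-- Every vertex is the start of total mass `N ^ 2 / N ^ 3 = 1 / N`. In particular, the paths that
start inside a square have mass `M ^ 2 / N`. -/
theorem sum_mul_ent (hx : ∀ v w, trans x v w = ((N : ℝ≥0) ^ 3)⁻¹) (f : Fin N × Fin N → ℝ≥0) :
    ∑ σ, x σ * f σ.1.ent = (∑ u, f u) / N := by
  have hN : (N : ℝ≥0) ≠ 0 := by exact_mod_cast NeZero.ne N
  have h1 : ∀ σ : SimplePath (torus N), x σ * f σ.1.ent =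
      ∑ v, ∑ w, (if σ.1.ent = v ∧ σ.1.exi = w then x σ else 0) * f v := by
    intro σ
    simp [ite_and]
  simp only [h1]
  rw [Finset.sum_comm, Finset.sum_div]
  refine Finset.sum_congr rfl fun v _ => ?_
  rw [Finset.sum_comm]
  simp only [← Finset.sum_mul]
  have h2 : ∀ w, ∑ σ : SimplePath (torus N), (if σ.1.ent = v ∧ σ.1.exi = w then x σ else 0) =
      ((N : ℝ≥0) ^ 3)⁻¹ := fun w => hx v w
  simp only [h2, Finset.sum_const, Finset.card_univ, Fintype.card_prod, Fintype.card_fin,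
    nsmul_eq_mul]
  push_cast
  field_simp

theorem sum_mul_exi (hx : ∀ v w, trans x v w = ((N : ℝ≥0) ^ 3)⁻¹) (f : Fin N × Fin N → ℝ≥0) :
    ∑ σ, x σ * f σ.1.exi = (∑ u, f u) / N := by
  have hN : (N : ℝ≥0) ≠ 0 := by exact_mod_cast NeZero.ne N
  have h1 : ∀ σ : SimplePath (torus N), x σ * f σ.1.exi =
      ∑ w, ∑ v, (if σ.1.ent = v ∧ σ.1.exi = w then x σ else 0) * f w := by
    intro σ
    simp [ite_and]
  simp only [h1]
  rw [Finset.sum_comm, Finset.sum_div]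
  refine Finset.sum_congr rfl fun w _ => ?_
  rw [Finset.sum_comm]
  simp only [← Finset.sum_mul]
  have h2 : ∀ v, ∑ σ : SimplePath (torus N), (if σ.1.ent = v ∧ σ.1.exi = w then x σ else 0) =
      ((N : ℝ≥0) ^ 3)⁻¹ := fun v => hx v w
  simp only [h2, Finset.sum_const, Finset.card_univ, Fintype.card_prod, Fintype.card_fin,
    nsmul_eq_mul]
  push_cast
  field_simp

theorem sum_mul_inside_ent (hMN : M + 2 ≤ N) (p : Fin N × Fin N)
    (hx : ∀ v w, trans x v w = ((N : ℝ≥0) ^ 3)⁻¹) :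
    ∑ σ, x σ * ((squareAt (M := M) hMN p).inside σ.1.ent : ℝ≥0) = (M : ℝ≥0) ^ 2 / N := by
  rw [sum_mul_ent hx fun u => ((squareAt (M := M) hMN p).inside u : ℝ≥0), ← Nat.cast_sum,
    sum_inside_position, Nat.cast_pow]

theorem sum_mul_inside_exi (hMN : M + 2 ≤ N) (p : Fin N × Fin N)
    (hx : ∀ v w, trans x v w = ((N : ℝ≥0) ^ 3)⁻¹) :
    ∑ σ, x σ * ((squareAt (M := M) hMN p).inside σ.1.exi : ℝ≥0) = (M : ℝ≥0) ^ 2 / N := by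
  rw [sum_mul_exi hx fun u => ((squareAt (M := M) hMN p).inside u : ℝ≥0), ← Nat.cast_sum,
    sum_inside_position, Nat.cast_pow]

end Position

theorem mul_le_sq_div {M N : ℕ} [NeZero M] {t : ℝ≥0} (ht : t ≤ (N : ℝ≥0)⁻¹) :
    t * M ≤ (M : ℝ≥0) ^ 2 / N := by
  have hM : (1 : ℝ≥0) ≤ M := by exact_mod_cast Nat.pos_of_ne_zero (NeZero.ne M)
  calc t * M ≤ (N : ℝ≥0)⁻¹ * (M * M) := by
        gcongr
        exact le_mul_of_one_le_left zero_le hM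
    _ = _ := by rw [div_eq_mul_inv]; ring

variable {M N : ℕ} [NeZero M] [NeZero N]

/-- A path between given vertices of the extended square. -/
def linkPath (z z' : SqVertex M) : SimplePath (extSquare M) :=
  FinPath.simplify ⟨z, z', (reachable_extSquare z z').some⟩

/-- The flow that consists of the pieces of the flow `x` in the square at the position `p`, with
small corrections. -/
def squareFlow (hMN : M + 2 ≤ N) (t₁ t₂ : ℝ≥0) (p : Fin N × Fin N)
    (x : SimplePath (torus N) → ℝ≥0) (τ : SimplePath (extSquare M)) : ℝ≥0 :=
  ∑ σ, x σ * ((pieces hMN p σ.1).countP (fun ρ => ρ.simplify = τ) : ℝ≥0) +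
    ((if τ = linkPath (.inr (corner .right)) (.inr (corner .right)) then (M : ℝ≥0) ^ 2 / N else 0) +
      ((if τ = linkPath (.inr (corner .left)) (.inr (corner .right)) then t₁ * M else 0) +
        if τ = linkPath (.inr (corner .bottom)) (.inr (corner .top)) then t₂ * M else 0))

theorem measurable_squareFlow (hMN : M + 2 ≤ N) (t₁ t₂ : ℝ≥0) (p : Fin N × Fin N) :
    Measurable (squareFlow (M := M) hMN t₁ t₂ p) := by
  refine measurable_pi_lambda _ fun τ => ?_
  unfold squareFlow
  fun_prop

variable (hMN : M + 2 ≤ N) (t₁ t₂ : ℝ≥0) (p : Fin N × Fin N) (x : SimplePath (torus N) → ℝ≥0)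

theorem sum_squareFlow (φ : SimplePath (extSquare M) → ℝ≥0) :
    ∑ τ, squareFlow hMN t₁ t₂ p x τ * φ τ =
      ∑ σ, x σ * ((pieces hMN p σ.1).map fun ρ => φ ρ.simplify).sum +
        ((M : ℝ≥0) ^ 2 / N * φ (linkPath (.inr (corner .right)) (.inr (corner .right))) +
        (t₁ * M * φ (linkPath (.inr (corner .left)) (.inr (corner .right))) +
          t₂ * M * φ (linkPath (.inr (corner .bottom)) (.inr (corner .top))))) := by
  simp only [squareFlow, add_mul, Finset.sum_add_distrib, ite_mul, zero_mul, Finset.sum_ite_eq',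
    Finset.mem_univ, if_true]
  congr 1
  simp only [← sum_countP_simplify, Finset.mul_sum, Finset.sum_mul]
  rw [Finset.sum_comm]
  simp only [mul_assoc]

theorem trans_eq_sum_mul {V : Type*} [DecidableEq V] [Fintype V] {G : SimpleGraph V}
    (x : SimplePath G → ℝ≥0) (v w : V) :
    trans x v w = ∑ σ, x σ * if σ.1.ent = v ∧ σ.1.exi = w then 1 else 0 := by
  simp [trans]

theorem trans_squareFlow (b b' : Bou M) :
    trans (squareFlow hMN t₁ t₂ p x) (.inr b) (.inr b') =
      ∑ σ, x σ * (pieceTrans hMN p σ.1 b b' : ℝ≥0) +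
        (pointMass (corner .right) (corner .right) ((M : ℝ≥0) ^ 2 / N) (b, b') +
          driftMass t₁ t₂ (b, b')) := by
  rw [trans_eq_sum_mul, sum_squareFlow]
  simp only [sum_map_simplify]
  simp only [FinPath.simplify_ent, FinPath.simplify_exi, pieceTrans,
    linkPath, pointMass, driftMass, Pi.add_apply, Sum.inr.injEq, Prod.mk.injEq, mul_ite, mul_one,
    mul_zero, eq_comm (a := b), eq_comm (a := b')]

theorem trans_squareFlow_eq_zero {v w : SqVertex M}
    (h : ∀ b b', ¬ (v = .inr b ∧ w = .inr b')) : trans (squareFlow hMN t₁ t₂ p x) v w = 0 := by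
  rw [trans_eq_sum_mul, sum_squareFlow]
  have h1 : ∀ b b' : Bou M, ¬ ((.inr b : SqVertex M) = v ∧ (.inr b' : SqVertex M) = w) :=
    fun b b' hb => h b b' ⟨hb.1.symm, hb.2.symm⟩
  simp only [sum_map_simplify]
  simp only [FinPath.simplify_ent, FinPath.simplify_exi, linkPath, h1,
    if_false, mul_zero, add_zero]
  refine Finset.sum_eq_zero fun σ _ => ?_
  rw [List.countP_eq_zero.2, Nat.cast_zero, mul_zero]
  intro τ hτ
  obtain ⟨⟨b, hb⟩, ⟨b', hb'⟩⟩ := (isCut_pieces hMN p σ.1).boundary τ hτ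
  simp only [hb, hb', h1, decide_false, Bool.false_eq_true, not_false_eq_true]

variable {x t₁ t₂}

/-- The five error terms are the completions of first and of last pieces and the three corrections
at the corners, each of mass at most `M ^ 2 / N` and crossing the edge at most once. -/
theorem vol_squareFlow_le (hx : ∀ v w, trans x v w = ((N : ℝ≥0) ^ 3)⁻¹)
    (ht₁ : t₁ ≤ (N : ℝ≥0)⁻¹) (ht₂ : t₂ ≤ (N : ℝ≥0)⁻¹) (e : (extSquare M).edgeSet) :
    vol (squareFlow hMN t₁ t₂ p x) e ≤ vol x (placeEdge hMN p e) + 5 * ((M : ℝ≥0) ^ 2 / N) := by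
  rw [vol, sum_squareFlow hMN t₁ t₂ p x fun τ => (τ.1.crossings e : ℝ≥0)]
  have hone : ∀ τ : SimplePath (extSquare M), (τ.1.crossings e : ℝ≥0) ≤ 1 := fun τ => by
    exact_mod_cast τ.crossings_le_one e
  have h1 : ∀ σ : SimplePath (torus N),
      ((pieces hMN p σ.1).map fun ρ => (ρ.simplify.1.crossings e : ℝ≥0)).sum ≤
        ((squareAt (M := M) hMN p).inside σ.1.ent : ℝ≥0) + σ.1.crossings (placeEdge hMN p e) +
          ((squareAt (M := M) hMN p).inside σ.1.exi : ℝ≥0) := by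
    intro σ
    have h2 := (isCut_pieces hMN p σ.1).cross e
    have h3 : ((pieces hMN p σ.1).map fun ρ => ρ.simplify.1.crossings e).sum ≤
        ((pieces hMN p σ.1).map fun ρ => ρ.crossings e).sum :=
      List.sum_le_sum fun ρ _ => ρ.crossings_simplify_le e
    have h4 := h3.trans h2
    have h5 : ((pieces hMN p σ.1).map fun ρ => (ρ.simplify.1.crossings e : ℝ≥0)).sum =
        (((pieces hMN p σ.1).map fun ρ => ρ.simplify.1.crossings e).sum : ℕ) := by
      rw [Nat.cast_list_sum, List.map_map]
      rfl
    rw [h5]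
    exact_mod_cast h4
  calc _ ≤ ∑ σ, x σ * (((squareAt (M := M) hMN p).inside σ.1.ent : ℝ≥0) +
          σ.1.crossings (placeEdge hMN p e) + ((squareAt (M := M) hMN p).inside σ.1.exi : ℝ≥0)) +
        ((M : ℝ≥0) ^ 2 / N * 1 + ((M : ℝ≥0) ^ 2 / N * 1 + (M : ℝ≥0) ^ 2 / N * 1)) := by
        gcongr
        · exact h1 _
        · exact hone _
        · exact mul_le_sq_div ht₁
        · exact hone _
        · exact mul_le_sq_div ht₂
        · exact hone _
    _ = _ := by
        simp only [mul_add, Finset.sum_add_distrib, sum_mul_inside_ent hMN p hx,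
          sum_mul_inside_exi hMN p hx, vol]
        ring

theorem length_pieces (σ : FinPath (torus N)) : (pieces (M := M) hMN p σ).length =
    (squareAt (M := M) hMN p).inside σ.ent + ∑ b, (squareAt (M := M) hMN p).entries σ.walk b := by
  have h1 := sum_countP (pieces (M := M) hMN p σ)
    (fun (b : Bou M) (τ : FinPath (extSquare M)) => τ.ent = .inr b) (fun _ => True) fun τ hτ => by
      obtain ⟨c, hc⟩ := ((isCut_pieces hMN p σ).boundary τ hτ).1
      simp [hc]
  simp only [decide_true, List.countP_true] at h1
  rw [← h1]
  simp only [(isCut_pieces hMN p σ).ent, Finset.sum_add_distrib, Finset.sum_ite_eq',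
    Finset.mem_univ, if_true]

/-- Pieces are counted by their entrances: at most `B` through each of the `4 * M` half-edges, plus
the completed starts. That the mass is of the order of the perimeter, not of the area, is what lets
`n` be small against `M ^ 2`. -/
theorem sum_squareFlow_le (hx : ∀ v w, trans x v w = ((N : ℝ≥0) ^ 3)⁻¹) {B : ℝ≥0}
    (hB : ∀ e, vol x e ≤ B) (ht₁ : t₁ ≤ (N : ℝ≥0)⁻¹) (ht₂ : t₂ ≤ (N : ℝ≥0)⁻¹) :
    ∑ τ, squareFlow (M := M) hMN t₁ t₂ p x τ ≤ (4 * B + 4) * M := by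
  have h0 := sum_squareFlow (M := M) hMN t₁ t₂ p x fun _ => 1
  simp only [mul_one, List.map_const', List.sum_replicate, nsmul_eq_mul] at h0
  have hside : Fintype.card Side = 4 := rfl
  have hN : (N : ℝ≥0) ≠ 0 := by exact_mod_cast NeZero.ne N
  have hle : (M : ℝ≥0) ^ 2 / N ≤ M := by
    rw [div_le_iff₀ (pos_iff_ne_zero.2 hN), sq]
    gcongr
    omega
  rw [h0]
  calc _ ≤ ∑ σ, x σ * (((squareAt (M := M) hMN p).inside σ.1.ent : ℝ≥0) +
          ∑ b : Bou M, (σ.1.crossings (placeEdge hMN p (halfEdge b)) : ℝ≥0)) +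
        ((M : ℝ≥0) ^ 2 / N + ((M : ℝ≥0) ^ 2 / N + (M : ℝ≥0) ^ 2 / N)) := by
        gcongr with σ
        · rw [length_pieces]
          push_cast
          gcongr
          exact_mod_cast entries_le hMN p σ.1 _
        · exact mul_le_sq_div ht₁
        · exact mul_le_sq_div ht₂
    _ = ∑ b : Bou M, vol x (placeEdge hMN p (halfEdge b)) + 4 * ((M : ℝ≥0) ^ 2 / N) := by
        simp only [mul_add, Finset.sum_add_distrib, sum_mul_inside_ent hMN p hx, Finset.mul_sum]
        rw [Finset.sum_comm]
        simp only [vol]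
        ring
    _ ≤ ∑ _b : Bou M, B + 4 * M := by
        gcongr
        exact hB _
    _ = _ := by
        simp only [Finset.sum_const, Finset.card_univ, Fintype.card_prod, Fintype.card_fin, hside,
          nsmul_eq_mul]
        push_cast
        ring

end SquareFlow

end LatticeFlow

end

noncomputable section

namespace LatticeFlow

open MeasureTheory SimpleGraph

/-! ### Measurable choice of almost optimal flows -/

section Selection

variable {V : Type*} [DecidableEq V] [Fintype V] {G : SimpleGraph V}

/-- Round the environment up to a grid of mesh `δ` and choose one flow for each grid point: a map
from a countable discrete set is measurable. Rounding up can only raise the cost of the chosen flow,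
and it raises the minimum by at most `η / 2`. -/
theorem exists_measurable_weights [Fintype G.edgeSet] (T : V → V → ℝ≥0∞) (B : ℝ≥0)
    (hfin : ∀ c : Environment G, minCost T B c ≠ ∞) {η : ℝ≥0} (hη : 0 < η) :
    ∃ x : Environment G → SimplePath G → ℝ≥0, Measurable x ∧ ∀ c,
      (∀ v w, (trans (x c) v w : ℝ≥0∞) = T v w) ∧ (∀ e, vol (x c) e ≤ B) ∧
      (nncost (vol (x c)) c : ℝ≥0∞) ≤ minCost T B c + η := by
  set K : ℝ≥0 := Fintype.card G.edgeSet * B ^ 2 + 1 with hK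
  set δ : ℝ≥0 := η / 2 / K with hδdef
  have hK0 : 0 < K := by positivity
  have hδ : 0 < δ := by positivity
  have hδK : Fintype.card G.edgeSet * δ * B ^ 2 ≤ η / 2 := by
    calc Fintype.card G.edgeSet * δ * B ^ 2 ≤ δ * K := by rw [hK, mul_add, mul_one]; ring_nf; simp
      _ = η / 2 := div_mul_cancel₀ _ hK0.ne'
  choose y hyT hyB hy using fun k : G.edgeSet → ℕ =>
    exists_weights_of_minCost (hfin fun e => (k e : ℝ≥0) * δ) (half_pos hη)
  let r : Environment G → G.edgeSet → ℕ := fun c e => ⌈c e / δ⌉₊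
  have hr : Measurable r := by
    refine measurable_pi_lambda _ fun e => ?_
    have : Measurable fun c : Environment G => c e / δ := by fun_prop
    exact Nat.measurable_ceil.comp this
  have hr1 : ∀ c e, c e ≤ (r c e : ℝ≥0) * δ := fun c e => by
    rw [← div_le_iff₀ hδ]; exact Nat.le_ceil _
  have hr2 : ∀ c e, (r c e : ℝ≥0) * δ ≤ c e + δ := fun c e => by
    have := (Nat.ceil_lt_add_one (zero_le (a := c e / δ))).le
    calc (r c e : ℝ≥0) * δ ≤ (c e / δ + 1) * δ := by gcongr
      _ = _ := by rw [add_mul, div_mul_cancel₀ _ hδ.ne', one_mul]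
  refine ⟨fun c => y (r c), (Measurable.of_discrete (f := y)).comp hr, fun c =>
    ⟨hyT _, hyB _, ?_⟩⟩
  have h1 := minCost_le_add T B c (fun e => (r c e : ℝ≥0) * δ) (fun _ => δ) (hr2 c)
  rw [Finset.sum_const, Finset.card_univ, nsmul_eq_mul] at h1
  calc (nncost (vol (y (r c))) c : ℝ≥0∞)
      ≤ (nncost (vol (y (r c))) (fun e => (r c e : ℝ≥0) * δ) : ℝ≥0∞) := by
        rw [ENNReal.coe_le_coe]
        refine Finset.sum_le_sum fun e _ => ?_
        gcongr
        exact hr1 c e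
    _ ≤ minCost T B c + (η / 2 : ℝ≥0) + (η / 2 : ℝ≥0) := by
        refine (hy (r c)).trans ?_
        gcongr
        refine h1.trans ?_
        gcongr
    _ = _ := by rw [add_assoc, ← ENNReal.coe_add, add_halves]

end Selection

/-! ### A square in a random position of the torus -/

section RandomPosition

variable {M N : ℕ}

/-- The law of the environment on the torus together with an independent uniform position. -/
def placedLaw (κ : Measure ℝ≥0) (N : ℕ) : Measure (Environment (torus N) × (Fin N × Fin N)) :=
  ∑ p, ((((N : ℝ≥0) ^ 2)⁻¹ : ℝ≥0) : ℝ≥0∞) • (torusLaw κ N).map fun c => (c, p)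

theorem lintegral_placedLaw (κ : Measure ℝ≥0) {f : Environment (torus N) × (Fin N × Fin N) → ℝ≥0∞}
    (hf : Measurable f) : ∫⁻ ω, f ω ∂placedLaw κ N =
      ∑ p, ((((N : ℝ≥0) ^ 2)⁻¹ : ℝ≥0) : ℝ≥0∞) * ∫⁻ c, f (c, p) ∂torusLaw κ N := by
  rw [placedLaw, lintegral_finsetSum_measure]
  refine Finset.sum_congr rfl fun p _ => ?_
  rw [lintegral_smul_measure, lintegral_map hf (by fun_prop), smul_eq_mul]

instance (κ : Measure ℝ≥0) [IsProbabilityMeasure κ] (N : ℕ) :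
    IsProbabilityMeasure (torusLaw κ N) := by unfold torusLaw; infer_instance

variable [NeZero N]

theorem sum_inv_sq (N : ℕ) [NeZero N] (a : ℝ≥0∞) :
    ∑ _p : Fin N × Fin N, ((((N : ℝ≥0) ^ 2)⁻¹ : ℝ≥0) : ℝ≥0∞) * a = a := by
  have hN : (N : ℝ≥0) ≠ 0 := by exact_mod_cast NeZero.ne N
  have h : ((N * N : ℕ) : ℝ≥0) * ((N : ℝ≥0) ^ 2)⁻¹ = 1 := by
    push_cast; field_simp
  have h' : ((N * N : ℕ) : ℝ≥0∞) * ((((N : ℝ≥0) ^ 2)⁻¹ : ℝ≥0) : ℝ≥0∞) = 1 := by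
    exact_mod_cast congrArg ENNReal.ofNNReal h
  rw [Finset.sum_const, Finset.card_univ, Fintype.card_prod, Fintype.card_fin, nsmul_eq_mul,
    ← mul_assoc, h', one_mul]

instance (κ : Measure ℝ≥0) [IsProbabilityMeasure κ] : IsProbabilityMeasure (placedLaw κ N) := ⟨by
  rw [← lintegral_one, lintegral_placedLaw κ measurable_const]
  simp only [lintegral_one, measure_univ]
  exact sum_inv_sq N 1⟩

theorem measurable_squareEnv_uncurry (hMN : M + 2 ≤ N) :
    Measurable fun ω : Environment (torus N) × (Fin N × Fin N) =>
      squareEnv (M := M) hMN ω.2 ω.1 :=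
  measurable_from_prod_countable_left fun p => measurable_squareEnv hMN p

theorem map_placedLaw (κ : Measure ℝ≥0) [IsProbabilityMeasure κ] (hMN : M + 2 ≤ N) :
    (placedLaw κ N).map (fun ω => squareEnv (M := M) hMN ω.2 ω.1) = squareLaw κ M := by
  ext s hs
  rw [Measure.map_apply (measurable_squareEnv_uncurry hMN) hs, placedLaw, Measure.finsetSum_apply]
  have : ∀ p : Fin N × Fin N, (((((N : ℝ≥0) ^ 2)⁻¹ : ℝ≥0) : ℝ≥0∞) • (torusLaw κ N).map fun c => (c, p))
      ((fun ω : Environment (torus N) × (Fin N × Fin N) => squareEnv (M := M) hMN ω.2 ω.1) ⁻¹' s) =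
      ((((N : ℝ≥0) ^ 2)⁻¹ : ℝ≥0) : ℝ≥0∞) * squareLaw κ M s := by
    intro p
    rw [Measure.smul_apply, Measure.map_apply (by fun_prop) (measurable_squareEnv_uncurry hMN hs),
      smul_eq_mul, ← map_squareEnv κ hMN p, Measure.map_apply (measurable_squareEnv hMN p) hs]
    rfl
  simp only [this]
  exact sum_inv_sq N _

theorem ae_torusLaw_le {κ : Measure ℝ≥0} [IsProbabilityMeasure κ] {cs : ℝ≥0}
    (hκ : ∀ᵐ t ∂κ, t ≤ cs) (N : ℕ) : ∀ᵐ c ∂torusLaw κ N, ∀ e, c e ≤ cs :=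
  Filter.eventually_all.2 fun e => (Measure.tendsto_eval_ae_ae
    (μ := fun _ : (torus N).edgeSet => κ) (i := e)).eventually hκ

/-- The expected weights of a random flow. -/
def meanWeights (κ : Measure ℝ≥0) (y : Environment (torus N) → SimplePath (torus N) → ℝ≥0)
    (σ : SimplePath (torus N)) : ℝ≥0 := (∫⁻ c, y c σ ∂torusLaw κ N).toNNReal

section Mean

variable {κ : Measure ℝ≥0} [IsProbabilityMeasure κ]
  {y : Environment (torus N) → SimplePath (torus N) → ℝ≥0}

theorem coe_meanWeights (hyT : ∀ c v w, trans (y c) v w = ((N : ℝ≥0) ^ 3)⁻¹)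
    (σ : SimplePath (torus N)) :
    (meanWeights κ y σ : ℝ≥0∞) = ∫⁻ c, y c σ ∂torusLaw κ N := by
  refine ENNReal.coe_toNNReal (ne_top_of_le_ne_top (b := ((N : ℝ≥0) : ℝ≥0∞)) ENNReal.coe_ne_top ?_)
  calc ∫⁻ c, y c σ ∂torusLaw κ N ≤ ∫⁻ _c, ((N : ℝ≥0) : ℝ≥0∞) ∂torusLaw κ N := by
        refine lintegral_mono fun c => ENNReal.coe_le_coe.2 ?_
        rw [← sum_weights (y c) (hyT c)]
        exact Finset.single_le_sum (fun _ _ => zero_le) (Finset.mem_univ σ)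
    _ = _ := by simp

theorem lintegral_sum_mul (hy : Measurable y)
    (hyT : ∀ c v w, trans (y c) v w = ((N : ℝ≥0) ^ 3)⁻¹) (a : SimplePath (torus N) → ℝ≥0) :
    ∫⁻ c, ((∑ σ, y c σ * a σ : ℝ≥0) : ℝ≥0∞) ∂torusLaw κ N =
      ((∑ σ, meanWeights κ y σ * a σ : ℝ≥0) : ℝ≥0∞) := by
  have hm : ∀ σ, Measurable fun c => (y c σ : ℝ≥0∞) := fun σ =>
    ((measurable_pi_apply σ).comp hy).coe_nnreal_ennreal
  push_cast
  rw [lintegral_finsetSum _ fun σ _ => (hm σ).mul_const _]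
  refine Finset.sum_congr rfl fun σ _ => ?_
  rw [lintegral_mul_const _ (hm σ), coe_meanWeights hyT]

theorem trans_meanWeights (hy : Measurable y)
    (hyT : ∀ c v w, trans (y c) v w = ((N : ℝ≥0) ^ 3)⁻¹) (v w : Fin N × Fin N) :
    trans (meanWeights κ y) v w = ((N : ℝ≥0) ^ 3)⁻¹ := by
  have h := lintegral_sum_mul (κ := κ) hy hyT fun σ => if σ.1.ent = v ∧ σ.1.exi = w then 1 else 0
  simp only [← trans_eq_sum_mul, hyT] at h
  rw [lintegral_const, measure_univ, mul_one] at h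
  exact_mod_cast h.symm

end Mean

end RandomPosition

end LatticeFlow

end

noncomputable section

namespace LatticeFlow

open MeasureTheory SimpleGraph

/-! ### Comparison of the square with the torus -/

section Comparison

variable {M N : ℕ} [NeZero M] [NeZero N] {κ : Measure ℝ≥0} [IsProbabilityMeasure κ]
  {y : Environment (torus N) → SimplePath (torus N) → ℝ≥0}

/-- The flow across the square in a random position. -/
def placedFlow (hMN : M + 2 ≤ N) (t₁ t₂ : ℝ≥0)
    (y : Environment (torus N) → SimplePath (torus N) → ℝ≥0)
    (ω : Environment (torus N) × (Fin N × Fin N)) : SimplePath (extSquare M) → ℝ≥0 :=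
  squareFlow hMN t₁ t₂ ω.2 (y ω.1)

theorem measurable_placedFlow (hMN : M + 2 ≤ N) (t₁ t₂ : ℝ≥0) (hy : Measurable y) :
    Measurable (placedFlow (M := M) hMN t₁ t₂ y) :=
  measurable_from_prod_countable_left fun p => (measurable_squareFlow hMN t₁ t₂ p).comp hy

/-- Averaging over the positions turns `pieceTrans` into `totalTrans` divided by `N ^ 2`. The corner
mass reappears unchanged because the mean weights divided by `N` sum to one. -/
theorem lintegral_trans_placedFlow (hMN : M + 2 ≤ N) (t₁ t₂ : ℝ≥0) (hy : Measurable y)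
    (hyT : ∀ c v w, trans (y c) v w = ((N : ℝ≥0) ^ 3)⁻¹) (v w : SqVertex M) :
    Transport.onVertices ((fun r => ∑ σ, meanWeights κ y σ / N * pathTransport hMN σ.1 r) +
        driftMass t₁ t₂ : Transport M) v w =
      ∫⁻ ω, trans (placedFlow hMN t₁ t₂ y ω) v w ∂placedLaw κ N := by
  have hN : (N : ℝ≥0) ≠ 0 := by exact_mod_cast NeZero.ne N
  by_cases h : ∃ b b', v = .inr b ∧ w = .inr b'
  · obtain ⟨b, b', rfl, rfl⟩ := h
    have hm : Measurable fun ω : Environment (torus N) × (Fin N × Fin N) =>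
        (trans (placedFlow hMN t₁ t₂ y ω) (.inr b) (.inr b') : ℝ≥0∞) :=
      ((measurable_trans _ _).comp (measurable_placedFlow hMN t₁ t₂ hy)).coe_nnreal_ennreal
    rw [lintegral_placedLaw κ hm]
    set K : ℝ≥0 := pointMass (corner .right) (corner .right) ((M : ℝ≥0) ^ 2 / N) (b, b') +
      driftMass t₁ t₂ (b, b') with hK
    have h1 : ∀ p, ∫⁻ c, (trans (placedFlow hMN t₁ t₂ y (c, p)) (.inr b) (.inr b') : ℝ≥0∞)
        ∂torusLaw κ N =
        ((∑ σ, meanWeights κ y σ * (pieceTrans hMN p σ.1 b b' : ℝ≥0) + K : ℝ≥0) : ℝ≥0∞) := by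
      intro p
      simp only [placedFlow, trans_squareFlow, ← hK]
      rw [ENNReal.coe_add, ← lintegral_sum_mul hy hyT]
      simp only [ENNReal.coe_add]
      rw [lintegral_add_right _ measurable_const, lintegral_const, measure_univ, mul_one]
    simp only [h1]
    change (((fun r => ∑ σ, meanWeights κ y σ / N * pathTransport hMN σ.1 r) +
        driftMass t₁ t₂ : Transport M) (b, b') : ℝ≥0∞) = _
    have hw := sum_weights _ (trans_meanWeights (κ := κ) hy hyT)
    simp only [← ENNReal.coe_mul, ← ENNReal.ofNNReal_finsetSum]
    congr 1
    have h2 : ∑ p : Fin N × Fin N, ((N : ℝ≥0) ^ 2)⁻¹ *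
        (∑ σ, meanWeights κ y σ * (pieceTrans hMN p σ.1 b b' : ℝ≥0) + K) =
        (∑ σ, meanWeights κ y σ * (totalTrans hMN σ.1 b b' : ℝ≥0)) * ((N : ℝ≥0) ^ 2)⁻¹ + K := by
      simp only [mul_add, Finset.sum_add_distrib, totalTrans, Nat.cast_sum, Finset.mul_sum,
        Finset.sum_mul]
      congr 1
      · rw [Finset.sum_comm]
        refine Finset.sum_congr rfl fun σ _ => Finset.sum_congr rfl fun p _ => ?_
        ring
      · rw [Finset.sum_const, Finset.card_univ, Fintype.card_prod, Fintype.card_fin, nsmul_eq_mul]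
        push_cast
        field_simp
    rw [h2, hK, ← add_assoc]
    simp only [Pi.add_apply, pathTransport, mul_add, Finset.sum_add_distrib]
    congr 1
    congr 1
    · rw [Finset.sum_mul]
      refine Finset.sum_congr rfl fun σ _ => ?_
      field_simp
    · rw [← Finset.sum_mul, ← Finset.sum_div, hw, div_self hN, one_mul]
  · push Not at h
    have h' : ∀ b b', ¬ (v = .inr b ∧ w = .inr b') := fun b b' hb => h b b' hb.1 hb.2
    have h0 : ∀ ω, trans (placedFlow hMN t₁ t₂ y ω) v w = 0 := fun ω =>
      trans_squareFlow_eq_zero hMN t₁ t₂ ω.2 (y ω.1) h'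
    simp only [h0, ENNReal.coe_zero, lintegral_zero]
    rcases v with q | b <;> rcases w with q' | b'
    · rfl
    · rfl
    · rfl
    · exact absurd ⟨rfl, rfl⟩ (h' b b')

/-- At each position the cost is that of the torus flow on the edges of the square, plus the price
of the volume corrections. The mean over the `N ^ 2` positions is then given by `sum_placeEdge_le`.
-/
theorem lintegral_nncost_placedFlow_le (hN : 3 ≤ N) (hMN : M + 2 ≤ N) {t₁ t₂ B cs : ℝ≥0}
    (ht₁ : t₁ ≤ (N : ℝ≥0)⁻¹) (ht₂ : t₂ ≤ (N : ℝ≥0)⁻¹) (hκ : ∀ᵐ t ∂κ, t ≤ cs) (hy : Measurable y)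
    (hyT : ∀ c v w, trans (y c) v w = ((N : ℝ≥0) ^ 3)⁻¹) (hyB : ∀ c e, vol (y c) e ≤ B) :
    ∫⁻ ω, nncost (vol (placedFlow (M := M) hMN t₁ t₂ y ω)) (squareEnv hMN ω.2 ω.1)
        ∂placedLaw κ N ≤
      (((M : ℝ≥0) ^ 2 / (N : ℝ≥0) ^ 2 : ℝ≥0) : ℝ≥0∞) *
        ∫⁻ c, nncost (vol (y c)) c ∂torusLaw κ N +
      ((cs * Fintype.card (extSquare M).edgeSet * (2 * B * (5 * ((M : ℝ≥0) ^ 2 / N)) +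
        (5 * ((M : ℝ≥0) ^ 2 / N)) ^ 2) : ℝ≥0) : ℝ≥0∞) := by
  classical
  set D : ℝ≥0 := cs * Fintype.card (extSquare M).edgeSet * (2 * B * (5 * ((M : ℝ≥0) ^ 2 / N)) +
        (5 * ((M : ℝ≥0) ^ 2 / N)) ^ 2) with hD
  have hvolm : ∀ e, Measurable fun ω => vol (placedFlow (M := M) hMN t₁ t₂ y ω) e := fun e =>
    (measurable_vol e).comp (measurable_placedFlow hMN t₁ t₂ hy)
  have henvm : ∀ e, Measurable fun ω : Environment (torus N) × (Fin N × Fin N) =>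
      squareEnv (M := M) hMN ω.2 ω.1 e := fun e =>
    (measurable_pi_apply e).comp (measurable_squareEnv_uncurry hMN)
  have hm : Measurable fun ω : Environment (torus N) × (Fin N × Fin N) =>
      (nncost (vol (placedFlow (M := M) hMN t₁ t₂ y ω)) (squareEnv hMN ω.2 ω.1) : ℝ≥0∞) := by
    unfold nncost
    fun_prop
  have hvy : ∀ e, Measurable fun c => vol (y c) e := fun e => (measurable_vol e).comp hy
  let F : Environment (torus N) → (torus N).edgeSet → ℝ≥0 := fun c e => c e * vol (y c) e ^ 2
  have hF : ∀ e, Measurable fun c => F c e := fun e => by fun_prop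
  let f : (Fin N × Fin N) → Environment (torus N) → ℝ≥0 := fun p c =>
    ∑ e : (extSquare M).edgeSet, if IsRightTop e then 0 else F c (placeEdge hMN p e)
  have hf : ∀ p, Measurable (f p) := fun p => by
    refine Finset.measurable_fun_sum _ fun e _ => ?_
    split_ifs
    · exact measurable_const
    · exact hF _
  have h1 : ∀ p, ∫⁻ c, (nncost (vol (placedFlow (M := M) hMN t₁ t₂ y (c, p)))
      (squareEnv hMN p c) : ℝ≥0∞) ∂torusLaw κ N ≤ ∫⁻ c, (f p c : ℝ≥0∞) ∂torusLaw κ N + D := by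
    intro p
    have h2 : ∀ᵐ c ∂torusLaw κ N, (nncost (vol (placedFlow (M := M) hMN t₁ t₂ y (c, p)))
        (squareEnv hMN p c) : ℝ≥0∞) ≤ (f p c : ℝ≥0∞) + D := by
      filter_upwards [ae_torusLaw_le hκ N] with c hc
      rw [← ENNReal.coe_add, ENNReal.coe_le_coe]
      have h3 := nncost_le_of_le_add (f := fun e => vol (y c) (placeEdge hMN p e))
        (f' := vol (placedFlow (M := M) hMN t₁ t₂ y (c, p))) (c := squareEnv hMN p c) (cs := cs)
        (fun e => hyB c _) (vol_squareFlow_le hMN p (hyT c) ht₁ ht₂) fun e => by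
          unfold squareEnv
          split_ifs
          · exact zero_le
          · exact hc _
      refine h3.trans (le_of_eq ?_)
      congr 1
      refine Finset.sum_congr rfl fun e _ => ?_
      simp only [squareEnv, F]
      split_ifs <;> simp
    refine (lintegral_mono_ae h2).trans (le_of_eq ?_)
    rw [lintegral_add_right _ measurable_const, lintegral_const, measure_univ, mul_one]
  rw [lintegral_placedLaw κ hm]
  calc _ ≤ ∑ p, ((((N : ℝ≥0) ^ 2)⁻¹ : ℝ≥0) : ℝ≥0∞) *
        (∫⁻ c, (f p c : ℝ≥0∞) ∂torusLaw κ N + D) := by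
        gcongr with p
        exact h1 p
    _ = ((((N : ℝ≥0) ^ 2)⁻¹ : ℝ≥0) : ℝ≥0∞) * ∫⁻ c, ((∑ p, f p c : ℝ≥0) : ℝ≥0∞) ∂torusLaw κ N +
        D := by
        simp only [mul_add, Finset.sum_add_distrib, sum_inv_sq N, ← Finset.mul_sum]
        congr 2
        simp only [ENNReal.ofNNReal_finsetSum]
        rw [lintegral_finsetSum _ fun p _ => (hf p).coe_nnreal_ennreal]
    _ ≤ ((((N : ℝ≥0) ^ 2)⁻¹ : ℝ≥0) : ℝ≥0∞) *
        ∫⁻ c, (((M : ℝ≥0) ^ 2 : ℝ≥0) : ℝ≥0∞) * (nncost (vol (y c)) c : ℝ≥0∞) ∂torusLaw κ N + D := by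
        gcongr with c
        rw [← ENNReal.coe_mul, ENNReal.coe_le_coe]
        exact sum_placeEdge_le hN hMN (F c)
    _ = _ := by
        rw [lintegral_const_mul, ← mul_assoc, ← ENNReal.coe_mul]
        · congr 3
          rw [div_eq_mul_inv, mul_comm]
        · unfold nncost
          fun_prop

theorem card_sqVertex (M : ℕ) : Fintype.card (SqVertex M) = M * M + 4 * M := by
  have hside : Fintype.card Side = 4 := rfl
  simp [hside]

/-- Upper bound for `c_{M,B₂}` by the cost in a large torus. -/
theorem cInf_le (hN : 3 ≤ N) (hMN : M + 2 ≤ N) {B cs : ℝ≥0} (hκ : ∀ᵐ t ∂κ, t ≤ cs) (hB : 0 < B)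
    (hfin : expTorusCost κ N B ≠ ∞) {η : ℝ≥0} (hη : 0 < η) {B₁ ξ B₂ : ℝ≥0}
    (hB₁ : B + 5 * ((M : ℝ≥0) ^ 2 / N) ≤ B₁) (hξB : ξ ≤ 2 * B₁)
    {n : ℕ} (hn : 0 < n) {l : ℝ} (hl : 0 < l)
    (hB₂ : (B₁ + ξ : ℝ) + Fintype.card (extSquare M).edgeSet *
      Real.exp (-((ξ : ℝ) ^ 2 * n / (4 * B₁ * ((4 * B + 4) * M : ℝ≥0)))) *
        ((4 * B + 4) * M : ℝ≥0) ≤ B₂) :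
    cInf κ M B₂ ≤ (((M : ℝ≥0) ^ 2 / (N : ℝ≥0) ^ 2 : ℝ≥0) : ℝ≥0∞) * (expTorusCost κ N B + η) +
      ((cs * Fintype.card (extSquare M).edgeSet * (2 * B * (5 * ((M : ℝ≥0) ^ 2 / N)) +
        (5 * ((M : ℝ≥0) ^ 2 / N)) ^ 2) : ℝ≥0) : ℝ≥0∞) +
      ENNReal.ofReal (decoupleError cs B₁ ((4 * B + 4) * M : ℝ≥0) ξ
        (Fintype.card (extSquare M).edgeSet) (Fintype.card (SqVertex M)) l n) := by
  classical
  have hN0 : (N : ℝ≥0) ≠ 0 := by exact_mod_cast NeZero.ne N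
  have hM0 : (0 : ℝ≥0) < M := by exact_mod_cast Nat.pos_of_ne_zero (NeZero.ne M)
  have hT : ((N : ℝ≥0∞) ^ 3)⁻¹ = ((((N : ℝ≥0) ^ 3)⁻¹ : ℝ≥0) : ℝ≥0∞) := by
    rw [ENNReal.coe_inv (pow_ne_zero _ hN0)]
    push_cast
    rfl
  -- Finite expectation gives one feasible environment, and feasibility does not depend on the
  -- environment.
  obtain ⟨c₀, hc₀⟩ : ∃ c : Environment (torus N),
      minCost (fun _ _ => ((N : ℝ≥0∞) ^ 3)⁻¹) B c ≠ ∞ := by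
    by_contra hcon
    push Not at hcon
    apply hfin
    rw [expTorusCost]
    simp only [torusCost, hcon]
    rw [lintegral_const, measure_univ, mul_one]
  obtain ⟨y, hy, hyall⟩ := exists_measurable_weights (G := torus N) _ B
    (fun c => minCost_ne_top_of_ne_top (c' := c) hc₀) hη
  have hyT : ∀ c v w, trans (y c) v w = ((N : ℝ≥0) ^ 3)⁻¹ := fun c v w => by
    have := (hyall c).1 v w
    rw [hT] at this
    exact_mod_cast this
  have hyB : ∀ c e, vol (y c) e ≤ B := fun c => (hyall c).2.1
  obtain ⟨t₁, t₂, ht₁, ht₂, hiso⟩ := exists_isIsotropic (M := M) hN hMN (meanWeights κ y)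
    (trans_meanWeights hy hyT)
  refine (iInf₂_le _ hiso).trans ?_
  have hprob : ∀ e : (extSquare M).edgeSet,
      IsProbabilityMeasure (if IsRightTop e then Measure.dirac 0 else κ) := fun e => by
    split_ifs <;> infer_instance
  have hae : ∀ e : (extSquare M).edgeSet,
      ∀ᵐ t ∂(if IsRightTop e then Measure.dirac 0 else κ), t ≤ cs := fun e => by
    split_ifs
    · rw [ae_dirac_eq, Filter.eventually_pure]; exact zero_le
    · exact hκ
  -- The randomness `ω` consists of the torus environment and the position; the environment seen in
  -- the square has the law `squareLaw κ M`.
  have key := lintegral_minCost_expectation_le (G := extSquare M) (placedLaw κ N) cs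
    (fun e => if IsRightTop e then Measure.dirac 0 else κ) hae
    (fun ω => squareEnv hMN ω.2 ω.1) (measurable_squareEnv_uncurry hMN) (map_placedLaw κ hMN)
    (placedFlow hMN t₁ t₂ y) (measurable_placedFlow hMN t₁ t₂ hy)
    (m := (4 * B + 4) * M) (B := B₁) (ξ := ξ) (B₂ := B₂) (by positivity)
    (hB.trans_le (le_self_add.trans hB₁))
    (fun ω => sum_squareFlow_le hMN ω.2 (hyT ω.1) (hyB ω.1) ht₁ ht₂)
    (fun ω e => (vol_squareFlow_le hMN ω.2 (hyT ω.1) ht₁ ht₂ e).trans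
      ((add_le_add_left (hyB ω.1 _) _).trans hB₁)) hξB hn hl _
    (lintegral_trans_placedFlow hMN t₁ t₂ hy hyT) hB₂
  refine key.trans ?_
  gcongr
  refine (lintegral_nncost_placedFlow_le hN hMN ht₁ ht₂ hκ hy hyT hyB).trans ?_
  gcongr
  calc ∫⁻ c, (nncost (vol (y c)) c : ℝ≥0∞) ∂torusLaw κ N
      ≤ ∫⁻ c, (torusCost N B c + η) ∂torusLaw κ N := lintegral_mono fun c => (hyall c).2.2
    _ = _ := by
        rw [lintegral_add_right _ measurable_const, lintegral_const, measure_univ, mul_one]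
        rfl

end Comparison

end LatticeFlow

end

noncomputable section

namespace LatticeFlow

open MeasureTheory SimpleGraph Filter Topology

/-! ### Asymptotics of the error terms -/

section Asymptotics

theorem tendsto_natSqrt : Tendsto Nat.sqrt atTop atTop :=
  tendsto_atTop.2 fun b => (eventually_ge_atTop (b * b)).mono fun _ h => Nat.le_sqrt.2 h

theorem cast_le_four_mul_sqrt_sq {M : ℕ} (hM : 0 < M) : (M : ℝ) ≤ 4 * (Nat.sqrt M : ℝ) ^ 2 := by
  have h1 := Nat.lt_succ_sqrt M
  have h2 : 1 ≤ Nat.sqrt M := Nat.le_sqrt.2 (by omega)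
  have h3 : M ≤ 4 * Nat.sqrt M ^ 2 := by
    simp only [Nat.succ_eq_add_one] at h1
    nlinarith
  exact_mod_cast h3

theorem tendsto_pow_mul_exp_sqrt {a : ℝ} (ha : 0 < a) :
    Tendsto (fun M : ℕ => (M : ℝ) ^ 4 * Real.exp (-(a * Nat.sqrt M))) atTop (𝓝 0) := by
  have h1 := ((tendsto_pow_const_mul_const_pow_of_lt_one 8 (Real.exp_nonneg (-a))
    (Real.exp_lt_one_iff.2 (neg_lt_zero.2 ha))).comp tendsto_natSqrt).const_mul (4 ^ 4 : ℝ)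
  rw [mul_zero] at h1
  refine squeeze_zero' (Eventually.of_forall fun M => by positivity) ?_ h1
  filter_upwards [eventually_gt_atTop 0] with M hM
  have h2 : Real.exp (-a) ^ Nat.sqrt M = Real.exp (-(a * Nat.sqrt M)) := by
    rw [← Real.exp_nat_mul]
    congr 1
    ring
  simp only [Function.comp_apply, h2]
  calc (M : ℝ) ^ 4 * Real.exp (-(a * Nat.sqrt M))
      ≤ (4 * (Nat.sqrt M : ℝ) ^ 2) ^ 4 * Real.exp (-(a * Nat.sqrt M)) := by
        gcongr
        exact cast_le_four_mul_sqrt_sq hM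
    _ = _ := by ring

/-- This is the logarithm of the number of end point samples for `n = M * Nat.sqrt M`, relative to
`M ^ 2`; the factor 26 comes from `(5 * M ^ 2) ^ 2 + 1 ≤ 26 * M ^ 4`. -/
theorem tendsto_log_mul_sqrt_div :
    Tendsto (fun M : ℕ => Real.log (26 * (M : ℝ) ^ 4) * Nat.sqrt M / M) atTop (𝓝 0) := by
  have h0 : Tendsto (fun s : ℝ => (Real.log (26 * 4 ^ 4) + 8 * Real.log s) / s) atTop (𝓝 0) := by
    have h1 := (Real.isLittleO_log_id_atTop.tendsto_div_nhds_zero).const_mul 8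
    have h2 := tendsto_inv_atTop_zero.const_mul (Real.log (26 * 4 ^ 4))
    have h3 := h2.add h1
    simp only [mul_zero, add_zero] at h3
    refine h3.congr fun s => ?_
    simp only [id]
    ring
  have h1 := h0.comp (tendsto_natCast_atTop_atTop.comp tendsto_natSqrt)
  refine squeeze_zero' ?_ ?_ h1
  · filter_upwards [eventually_gt_atTop 0] with M hM
    have : (1 : ℝ) ≤ M := by exact_mod_cast hM
    have : (1 : ℝ) ≤ 26 * (M : ℝ) ^ 4 := by nlinarith [one_le_pow₀ this (n := 4)]
    have := Real.log_nonneg this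
    positivity
  · filter_upwards [eventually_gt_atTop 0] with M hM
    have hM' : (0 : ℝ) < M := by exact_mod_cast hM
    have hs : (0 : ℝ) < Nat.sqrt M := by exact_mod_cast Nat.sqrt_pos.2 hM
    have hs2 : (Nat.sqrt M : ℝ) ^ 2 ≤ M := by exact_mod_cast Nat.sqrt_le' M
    have h2 : Real.log (26 * (M : ℝ) ^ 4) ≤ Real.log (26 * 4 ^ 4) + 8 * Real.log (Nat.sqrt M) := by
      calc Real.log (26 * (M : ℝ) ^ 4) ≤ Real.log (26 * (4 * (Nat.sqrt M : ℝ) ^ 2) ^ 4) := by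
            gcongr
            exact cast_le_four_mul_sqrt_sq hM
        _ = Real.log (26 * 4 ^ 4 * (Nat.sqrt M : ℝ) ^ 8) := by ring_nf
        _ = _ := by
            rw [Real.log_mul (by positivity) (by positivity), Real.log_pow]
            push_cast
            ring
    have h3 : 0 ≤ Real.log (26 * 4 ^ 4) + 8 * Real.log (Nat.sqrt M) := by
      have h4 : (1 : ℝ) ≤ Nat.sqrt M := by exact_mod_cast Nat.sqrt_pos.2 hM
      have := Real.log_nonneg h4
      have := Real.log_nonneg (by norm_num : (1 : ℝ) ≤ 26 * 4 ^ 4)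
      positivity
    simp only [Function.comp_apply]
    rw [div_le_div_iff₀ hM' hs]
    calc Real.log (26 * (M : ℝ) ^ 4) * Nat.sqrt M * Nat.sqrt M
        = Real.log (26 * (M : ℝ) ^ 4) * (Nat.sqrt M : ℝ) ^ 2 := by ring
      _ ≤ (Real.log (26 * 4 ^ 4) + 8 * Real.log (Nat.sqrt M)) * M := by gcongr

/-- With a suitable choice of the parameters, the error of decoupling is small compared with the
area. -/
theorem exists_decoupleError_le {cs B C b ε : ℝ} (hcs : 0 ≤ cs) (hB : 0 < B) (hC : 0 < C)
    (hb : 0 < b) (hε : 0 < ε) : ∃ ξ l : ℝ, 0 < ξ ∧ ξ ≤ b ∧ 0 < l ∧ ∀ᶠ M : ℕ in atTop,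
      ∀ E v : ℝ, 0 ≤ E → E ≤ 6 * (M : ℝ) ^ 2 → 0 ≤ v → v ≤ 5 * (M : ℝ) ^ 2 →
        E * Real.exp (-(ξ ^ 2 * (M * Nat.sqrt M : ℕ) / (4 * B * (C * M)))) * (C * M) ≤ b ∧
        decoupleError cs B (C * M) ξ E v l (M * Nat.sqrt M) ≤ ε * (M : ℝ) ^ 2 := by
  -- `ξ` and `l` do not depend on `M`: two of the error terms are proportional to the area, and
  -- small `ξ` and `l` make their factors small. The other terms are `o(M ^ 2)` for fixed `ξ` and
  -- `l`.
  set ξ : ℝ := min b (min 1 (ε / 5 / (6 * cs * (2 * B + 1) + 1))) with hξdef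
  have hden : 0 < 6 * cs * (2 * B + 1) + 1 := by positivity
  have hξ : 0 < ξ := lt_min hb (lt_min one_pos (by positivity))
  have hξ1 : ξ ≤ 1 := (min_le_right _ _).trans (min_le_left _ _)
  have hξε : 6 * cs * (2 * B * ξ + ξ ^ 2) ≤ ε / 5 := by
    have h1 : ξ ≤ ε / 5 / (6 * cs * (2 * B + 1) + 1) := (min_le_right _ _).trans (min_le_right _ _)
    rw [le_div_iff₀ hden] at h1
    have h2 : ξ ^ 2 ≤ ξ := by nlinarith
    calc 6 * cs * (2 * B * ξ + ξ ^ 2) ≤ 6 * cs * (2 * B * ξ + ξ) := by gcongr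
      _ ≤ ξ * (6 * cs * (2 * B + 1) + 1) := by nlinarith
      _ ≤ _ := h1
  set K : ℝ := (cs * (B + ξ) ^ 2) ^ 2 with hK
  have hK0 : 0 ≤ K := by positivity
  set l : ℝ := ε / 5 / (3 * K + 1) with hldef
  have hl : 0 < l := by positivity
  have hlε : 3 * K * l ≤ ε / 5 := by
    have : l * (3 * K + 1) = ε / 5 := div_mul_cancel₀ _ (by positivity)
    nlinarith
  refine ⟨ξ, l, hξ, min_le_left _ _, hl, ?_⟩
  set a : ℝ := ξ ^ 2 / (4 * B * C) with ha
  have ha0 : 0 < a := by positivity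
  have hX := tendsto_pow_mul_exp_sqrt ha0
  have hX1 := (hX.const_mul (6 * C)).eventually_le_const (u := b) (by simpa using hb)
  have hX2 := (hX.const_mul (36 * cs * C ^ 2)).eventually_le_const (u := ε / 5)
    (by rw [mul_zero]; positivity)
  have hY := (tendsto_log_mul_sqrt_div.const_mul (1 / l)).eventually_le_const (u := ε / 5)
    (by rw [mul_zero]; positivity)
  have hZ := (tendsto_one_div_atTop_nhds_zero_nat.const_mul (1 / l)).eventually_le_const
    (u := ε / 5) (by rw [mul_zero]; positivity)
  filter_upwards [hX1, hX2, hY, hZ, eventually_gt_atTop 0] with M hX1 hX2 hY hZ hM E v hE0 hE hv0 hv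
  have hM0 : (0 : ℝ) < M := by exact_mod_cast hM
  have hM1 : (1 : ℝ) ≤ M := by exact_mod_cast hM
  have hexp : ξ ^ 2 * (M * Nat.sqrt M : ℕ) / (4 * B * (C * M)) = a * Nat.sqrt M := by
    rw [ha]
    push_cast
    field_simp
  set X : ℝ := Real.exp (-(a * Nat.sqrt M)) with hXdef
  have hX0 : 0 < X := Real.exp_pos _
  rw [hexp]
  refine ⟨?_, ?_⟩
  · calc E * X * (C * M) ≤ 6 * (M : ℝ) ^ 2 * X * (C * M) := by gcongr
      _ = 6 * C * ((M : ℝ) ^ 3 * X) := by ring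
      _ ≤ 6 * C * ((M : ℝ) ^ 4 * X) := by
          gcongr
          · norm_num
      _ ≤ b := hX1
  · rw [decoupleError, hexp, ← hXdef, ← hK]
    have hv1 : v ^ 2 + 1 ≤ 26 * (M : ℝ) ^ 4 := by
      have h1 : v ^ 2 ≤ (5 * (M : ℝ) ^ 2) ^ 2 := by gcongr
      have h2 : (1 : ℝ) ≤ (M : ℝ) ^ 4 := one_le_pow₀ hM1
      nlinarith
    have hlog : Real.log ((v ^ 2 + 1) ^ (M * Nat.sqrt M)) / l ≤ ε / 5 * (M : ℝ) ^ 2 := by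
      rw [Real.log_pow]
      calc ((M * Nat.sqrt M : ℕ) : ℝ) * Real.log (v ^ 2 + 1) / l
          ≤ ((M * Nat.sqrt M : ℕ) : ℝ) * Real.log (26 * (M : ℝ) ^ 4) / l := by
            gcongr
        _ = 1 / l * (Real.log (26 * (M : ℝ) ^ 4) * Nat.sqrt M / M) * (M : ℝ) ^ 2 := by
            push_cast
            field_simp
        _ ≤ _ := by gcongr
    have h1 : cs * E * (2 * B * ξ + ξ ^ 2) ≤ ε / 5 * (M : ℝ) ^ 2 := by
      calc cs * E * (2 * B * ξ + ξ ^ 2) ≤ cs * (6 * (M : ℝ) ^ 2) * (2 * B * ξ + ξ ^ 2) := by gcongr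
        _ = 6 * cs * (2 * B * ξ + ξ ^ 2) * (M : ℝ) ^ 2 := by ring
        _ ≤ _ := by gcongr
    have h2 : E * (l ^ 2 * K / 2) / l ≤ ε / 5 * (M : ℝ) ^ 2 := by
      calc E * (l ^ 2 * K / 2) / l ≤ 6 * (M : ℝ) ^ 2 * (l ^ 2 * K / 2) / l := by gcongr
        _ = 3 * K * l * (M : ℝ) ^ 2 := by field_simp; ring
        _ ≤ _ := by gcongr
    have h3 : 1 / l ≤ ε / 5 * (M : ℝ) ^ 2 := by
      calc 1 / l = 1 / l * (1 / M) * M := by field_simp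
        _ ≤ ε / 5 * M := by gcongr
        _ ≤ ε / 5 * (M : ℝ) ^ 2 := by
            gcongr
            nlinarith
    have h4 : E * X * (cs * E * (C * M) ^ 2) ≤ ε / 5 * (M : ℝ) ^ 2 := by
      calc E * X * (cs * E * (C * M) ^ 2)
          ≤ 6 * (M : ℝ) ^ 2 * X * (cs * (6 * (M : ℝ) ^ 2) * (C * M) ^ 2) := by gcongr
        _ = 36 * cs * C ^ 2 * ((M : ℝ) ^ 4 * X) * (M : ℝ) ^ 2 := by ring
        _ ≤ _ := by gcongr
    rw [add_div]
    linarith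

end Asymptotics

end LatticeFlow

end

noncomputable section

namespace LatticeFlow

open MeasureTheory SimpleGraph Filter Topology

/-! ### Passage to the limit. -/

section Limit

variable {κ : Measure ℝ≥0} [IsProbabilityMeasure κ]

/-- For each large `M`, a suitable `N` may be taken as large as one likes, so all errors that vanish
as `N` grows are controlled first and only the decoupling error restricts `M`. -/
theorem eventually_cInf_le {cs : ℝ≥0} (hκ : ∀ᵐ t ∂κ, t ≤ cs) {B B'' : ℝ≥0} (hB : 0 < B)
    (hB'' : B < B'') {γ : ℝ≥0∞} (hγ : ∃ᶠ N : ℕ in atTop, expTorusCost κ N B / (N : ℝ≥0∞) ^ 2 < γ)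
    (hγ_top : γ ≠ ∞) {ε : ℝ≥0} (hε : 0 < ε) :
    ∀ᶠ M : ℕ in atTop, cInf κ M B'' / (M : ℝ≥0∞) ^ 2 ≤ γ + (3 * ε : ℝ≥0) := by
  -- The spare capacity is divided into thirds: boundary corrections, the sampling error `ξ`, and
  -- the bad samples.
  set δ : ℝ≥0 := B'' - B with hδdef
  have hδ : 0 < δ := tsub_pos_of_lt hB''
  have hδB : B + δ = B'' := add_tsub_cancel_of_le hB''.le
  set B₁ : ℝ≥0 := B + δ / 3 with hB₁
  have hB₁0 : 0 < B₁ := by positivity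
  obtain ⟨ξ, l, hξ, hξb, hl, hev⟩ := exists_decoupleError_le (cs := cs) (B := B₁)
    (C := (4 * B + 4 : ℝ≥0)) (b := min (δ / 3) B₁) (ε := ε) cs.2 hB₁0
    (NNReal.coe_pos.2 (by positivity)) (lt_min (by positivity) hB₁0) hε
  lift ξ to ℝ≥0 using hξ.le
  have hinv : Tendsto (fun M : ℕ => (1 : ℝ≥0) / M) atTop (𝓝 0) := by
    rw [← NNReal.tendsto_coe]
    simpa using tendsto_one_div_atTop_nhds_zero_nat (𝕜 := ℝ)
  have h1 := hinv.eventually_le_const (u := δ / 3) (by positivity)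
  have h2 : ∀ᶠ M : ℕ in atTop, 6 * cs * (2 * B * (1 / M) + (1 / (M : ℝ≥0)) ^ 2) ≤ ε := by
    have := (((hinv.const_mul (2 * B)).add (hinv.pow 2)).const_mul (6 * cs)).eventually_le_const
      (u := ε) (by simpa using hε)
    exact this
  filter_upwards [hev, h1, h2, eventually_gt_atTop 0] with M hdec h1 h2 hM
  -- The summand `5 * M ^ 3` makes the volume corrections `5 * M ^ 2 / N` at most `1 / M`.
  obtain ⟨N, hNγ, hNM⟩ := (hγ.and_eventually
    (eventually_ge_atTop (3 + (M + 2) + 5 * M ^ 3))).exists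
  have hN3 : 3 ≤ N := by omega
  have hMN : M + 2 ≤ N := by omega
  have : NeZero M := ⟨hM.ne'⟩
  have : NeZero N := ⟨by omega⟩
  have hM0 : (0 : ℝ≥0) < M := by exact_mod_cast hM
  have hN0 : (0 : ℝ≥0) < N := by exact_mod_cast (by omega : 0 < N)
  have hMtop : ((M : ℝ≥0∞) ^ 2) = (((M : ℝ≥0) ^ 2 : ℝ≥0) : ℝ≥0∞) := by push_cast; rfl
  have hNtop : ((N : ℝ≥0∞) ^ 2) = (((N : ℝ≥0) ^ 2 : ℝ≥0) : ℝ≥0∞) := by push_cast; rfl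
  have hr : 5 * ((M : ℝ≥0) ^ 2 / N) ≤ 1 / M := by
    rw [← mul_div_assoc, div_le_div_iff₀ hN0 hM0]
    have : 5 * M ^ 2 * M ≤ 1 * N := by nlinarith
    exact_mod_cast this
  have hE : Fintype.card (extSquare M).edgeSet ≤ 6 * M ^ 2 := card_edgeSet_le hM
  have hv : Fintype.card (SqVertex M) ≤ 5 * M ^ 2 := by rw [card_sqVertex]; nlinarith
  obtain ⟨hcap, herr⟩ := hdec (Fintype.card (extSquare M).edgeSet) (Fintype.card (SqVertex M))
    (by positivity) (by exact_mod_cast hE) (by positivity) (by exact_mod_cast hv)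
  have hexp : expTorusCost κ N B ≤ γ * (N : ℝ≥0∞) ^ 2 := by
    rw [hNtop] at hNγ ⊢
    exact (ENNReal.div_le_iff (by simpa using hN0.ne') ENNReal.coe_ne_top).1 hNγ.le
  have hfin : expTorusCost κ N B ≠ ∞ := by
    refine ne_top_of_le_ne_top ?_ hexp
    rw [hNtop]
    exact ENNReal.mul_ne_top hγ_top ENNReal.coe_ne_top
  have hs : 0 < Nat.sqrt M := Nat.sqrt_pos.2 hM
  have key := cInf_le (κ := κ) (M := M) (N := N) hN3 hMN hκ hB hfin hε (B₁ := B₁) (ξ := ξ)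
    (B₂ := B'') (add_le_add_right (hr.trans h1) B)
    (by
      have h3 : (ξ : ℝ) ≤ B₁ := hξb.trans (min_le_right _ _)
      have h4 : ξ ≤ B₁ := by exact_mod_cast h3
      exact h4.trans (by rw [two_mul]; exact le_self_add))
    (n := M * Nat.sqrt M) (by positivity) hl (by
      have h3 : (ξ : ℝ) ≤ δ / 3 := hξb.trans (min_le_left _ _)
      have h4 := hcap.trans (min_le_left _ _)
      have h5 : (B₁ : ℝ) = B + δ / 3 := by rw [hB₁]; push_cast; rfl
      have h6 : (B'' : ℝ) = B + δ := by rw [← hδB]; push_cast; rfl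
      rw [NNReal.coe_mul, NNReal.coe_natCast, h6]
      linarith)
  refine ENNReal.div_le_of_le_mul (key.trans ?_)
  have t1 : (((M : ℝ≥0) ^ 2 / (N : ℝ≥0) ^ 2 : ℝ≥0) : ℝ≥0∞) * (expTorusCost κ N B + ε) ≤
      (γ + ε) * (M : ℝ≥0∞) ^ 2 := by
    calc (((M : ℝ≥0) ^ 2 / (N : ℝ≥0) ^ 2 : ℝ≥0) : ℝ≥0∞) * (expTorusCost κ N B + ε)
        ≤ (((M : ℝ≥0) ^ 2 / (N : ℝ≥0) ^ 2 : ℝ≥0) : ℝ≥0∞) * ((γ + ε) * (N : ℝ≥0∞) ^ 2) := by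
          gcongr
          rw [add_mul]
          gcongr
          refine le_mul_of_one_le_right zero_le ?_
          exact_mod_cast one_le_pow₀ (by omega : 1 ≤ N)
      _ = (γ + ε) * ((((M : ℝ≥0) ^ 2 / (N : ℝ≥0) ^ 2 : ℝ≥0) : ℝ≥0∞) * (N : ℝ≥0∞) ^ 2) := by ring
      _ = _ := by
          rw [hNtop, hMtop, ← ENNReal.coe_mul, div_mul_cancel₀ _ (pow_pos hN0 2).ne']
  have t2 : ((cs * Fintype.card (extSquare M).edgeSet * (2 * B * (5 * ((M : ℝ≥0) ^ 2 / N)) +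
      (5 * ((M : ℝ≥0) ^ 2 / N)) ^ 2) : ℝ≥0) : ℝ≥0∞) ≤ ε * (M : ℝ≥0∞) ^ 2 := by
    rw [hMtop, ← ENNReal.coe_mul, ENNReal.coe_le_coe]
    have hE' : (Fintype.card (extSquare M).edgeSet : ℝ≥0) ≤ 6 * (M : ℝ≥0) ^ 2 := by
      exact_mod_cast hE
    calc _ ≤ cs * (6 * (M : ℝ≥0) ^ 2) * (2 * B * (1 / M) + (1 / (M : ℝ≥0)) ^ 2) := by gcongr
      _ = 6 * cs * (2 * B * (1 / M) + (1 / (M : ℝ≥0)) ^ 2) * (M : ℝ≥0) ^ 2 := by ring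
      _ ≤ _ := by gcongr
  have t3 : ENNReal.ofReal (decoupleError cs B₁ ((4 * B + 4) * M : ℝ≥0) ξ
      (Fintype.card (extSquare M).edgeSet) (Fintype.card (SqVertex M)) l (M * Nat.sqrt M)) ≤
      ε * (M : ℝ≥0∞) ^ 2 := by
    rw [NNReal.coe_mul, NNReal.coe_natCast]
    refine (ENNReal.ofReal_le_ofReal herr).trans (le_of_eq ?_)
    rw [hMtop, ← ENNReal.coe_mul, ← ENNReal.ofReal_coe_nnreal]
    push_cast
    rfl
  calc _ ≤ (γ + ε) * (M : ℝ≥0∞) ^ 2 + ε * (M : ℝ≥0∞) ^ 2 + ε * (M : ℝ≥0∞) ^ 2 := by gcongr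
    _ = _ := by
        push_cast
        ring

/-- The limiting cost in the torus is an upper bound for the limiting cost in the square with a
slightly larger capacity. -/
theorem limsup_cInf_le_liminf_expTorusCost {cs : ℝ≥0} (hκ : ∀ᵐ t ∂κ, t ≤ cs) {B B'' : ℝ≥0}
    (hB : 0 < B) (hB'' : B < B'') :
    limsup (fun M : ℕ => cInf κ M B'' / (M : ℝ≥0∞) ^ 2) atTop ≤
      liminf (fun N : ℕ => expTorusCost κ N B / (N : ℝ≥0∞) ^ 2) atTop := by
  refine ENNReal.le_of_forall_pos_le_add fun ε hε hfin => ?_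
  set γ := Filter.liminf (fun N : ℕ => expTorusCost κ N B / (N : ℝ≥0∞) ^ 2) atTop
  -- One quarter is the distance to the lower limit, the other three are the error terms of
  -- `eventually_cInf_le`.
  have hε' : 0 < ε / 4 := by positivity
  have hfreq : ∃ᶠ N : ℕ in atTop, expTorusCost κ N B / (N : ℝ≥0∞) ^ 2 < γ + (ε / 4 : ℝ≥0) :=
    frequently_lt_of_liminf_lt (by isBoundedDefault)
      (ENNReal.lt_add_right hfin.ne (ENNReal.coe_ne_zero.2 hε'.ne'))
  refine limsup_le_of_le (by isBoundedDefault) ?_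
  filter_upwards [eventually_cInf_le hκ hB hB'' hfreq
    (ENNReal.add_ne_top.2 ⟨hfin.ne, ENNReal.coe_ne_top⟩) hε'] with M hM
  refine hM.trans (le_of_eq ?_)
  rw [add_assoc, ← ENNReal.coe_add]
  congr 2
  rw [← one_add_mul]
  have : (1 + 3 : ℝ≥0) = 4 := by norm_num
  rw [this, mul_div_cancel₀ _ (by norm_num)]

end Limit

end LatticeFlow

end

theorem proposition22 (κ : MeasureTheory.Measure ℝ≥0) [MeasureTheory.IsProbabilityMeasure κ]
    (cstar : ℝ≥0) (hcstar : 0 < cstar) (hκ : κ (Set.Icc 0 cstar) = 1)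
    (B : ℝ≥0) (hB : 1 / 4 < B) (B'' : ℝ≥0) (hB'' : B < B'') :
    Filter.limsup (fun M : ℕ => LatticeFlow.cInf κ M B'' / (M : ℝ≥0∞) ^ 2) Filter.atTop ≤
      Filter.liminf (fun N : ℕ => LatticeFlow.expTorusCost κ N B / (N : ℝ≥0∞) ^ 2)
        Filter.atTop := by
  refine LatticeFlow.limsup_cInf_le_liminf_expTorusCost (cs := cstar) ?_
    ((by positivity : (0 : ℝ≥0) < 1 / 4).trans hB) hB''
  filter_upwards [(MeasureTheory.mem_ae_iff_prob_eq_one measurableSet_Icc).2 hκ] with t ht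
  exact ht.2
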